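/- **Conventions.** All 2-categories and 2-functors are strict, and $\mathbf{CAT}$ is a 2-category of categories that contains all hom-categories of $\mathcal K$ and $\mathcal L$ below. *Lax slices.* For an object $M$ of a 2-category $\mathcal K$, the lax slice $\mathcal K/_{\mathrm{lax}}M$ has as objects the morphisms $g\colon X\to M$; a morphism from $g$ to $g'\colon X'\to M$ is a pair $(\hat\gamma,\gamma)$ with $\hat\gamma\colon X\to X'$ and $\gamma\colon g\Rightarrow g'\hat\gamma$; a 2-cell $(\hat\gamma,\gamma)\Rightarrow(\hat\xi,\xi)$ is a 2-cell $\delta\colon\hat\gamma\Rightarrow\hat\xi$ with $(g'\delta)\circ\gamma=\xi$. A morphism is *tight* if $\gamma$ is an identity. $\mathrm{dom}\colon\mathcal K/_{\mathrm{lax}}M\to\mathcal K$ is the domain 2-functor. *Oplax normal 2-cocones.* Let $\mathcal A$ be a small 2-category and $W\colon\mathcal A^{\mathrm{op}}\to\mathbf{CAT}$ a 2-functor. Its Grothendieck construction $\int W$ has objects $(A,X)$ with $X\in W(A)$, morphisms $(f,\alpha)\colon(A,X)\to(A',X')$ with $f\colon A\to A'$ and $\alpha\colon X\to W(f)(X')$,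 and 2-cells $(f,\alpha)\Rightarrow(g,\beta)$ the $\delta\colon f\Rightarrow g$ with $W(\delta)_{X'}\circ\alpha=\beta$. For a 2-functor $D\colon\int W\to\mathcal S$ and $C\in\mathcal S$, an oplax normal 2-cocone $\zeta$ for $D$ on $C$ consists of morphisms $\zeta_x\colon D(x)\to C$ and 2-cells $\zeta_u\colon\zeta_x\Rightarrow\zeta_y\circ D(u)$ for $u\colon x\to y$, compatible with identities, composition and 2-cells, and such that $\zeta_u$ is an identity whenever $u=(f,\mathrm{id})$. With modifications these form a category; $\zeta$ is *universal* if for every $Q\in\mathcal S$ composition with $\zeta$ is an isomorphism of categories from $\mathcal S(C,Q)$ to the category of oplax normal 2-cocones for $D$ on $Q$. A 2-functor $G$ sends $\zeta$ to an oplax normal 2-cocone $G\circ\zeta$ for $G\circ D$ on $G(C)$. *Dense 2-functors.* A 2-functor is *fully faithful* if it induces isomorphisms of hom-categories. For $J\colon\mathcal L\to\mathcal K$ let $\tilde J\colon\mathcal K\to[\mathcal L^{\mathrm{op}},\mathbf{CAT}]$ be the 2-functor $F\mapsto\mathcal K(J(-),F)$, where $[\mathcal L^{\mathrm{op}},\mathbf{CAT}]$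 is the 2-category of 2-functors, 2-natural transformations and modifications. $J$ is *dense* if $\tilde J$ is fully faithful. A 2-cocone $\zeta$ in $\mathcal K$ is *$J$-absolute* if $\tilde J\circ\zeta$ is universal. *Split opfibrations and change of base.* A morphism $\tau\colon E\to B$ of $\mathcal K$ is a split Grothendieck opfibration if every functor $\tau\circ-\colon\mathcal K(X,E)\to\mathcal K(X,B)$ is equipped with the structure of a split Grothendieck opfibration such that precomposition with every $h\colon X'\to X$ sends the chosen cocartesian lifts to the chosen cocartesian lifts. Suppose chosen, for every $F\colon A\to B$, a (strict 2-)pullback of $F$ along $\tau$, with projections $F^*\tau\colon P_F\to A$ and $\tau^*F\colon P_F\to E$. The 2-functor $\tau^*\colon\mathcal K/_{\mathrm{lax}}B\to\mathcal K/_{\mathrm{lax}}E$ sends $F$ to $\tau^*F$. It sends $(\hat\alpha,\alpha)\colon F\to F'$ to the triangle $(\widehat{\tau^*\alpha},\tau^*\alpha)$, where $\tau^*\alpha\colon\tau^*F\Rightarrow V$ is the chosen cocartesian lift of $\alpha F^*\tau\colon \tau\,\tau^*F=F\,F^*\tau\Rightarrow F'\hat\alpha F^*\tau$, and $\widehat{\tau^*\alpha}\colon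 P_F\to P_{F'}$ is determined by $\tau^*F'\circ\widehat{\tau^*\alpha}=V$ and $F'^*\tau\circ\widehat{\tau^*\alpha}=\hat\alpha\circ F^*\tau$. It sends a 2-cell $\delta\colon(\hat\alpha,\alpha)\Rightarrow(\hat\beta,\beta)$ to the unique 2-cell $\tau^*\delta\colon(\widehat{\tau^*\alpha},\tau^*\alpha)\Rightarrow(\widehat{\tau^*\beta},\tau^*\beta)$ of $\mathcal K/_{\mathrm{lax}}E$ with $F'^*\tau\,(\tau^*\delta)=\delta\, F^*\tau$. **Theorem.** Let $\mathcal K$ be a finitely complete 2-category, let $J\colon\mathcal L\to\mathcal K$ be a fully faithful dense 2-functor, and let $\tau\colon E\to B$ be a split Grothendieck opfibration in $\mathcal K$, with any choice of pullbacks along $\tau$. Let $\mathcal A$ be a small 2-category, $W\colon\mathcal A^{\mathrm{op}}\to\mathbf{CAT}$ a 2-functor, and $H\colon\int W\to\mathcal K/_{\mathrm{lax}}B$ a 2-functor that sends every morphism of the form $(f,\mathrm{id})$ to a tight morphism. Let $\zeta$ be a universal oplax normal 2-cocone for $H$ on an object $C$ of $\mathcal K/_{\mathrm{lax}}B$ such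 that every component $\zeta_{(A,X)}$ is tight and $\mathrm{dom}\circ\zeta$ is $J$-absolute. Then the oplax normal 2-cocone $\tau^*\circ\zeta$ for $\tau^*\circ H$ on $\tau^*(C)$ is universal. -/

import Mathlib

open CategoryTheory Bicategory Opposite

set_option linter.unusedSectionVars false
set_option linter.unusedVariables false

universe w v u w₁ v₁ u₁ w₂ v₂ u₂ w₃ v₃ u₃

-- Hom-types of a strict bicategory are always read off from its bicategory structure.
attribute [-instance] catToReflQuiver

namespace TwoCat

section Strictness

variable {K : Type u} [Bicategory.{w, v} K]

theorem whiskerLeft_heq {a b c : K} {f f' : a ⟶ b} (hf : f = f') {g g' h h' : b ⟶ c}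
    (hg : g = g') (hh : h = h') {η : g ⟶ h} {η' : g' ⟶ h'} (e : η ≍ η') :
    f ◁ η ≍ f' ◁ η' := by
  subst hf hg hh; rw [eq_of_heq e]

theorem whiskerRight_heq {a b c : K} {f f' g g' : a ⟶ b} (hf : f = f') (hg : g = g')
    {h h' : b ⟶ c} (hh : h = h') {η : f ⟶ g} {η' : f' ⟶ g'} (e : η ≍ η') :
    η ▷ h ≍ η' ▷ h' := by
  subst hf hg hh; rw [eq_of_heq e]

variable [Strict K]

theorem associator_hom {a b c d : K} (f : a ⟶ b) (g : b ⟶ c) (h : c ⟶ d) :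
    (α_ f g h).hom = eqToHom (Strict.assoc f g h) := by
  rw [Strict.associator_eqToIso]; rfl

theorem associator_inv {a b c d : K} (f : a ⟶ b) (g : b ⟶ c) (h : c ⟶ d) :
    (α_ f g h).inv = eqToHom (Strict.assoc f g h).symm := by
  rw [Strict.associator_eqToIso]; rfl

theorem leftUnitor_hom {a b : K} (f : a ⟶ b) : (λ_ f).hom = eqToHom (Strict.id_comp f) := by
  rw [Strict.leftUnitor_eqToIso]; rfl

theorem leftUnitor_inv {a b : K} (f : a ⟶ b) :
    (λ_ f).inv = eqToHom (Strict.id_comp f).symm := by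
  rw [Strict.leftUnitor_eqToIso]; rfl

theorem rightUnitor_hom {a b : K} (f : a ⟶ b) : (ρ_ f).hom = eqToHom (Strict.comp_id f) := by
  rw [Strict.rightUnitor_eqToIso]; rfl

theorem rightUnitor_inv {a b : K} (f : a ⟶ b) :
    (ρ_ f).inv = eqToHom (Strict.comp_id f).symm := by
  rw [Strict.rightUnitor_eqToIso]; rfl

theorem comp_whiskerLeft_heq {a b c d : K} (f : a ⟶ b) (g : b ⟶ c) {h k : c ⟶ d} (η : h ⟶ k) :
    (f ≫ g) ◁ η ≍ f ◁ g ◁ η := by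
  rw [Bicategory.comp_whiskerLeft, associator_hom, associator_inv]
  exact (eqToHom_comp_heq _ _).trans (comp_eqToHom_heq _ _)

theorem whiskerRight_comp_heq {a b c d : K} {f f' : a ⟶ b} (η : f ⟶ f') (g : b ⟶ c)
    (h : c ⟶ d) : η ▷ (g ≫ h) ≍ η ▷ g ▷ h := by
  rw [Bicategory.whiskerRight_comp, associator_hom, associator_inv]
  exact (eqToHom_comp_heq _ _).trans (comp_eqToHom_heq _ _)

theorem whisker_assoc_heq {a b c d : K} (f : a ⟶ b) {g g' : b ⟶ c} (η : g ⟶ g')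
    (h : c ⟶ d) : (f ◁ η) ▷ h ≍ f ◁ η ▷ h := by
  rw [Bicategory.whisker_assoc, associator_hom, associator_inv]
  exact (eqToHom_comp_heq _ _).trans (comp_eqToHom_heq _ _)

theorem id_whiskerLeft_heq {a b : K} {f g : a ⟶ b} (η : f ⟶ g) : 𝟙 a ◁ η ≍ η := by
  rw [Bicategory.id_whiskerLeft, leftUnitor_hom, leftUnitor_inv]
  exact (eqToHom_comp_heq _ _).trans (comp_eqToHom_heq _ _)

theorem whiskerRight_id_heq {a b : K} {f g : a ⟶ b} (η : f ⟶ g) : η ▷ 𝟙 b ≍ η := by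
  rw [Bicategory.whiskerRight_id, rightUnitor_hom, rightUnitor_inv]
  exact (eqToHom_comp_heq _ _).trans (comp_eqToHom_heq _ _)

end Strictness

/-! ### The lax slice -/

/-- An object of the lax slice of `K` over `M`: a morphism with codomain `M`. -/
structure LaxSlice (K : Type u) [Bicategory.{w, v} K] (M : K) where
  dom : K
  hom : dom ⟶ M

namespace LaxSlice

variable {K : Type u} [Bicategory.{w, v} K] {M : K}

/-- A morphism from `g : E ⟶ M` to `g' : E' ⟶ M` in the lax slice: a triangle
consisting of `map : E ⟶ E'` filled with a 2-cell from `g` to `g' ∘ map`. -/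
@[ext]
structure Hom (X Y : LaxSlice K M) where
  map : X.dom ⟶ Y.dom
  cell : X.hom ⟶ map ≫ Y.hom

/-- A 2-cell in the lax slice: a 2-cell of `K` compatible with the fillings of the triangles. -/
@[ext]
structure Hom₂ {X Y : LaxSlice K M} (f g : Hom X Y) where
  cell : f.map ⟶ g.map
  w : f.cell ≫ cell ▷ Y.hom = g.cell

instance categoryStruct : CategoryStruct (LaxSlice K M) where
  Hom := Hom
  id X := Hom.mk (𝟙 X.dom) (λ_ X.hom).inv
  comp {_ _ Z} f g :=
    Hom.mk (f.map ≫ g.map) (f.cell ≫ f.map ◁ g.cell ≫ (α_ f.map g.map Z.hom).inv)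

@[simp] theorem id_map (X : LaxSlice K M) : (𝟙 X : X ⟶ X).map = 𝟙 X.dom := rfl

@[simp] theorem id_cell (X : LaxSlice K M) : (𝟙 X : X ⟶ X).cell = (λ_ X.hom).inv := rfl

@[simp] theorem comp_map {X Y Z : LaxSlice K M} (f : X ⟶ Y) (g : Y ⟶ Z) :
    (f ≫ g).map = f.map ≫ g.map := rfl

@[simp] theorem comp_cell {X Y Z : LaxSlice K M} (f : X ⟶ Y) (g : Y ⟶ Z) :
    (f ≫ g).cell = f.cell ≫ f.map ◁ g.cell ≫ (α_ f.map g.map Z.hom).inv := rfl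

instance homCategory (X Y : LaxSlice K M) : Category (X ⟶ Y) where
  Hom f g := Hom₂ f g
  id f := Hom₂.mk (𝟙 f.map) (by simp)
  comp {_ _ _} η θ := Hom₂.mk (η.cell ≫ θ.cell) (by
    rw [Bicategory.comp_whiskerRight, ← Category.assoc, η.w, θ.w])
  id_comp _ := Hom₂.ext (Category.id_comp _)
  comp_id _ := Hom₂.ext (Category.comp_id _)
  assoc _ _ _ := Hom₂.ext (Category.assoc _ _ _)

@[ext]
theorem hom₂_ext {X Y : LaxSlice K M} {f g : X ⟶ Y} {η θ : f ⟶ g} (h : η.cell = θ.cell) :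
    η = θ := Hom₂.ext h

@[simp] theorem id₂_cell {X Y : LaxSlice K M} (f : X ⟶ Y) : (𝟙 f : f ⟶ f).cell = 𝟙 f.map := rfl

@[simp] theorem comp₂_cell {X Y : LaxSlice K M} {f g h : X ⟶ Y} (η : f ⟶ g) (θ : g ⟶ h) :
    (η ≫ θ).cell = η.cell ≫ θ.cell := rfl

@[simp] theorem hom₂_w {X Y : LaxSlice K M} {f g : X ⟶ Y} (η : f ⟶ g) :
    f.cell ≫ η.cell ▷ Y.hom = g.cell := η.w

/-- An invertible 2-cell of `K` that is compatible with the fillings of the triangles gives an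
invertible 2-cell of the lax slice. -/
@[simps]
def isoMk {X Y : LaxSlice K M} {f g : X ⟶ Y} (e : f.map ≅ g.map)
    (h : f.cell ≫ e.hom ▷ Y.hom = g.cell) : f ≅ g where
  hom := Hom₂.mk e.hom h
  inv := Hom₂.mk e.inv (by rw [← h]; simp)
  hom_inv_id := hom₂_ext e.hom_inv_id
  inv_hom_id := hom₂_ext e.inv_hom_id

/-- The bicategory structure of the lax slice; it is inherited from `K`. -/
instance bicategory : Bicategory (LaxSlice K M) where
  toCategoryStruct := categoryStruct
  homCategory := homCategory
  whiskerLeft f _ _ η := Hom₂.mk (f.map ◁ η.cell) (by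
    rw [comp_cell, comp_cell, ← η.w, Bicategory.whiskerLeft_comp]; simp)
  whiskerRight η h := Hom₂.mk (η.cell ▷ h.map) (by
    rw [comp_cell, comp_cell, ← η.w]
    simp only [comp_map, Category.assoc, ← associator_inv_naturality_left]
    rw [whisker_exchange_assoc])
  associator f g h := isoMk (α_ f.map g.map h.map) (by simp)
  leftUnitor f := isoMk (λ_ f.map) (by simp)
  rightUnitor f := isoMk (ρ_ f.map) (by simp)
  whiskerLeft_id _ _ := hom₂_ext (Bicategory.whiskerLeft_id _ _)
  whiskerLeft_comp _ _ _ _ _ _ := hom₂_ext (Bicategory.whiskerLeft_comp _ _ _)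
  id_whiskerLeft _ := hom₂_ext (Bicategory.id_whiskerLeft _)
  comp_whiskerLeft _ _ _ _ _ := hom₂_ext (Bicategory.comp_whiskerLeft _ _ _)
  id_whiskerRight _ _ := hom₂_ext (Bicategory.id_whiskerRight _ _)
  comp_whiskerRight _ _ _ := hom₂_ext (Bicategory.comp_whiskerRight _ _ _)
  whiskerRight_id _ := hom₂_ext (Bicategory.whiskerRight_id _)
  whiskerRight_comp _ _ _ := hom₂_ext (Bicategory.whiskerRight_comp _ _ _)
  whisker_assoc _ _ _ _ _ := hom₂_ext (Bicategory.whisker_assoc _ _ _)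
  whisker_exchange _ _ := hom₂_ext (Bicategory.whisker_exchange _ _)
  pentagon _ _ _ _ := hom₂_ext (Bicategory.pentagon _ _ _ _)
  triangle _ _ := hom₂_ext (Bicategory.triangle _ _)

@[simp] theorem whiskerLeft_cell {X Y Z : LaxSlice K M} (f : X ⟶ Y) {g h : Y ⟶ Z} (η : g ⟶ h) :
    (f ◁ η).cell = f.map ◁ η.cell := rfl

@[simp] theorem whiskerRight_cell {X Y Z : LaxSlice K M} {f g : X ⟶ Y} (η : f ⟶ g) (h : Y ⟶ Z) :
    (η ▷ h).cell = η.cell ▷ h.map := rfl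

theorem hom_ext' {X Y : LaxSlice K M} {f g : X ⟶ Y} (h : f.map = g.map)
    (h' : f.cell ≍ g.cell) : f = g := Hom.ext h h'

theorem eqToHom_cell {X Y : LaxSlice K M} {f g : X ⟶ Y} (h : f = g) :
    (eqToHom h).cell = eqToHom (congrArg Hom.map h) := by
  subst h; rfl

/-- The lax slice of a 2-category is a 2-category. -/
instance [Strict K] : Strict (LaxSlice K M) where
  id_comp f := hom_ext' (Strict.id_comp _) (by
    rw [comp_cell, id_cell, associator_inv, leftUnitor_inv]
    refine (eqToHom_comp_heq _ _).trans ((comp_eqToHom_heq _ _).trans (id_whiskerLeft_heq _)))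
  comp_id f := hom_ext' (Strict.comp_id _) (by
    rw [comp_cell, id_cell, associator_inv, leftUnitor_inv, whiskerLeft_eqToHom, eqToHom_trans]
    exact comp_eqToHom_heq _ _)
  assoc f g h := hom_ext' (Strict.assoc _ _ _) (by
    simp only [comp_cell, comp_map, associator_inv, Bicategory.whiskerLeft_comp,
      whiskerLeft_eqToHom, Category.assoc, eqToHom_trans]
    refine heq_comp rfl (by simp) (by simp) HEq.rfl ?_
    refine heq_comp rfl (by simp) (by simp) HEq.rfl ?_
    refine (eqToHom_comp_heq _ _).trans ?_
    refine (comp_eqToHom_heq _ _).trans ?_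
    exact (comp_whiskerLeft_heq _ _ _).trans (comp_eqToHom_heq _ _).symm)
  leftUnitor_eqToIso f := Iso.ext (hom₂_ext (by
    rw [eqToIso.hom, eqToHom_cell]; exact leftUnitor_hom _))
  rightUnitor_eqToIso f := Iso.ext (hom₂_ext (by
    rw [eqToIso.hom, eqToHom_cell]; exact rightUnitor_hom _))
  associator_eqToIso f g h := Iso.ext (hom₂_ext (by
    rw [eqToIso.hom, eqToHom_cell]; exact associator_hom _ _ _))

/-- The domain 2-functor from the lax slice. -/
def domFunctor (K : Type u) [Bicategory.{w, v} K] [Strict K] (M : K) :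
    StrictPseudofunctor (LaxSlice K M) K :=
  StrictPseudofunctor.mk''
    { obj X := X.dom
      map f := f.map
      map₂ η := η.cell
      map₂_id _ := rfl
      map₂_comp _ _ := rfl
      map_id _ := rfl
      map_comp _ _ := rfl
      map₂_whisker_left _ _ _ _ := by simp
      map₂_whisker_right _ _ := by simp }

/-- A morphism of the lax slice is tight if its triangle is filled with an identity. -/
def IsTight {X Y : LaxSlice K M} (f : X ⟶ Y) : Prop :=
  ∃ h : X.hom = f.map ≫ Y.hom, f.cell = eqToHom h

end LaxSlice

/-! ### The Grothendieck construction -/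

section Opposite

variable {A : Type u} [Bicategory.{w, v} A]

theorem eqToIso_op2 {a b : Aᵒᵖ} {f g : a ⟶ b} (h : f = g) :
    eqToIso h = Iso.op2_unop (eqToIso (congrArg Quiver.Hom.unop h)) := by
  subst h; rfl

/-- The 2-category obtained by reversing the 1-cells of a 2-category. -/
instance [Strict A] : Strict Aᵒᵖ where
  id_comp f := congrArg Quiver.Hom.op (Strict.comp_id f.unop)
  comp_id f := congrArg Quiver.Hom.op (Strict.id_comp f.unop)
  assoc f g h := congrArg Quiver.Hom.op (Strict.assoc h.unop g.unop f.unop).symm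
  leftUnitor_eqToIso f := by
    rw [eqToIso_op2]
    exact congrArg (fun e => Iso.op2_unop e) (Strict.rightUnitor_eqToIso f.unop)
  rightUnitor_eqToIso f := by
    rw [eqToIso_op2]
    exact congrArg (fun e => Iso.op2_unop e) (Strict.leftUnitor_eqToIso f.unop)
  associator_eqToIso f g h := by
    rw [eqToIso_op2]
    refine (congrArg (fun e => (Iso.op2_unop e).symm)
      (Strict.associator_eqToIso h.unop g.unop f.unop)).trans ?_
    exact Iso.ext (by simp)

end Opposite

/-- An object `(A, X)` of the Grothendieck construction of a 2-functor `W : Aᵒᵖ → Cat`, where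
`Aᵒᵖ` has reversed 1-cells. -/
structure Groth {A : Type u} [Bicategory.{w, v} A]
    (W : StrictPseudofunctor Aᵒᵖ Cat.{v₁, u₁}) where
  base : A
  fiber : W.obj (op base)

namespace Groth

open Bicategory.Opposite (op2)

variable {A : Type u} [Bicategory.{w, v} A] {W : StrictPseudofunctor Aᵒᵖ Cat.{v₁, u₁}}

/-- A morphism `(f, α)` from `(A, X)` to `(B, X')`: a morphism `f : A ⟶ B` and
a morphism `α : X ⟶ W(f)(X')`. -/
@[ext]
structure Hom (x y : Groth W) where
  base : x.base ⟶ y.base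
  fiber : x.fiber ⟶ (W.map base.op).toFunctor.obj y.fiber

/-- A 2-cell from `(f, α)` to `(g, β)`: a 2-cell `δ` from `f` to `g` such that
`W(δ)` at `X'` after `α` is `β`. -/
@[ext]
structure Hom₂ {x y : Groth W} (f g : Hom x y) where
  base : f.base ⟶ g.base
  w : f.fiber ≫ (W.map₂ (op2 base)).toNatTrans.app y.fiber = g.fiber

instance categoryStruct : CategoryStruct (Groth W) where
  Hom := Hom
  id x := Hom.mk (𝟙 x.base) ((W.mapId (op x.base)).inv.toNatTrans.app x.fiber)
  comp {_ _ z} f g := Hom.mk (f.base ≫ g.base)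
    (f.fiber ≫ (W.map f.base.op).toFunctor.map g.fiber ≫
      (W.mapComp g.base.op f.base.op).inv.toNatTrans.app z.fiber)

@[simp] theorem id_base (x : Groth W) : (𝟙 x : x ⟶ x).base = 𝟙 x.base := rfl

@[simp] theorem id_fiber (x : Groth W) :
    (𝟙 x : x ⟶ x).fiber = (W.mapId (op x.base)).inv.toNatTrans.app x.fiber := rfl

@[simp] theorem comp_base {x y z : Groth W} (f : x ⟶ y) (g : y ⟶ z) :
    (f ≫ g).base = f.base ≫ g.base := rfl

@[simp] theorem comp_fiber {x y z : Groth W} (f : x ⟶ y) (g : y ⟶ z) :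
    (f ≫ g).fiber = f.fiber ≫ (W.map f.base.op).toFunctor.map g.fiber ≫
      (W.mapComp g.base.op f.base.op).inv.toNatTrans.app z.fiber := rfl

instance homCategory (x y : Groth W) : Category (x ⟶ y) where
  Hom f g := Hom₂ f g
  id f := Hom₂.mk (𝟙 f.base) (by simp)
  comp {_ _ _} η θ := Hom₂.mk (η.base ≫ θ.base) (by
    rw [Bicategory.Opposite.op2_comp, PrelaxFunctor.map₂_comp, Cat.Hom₂.comp_app,
      ← Category.assoc, η.w, θ.w])
  id_comp _ := Hom₂.ext (Category.id_comp _)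
  comp_id _ := Hom₂.ext (Category.comp_id _)
  assoc _ _ _ := Hom₂.ext (Category.assoc _ _ _)

@[ext]
theorem hom₂_ext {x y : Groth W} {f g : x ⟶ y} {η θ : f ⟶ g} (h : η.base = θ.base) :
    η = θ := Hom₂.ext h

@[simp] theorem id₂_base {x y : Groth W} (f : x ⟶ y) : (𝟙 f : f ⟶ f).base = 𝟙 f.base := rfl

@[simp] theorem comp₂_base {x y : Groth W} {f g h : x ⟶ y} (η : f ⟶ g) (θ : g ⟶ h) :
    (η ≫ θ).base = η.base ≫ θ.base := rfl

/-- An invertible 2-cell of the base that is compatible with the fibre components gives an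
invertible 2-cell of the Grothendieck construction. -/
@[simps]
def isoMk {x y : Groth W} {f g : x ⟶ y} (e : f.base ≅ g.base)
    (h : f.fiber ≫ (W.map₂ (op2 e.hom)).toNatTrans.app y.fiber = g.fiber) : f ≅ g where
  hom := Hom₂.mk e.hom h
  inv := Hom₂.mk e.inv (by
    rw [← h, Category.assoc, ← Cat.Hom₂.comp_app, ← PrelaxFunctor.map₂_comp,
      ← Bicategory.Opposite.op2_comp, e.hom_inv_id]
    simp)
  hom_inv_id := hom₂_ext e.hom_inv_id
  inv_hom_id := hom₂_ext e.inv_hom_id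

theorem whiskerLeft_aux {x y z : Groth W} (f : x ⟶ y) {g h : y ⟶ z} (η : g ⟶ h) :
    (f ≫ g).fiber ≫ (W.map₂ (op2 (f.base ◁ η.base))).toNatTrans.app z.fiber =
      (f ≫ h).fiber := by
  have e := W.map₂_whisker_right (op2 η.base) f.base.op
  have hw := η.w
  rw [comp_fiber, comp_fiber, ← hw, Bicategory.Opposite.op2_whiskerLeft, e]
  simp

theorem whiskerRight_aux {x y z : Groth W} {f g : x ⟶ y} (η : f ⟶ g) (h : y ⟶ z) :
    (f ≫ h).fiber ≫ (W.map₂ (op2 (η.base ▷ h.base))).toNatTrans.app z.fiber =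
      (g ≫ h).fiber := by
  have e := W.map₂_whisker_left h.base.op (op2 η.base)
  have hw := η.w
  rw [comp_fiber, comp_fiber, ← hw, Bicategory.Opposite.op2_whiskerRight, e]
  simp

theorem associator_aux {x y z t : Groth W} (f : x ⟶ y) (g : y ⟶ z) (h : z ⟶ t) :
    ((f ≫ g) ≫ h).fiber ≫
      (W.map₂ (op2 (α_ f.base g.base h.base).hom)).toNatTrans.app t.fiber =
        (f ≫ g ≫ h).fiber := by
  have e := congrArg (fun s => s.toNatTrans.app t.fiber)
    (W.mapComp_assoc_left_inv h.base.op g.base.op f.base.op)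
  have n := (W.mapComp g.base.op f.base.op).inv.toNatTrans.naturality h.fiber
  simp only [comp_base, op_comp, comp_fiber, Category.assoc, Functor.map_comp]
  congr 2
  have e' : (W.map f.base.op).toFunctor.map
        ((W.mapComp h.base.op g.base.op).inv.toNatTrans.app t.fiber) ≫
      (W.mapComp (h.base.op ≫ g.base.op) f.base.op).inv.toNatTrans.app t.fiber =
      (W.mapComp g.base.op f.base.op).inv.toNatTrans.app _ ≫
        (W.mapComp h.base.op (g.base.op ≫ f.base.op)).inv.toNatTrans.app t.fiber ≫
        (W.map₂ (α_ h.base.op g.base.op f.base.op).inv).toNatTrans.app t.fiber := by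
    refine e.trans ?_
    change 𝟙 _ ≫ _ ≫ _ ≫ _ = _
    rw [Category.id_comp]
    rfl
  rw [e', ← Category.assoc, ← n]
  simp

theorem leftUnitor_aux {x y : Groth W} (f : x ⟶ y) :
    (𝟙 x ≫ f).fiber ≫ (W.map₂ (op2 (λ_ f.base).hom)).toNatTrans.app y.fiber = f.fiber := by
  simp

theorem rightUnitor_aux {x y : Groth W} (f : x ⟶ y) :
    (f ≫ 𝟙 y).fiber ≫ (W.map₂ (op2 (ρ_ f.base).hom)).toNatTrans.app y.fiber = f.fiber := by
  simp [← Functor.map_comp]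

/-- The bicategory structure of the Grothendieck construction. -/
instance bicategory : Bicategory (Groth W) where
  toCategoryStruct := categoryStruct
  homCategory := homCategory
  whiskerLeft f _ _ η := Hom₂.mk (f.base ◁ η.base) (whiskerLeft_aux f η)
  whiskerRight η h := Hom₂.mk (η.base ▷ h.base) (whiskerRight_aux η h)
  associator f g h := isoMk (α_ f.base g.base h.base) (associator_aux f g h)
  leftUnitor f := isoMk (λ_ f.base) (leftUnitor_aux f)
  rightUnitor f := isoMk (ρ_ f.base) (rightUnitor_aux f)
  whiskerLeft_id _ _ := hom₂_ext (Bicategory.whiskerLeft_id _ _)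
  whiskerLeft_comp _ _ _ _ _ _ := hom₂_ext (Bicategory.whiskerLeft_comp _ _ _)
  id_whiskerLeft _ := hom₂_ext (Bicategory.id_whiskerLeft _)
  comp_whiskerLeft _ _ _ _ _ := hom₂_ext (Bicategory.comp_whiskerLeft _ _ _)
  id_whiskerRight _ _ := hom₂_ext (Bicategory.id_whiskerRight _ _)
  comp_whiskerRight _ _ _ := hom₂_ext (Bicategory.comp_whiskerRight _ _ _)
  whiskerRight_id _ := hom₂_ext (Bicategory.whiskerRight_id _)
  whiskerRight_comp _ _ _ := hom₂_ext (Bicategory.whiskerRight_comp _ _ _)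
  whisker_assoc _ _ _ _ _ := hom₂_ext (Bicategory.whisker_assoc _ _ _)
  whisker_exchange _ _ := hom₂_ext (Bicategory.whisker_exchange _ _)
  pentagon _ _ _ _ := hom₂_ext (Bicategory.pentagon _ _ _ _)
  triangle _ _ := hom₂_ext (Bicategory.triangle _ _)

theorem eqToHom_base {x y : Groth W} {f g : x ⟶ y} (h : f = g) :
    (eqToHom h).base = eqToHom (congrArg Hom.base h) := by
  subst h; rfl

theorem hom_ext_of_eqToHom {x y : Groth W} {f g : x ⟶ y} (h : f.base = g.base)
    (w : f.fiber ≫ (W.map₂ (op2 (eqToHom h))).toNatTrans.app y.fiber = g.fiber) : f = g := by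
  obtain ⟨b, φ⟩ := f
  obtain ⟨b', φ'⟩ := g
  change b = b' at h
  subst h
  refine Hom.ext rfl (heq_of_eq ?_)
  simpa using w

/-- The Grothendieck construction is a 2-category. -/
instance [Strict A] : Strict (Groth W) where
  id_comp f := hom_ext_of_eqToHom (Strict.id_comp f.base) (by
    rw [← leftUnitor_hom]; exact leftUnitor_aux f)
  comp_id f := hom_ext_of_eqToHom (Strict.comp_id f.base) (by
    rw [← rightUnitor_hom]; exact rightUnitor_aux f)
  assoc f g h := hom_ext_of_eqToHom (Strict.assoc f.base g.base h.base) (by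
    rw [← associator_hom]; exact associator_aux f g h)
  leftUnitor_eqToIso f := Iso.ext (hom₂_ext (by
    rw [eqToIso.hom, eqToHom_base]; exact leftUnitor_hom _))
  rightUnitor_eqToIso f := Iso.ext (hom₂_ext (by
    rw [eqToIso.hom, eqToHom_base]; exact rightUnitor_hom _))
  associator_eqToIso f g h := Iso.ext (hom₂_ext (by
    rw [eqToIso.hom, eqToHom_base]; exact associator_hom _ _ _))

/-- The morphisms of the form `(f, id)`: the morphisms of the cleavage of the projection. -/
def IsCleavage {x y : Groth W} (f : x ⟶ y) : Prop :=
  ∃ h : x.fiber = (W.map f.base.op).toFunctor.obj y.fiber, f.fiber = eqToHom h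

end Groth

/-! ### Oplax normal 2-cocones and their universality -/

section Cocone

variable {A : Type u₁} [Bicategory.{w₁, v₁} A] {W : StrictPseudofunctor Aᵒᵖ Cat.{v₂, u₂}}
  {S : Type u} [Bicategory.{w, v} S] [Strict S]

/-- An oplax normal 2-cocone on `C` for a 2-diagram `D` indexed by the Grothendieck construction
of `W`, that is, an oplax normal natural transformation from the constant 2-functor at the
terminal category to the hom 2-functor from `D(-)` to `C`: it has components `app x : D x ⟶ C` and
structure 2-cells `cell f` from `app x` to `app y ∘ D f`, which are identities on the morphisms
of the form `(f, id)`. -/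
@[ext]
structure OplaxNormalCocone (D : StrictPseudofunctor (Groth W) S) (C : S) where
  app (x : Groth W) : D.obj x ⟶ C
  cell {x y : Groth W} (f : x ⟶ y) : app x ⟶ D.map f ≫ app y
  cell_id (x : Groth W) :
    cell (𝟙 x) = eqToHom (by rw [D.map_id, Strict.id_comp])
  cell_comp {x y z : Groth W} (f : x ⟶ y) (g : y ⟶ z) :
    cell (f ≫ g) = cell f ≫ D.map f ◁ cell g ≫
      eqToHom (by rw [D.map_comp, Strict.assoc])
  cell_naturality {x y : Groth W} {f g : x ⟶ y} (δ : f ⟶ g) :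
    cell f ≫ D.map₂ δ ▷ app y = cell g
  normal {x y : Groth W} (f : x ⟶ y) (hf : Groth.IsCleavage f) :
    ∃ h : app x = D.map f ≫ app y, cell f = eqToHom h

namespace OplaxNormalCocone

variable {D : StrictPseudofunctor (Groth W) S} {C : S}

/-- A modification between oplax normal 2-cocones. -/
@[ext]
structure Hom (σ ρ : OplaxNormalCocone D C) where
  app (x : Groth W) : σ.app x ⟶ ρ.app x
  naturality {x y : Groth W} (f : x ⟶ y) :
    σ.cell f ≫ D.map f ◁ app y = app x ≫ ρ.cell f

instance category : Category (OplaxNormalCocone D C) where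
  Hom := Hom
  id σ := Hom.mk (fun x => 𝟙 (σ.app x)) (fun f => by simp)
  comp Γ Θ := Hom.mk (fun x => Γ.app x ≫ Θ.app x) (fun f => by
    rw [Bicategory.whiskerLeft_comp, ← Category.assoc, Γ.naturality, Category.assoc,
      Θ.naturality, Category.assoc])
  id_comp _ := Hom.ext (funext fun _ => Category.id_comp _)
  comp_id _ := Hom.ext (funext fun _ => Category.comp_id _)
  assoc _ _ _ := Hom.ext (funext fun _ => Category.assoc _ _ _)

/-- The oplax normal 2-cocone obtained by postcomposing with a morphism `q : C ⟶ Q`. -/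
def postcompObj (ζ : OplaxNormalCocone D C) {Q : S} (q : C ⟶ Q) : OplaxNormalCocone D Q where
  app x := ζ.app x ≫ q
  cell {x y} f := ζ.cell f ▷ q ≫ (α_ (D.map f) (ζ.app y) q).hom
  cell_id x := by
    rw [ζ.cell_id, associator_hom, eqToHom_whiskerRight, eqToHom_trans]
  cell_comp f g := by
    rw [ζ.cell_comp]
    simp only [associator_hom, Bicategory.comp_whiskerRight, Bicategory.whisker_assoc,
      associator_inv, eqToHom_whiskerRight, eqToHom_trans, Category.assoc,
      Bicategory.whiskerLeft_comp, whiskerLeft_eqToHom]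
  cell_naturality {x y f g} δ := by
    rw [← ζ.cell_naturality δ, Category.assoc, ← associator_naturality_left,
      Bicategory.comp_whiskerRight]
    exact (Category.assoc _ _ _).symm
  normal {x y} f hf := by
    obtain ⟨h, e⟩ := ζ.normal f hf
    refine ⟨by rw [h, Strict.assoc], ?_⟩
    rw [e, associator_hom, eqToHom_whiskerRight, eqToHom_trans]

/-- Postcomposition with an oplax normal 2-cocone `ζ` on `C`, as a functor from the category of
morphisms `C ⟶ Q` to the category of oplax normal 2-cocones on `Q`. -/
def postcomp (ζ : OplaxNormalCocone D C) (Q : S) :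
    (C ⟶ Q) ⥤ OplaxNormalCocone D Q where
  obj q := ζ.postcompObj q
  map η := Hom.mk (fun x => ζ.app x ◁ η) (fun {x y} f => by
    simp only [postcompObj, Category.assoc, ← associator_naturality_right]
    rw [whisker_exchange_assoc])
  map_id q := Hom.ext (funext fun _ => Bicategory.whiskerLeft_id _ _)
  map_comp η θ := Hom.ext (funext fun _ => Bicategory.whiskerLeft_comp _ _ _)

/-- An oplax normal 2-cocone on `C` is universal, exhibiting `C` as the oplax normal conical
2-colimit of `D`, if postcomposition with it is an isomorphism of categories for every `Q`,
between the category of morphisms `C ⟶ Q` and that of oplax normal 2-cocones on `Q`. -/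
def IsUniversal (ζ : OplaxNormalCocone D C) : Prop :=
  ∀ Q : S, Function.Bijective (ζ.postcomp Q).obj ∧
    (ζ.postcomp Q).Full ∧ (ζ.postcomp Q).Faithful

variable {T : Type u₃} [Bicategory.{w₃, v₃} T] [Strict T]

theorem map_cell_id (F : StrictPseudofunctor S T) (ζ : OplaxNormalCocone D C) (x : Groth W)
    (h : F.map (ζ.app x) = F.map (D.map (𝟙 x)) ≫ F.map (ζ.app x)) :
    F.map₂ (ζ.cell (𝟙 x)) ≫ eqToHom (F.map_comp (D.map (𝟙 x)) (ζ.app x)) = eqToHom h := by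
  rw [ζ.cell_id, PrelaxFunctor.map₂_eqToHom, eqToHom_trans]

theorem map_cell_comp (F : StrictPseudofunctor S T) (ζ : OplaxNormalCocone D C)
    {x y z : Groth W} (f : x ⟶ y) (g : y ⟶ z)
    (h : F.map (D.map f) ≫ F.map (D.map g) ≫ F.map (ζ.app z) =
      F.map (D.map (f ≫ g)) ≫ F.map (ζ.app z)) :
    F.map₂ (ζ.cell (f ≫ g)) ≫ eqToHom (F.map_comp (D.map (f ≫ g)) (ζ.app z)) =
      (F.map₂ (ζ.cell f) ≫ eqToHom (F.map_comp (D.map f) (ζ.app y))) ≫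
        F.map (D.map f) ◁
          (F.map₂ (ζ.cell g) ≫ eqToHom (F.map_comp (D.map g) (ζ.app z))) ≫ eqToHom h := by
  rw [ζ.cell_comp, PrelaxFunctor.map₂_comp, PrelaxFunctor.map₂_comp,
    PrelaxFunctor.map₂_eqToHom, F.map₂_whisker_left, F.mapComp_eq_eqToIso,
    F.mapComp_eq_eqToIso]
  simp only [eqToIso.hom, eqToIso.inv, Bicategory.whiskerLeft_comp, whiskerLeft_eqToHom,
    eqToHom_trans, Category.assoc]

theorem map_cell_naturality (F : StrictPseudofunctor S T) (ζ : OplaxNormalCocone D C)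
    {x y : Groth W} {f g : x ⟶ y} (δ : f ⟶ g) :
    (F.map₂ (ζ.cell f) ≫ eqToHom (F.map_comp (D.map f) (ζ.app y))) ≫
      F.map₂ (D.map₂ δ) ▷ F.map (ζ.app y) =
        F.map₂ (ζ.cell g) ≫ eqToHom (F.map_comp (D.map g) (ζ.app y)) := by
  rw [← ζ.cell_naturality δ, PrelaxFunctor.map₂_comp, F.map₂_whisker_right,
    F.mapComp_eq_eqToIso, F.mapComp_eq_eqToIso]
  simp

theorem map_normal (F : StrictPseudofunctor S T) (ζ : OplaxNormalCocone D C)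
    {x y : Groth W} (f : x ⟶ y) (hf : Groth.IsCleavage f) :
    ∃ h : F.map (ζ.app x) = F.map (D.map f) ≫ F.map (ζ.app y),
      F.map₂ (ζ.cell f) ≫ eqToHom (F.map_comp (D.map f) (ζ.app y)) = eqToHom h := by
  obtain ⟨h, e⟩ := ζ.normal f hf
  refine ⟨by rw [h, F.map_comp], ?_⟩
  rw [e, PrelaxFunctor.map₂_eqToHom, eqToHom_trans]

/-- The image `F ∘ ζ` of an oplax normal 2-cocone `ζ` under a 2-functor `F`. -/
def map (F : StrictPseudofunctor S T) (ζ : OplaxNormalCocone D C) :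
    OplaxNormalCocone (D.comp F) (F.obj C) where
  app x := F.map (ζ.app x)
  cell {x y} f := F.map₂ (ζ.cell f) ≫ eqToHom (F.map_comp (D.map f) (ζ.app y))
  cell_id x := map_cell_id F ζ x _
  cell_comp f g := map_cell_comp F ζ f g _
  cell_naturality δ := map_cell_naturality F ζ δ
  normal f hf := map_normal F ζ f hf

end OplaxNormalCocone

end Cocone

/-! ### 2-categories of 2-functors -/

section FunctorCategory

variable {B : Type u₁} [Bicategory.{w₁, v₁} B] {C : Type u₂} [Bicategory.{w₂, v₂} C]

/-- A (strict) 2-natural transformation between 2-functors. The heterogeneous equality compares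
2-cells whose domains and whose codomains are equal by `naturality`. -/
@[ext]
structure TwoNatTrans (F G : StrictPseudofunctor B C) where
  app (a : B) : F.obj a ⟶ G.obj a
  naturality {a b : B} (f : a ⟶ b) : F.map f ≫ app b = app a ≫ G.map f
  naturality₂ {a b : B} {f g : a ⟶ b} (η : f ⟶ g) : F.map₂ η ▷ app b ≍ app a ◁ G.map₂ η

/-- A modification between 2-natural transformations. The heterogeneous equality compares
2-cells whose domains and whose codomains are equal by the naturality of `η` and `θ`. -/
@[ext]
structure TwoModification {F G : StrictPseudofunctor B C} (η θ : TwoNatTrans F G) where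
  app (a : B) : η.app a ⟶ θ.app a
  naturality {a b : B} (f : a ⟶ b) : F.map f ◁ app b ≍ app a ▷ G.map f

theorem eqToHom_heq_eqToHom {D : Type u} [Category.{v} D] {a b a' b' : D} (h : a = b)
    (h' : a' = b') (e : a = a') : eqToHom h ≍ eqToHom h' := by
  subst h h' e; rfl

namespace TwoFunctor

section

variable {F G : StrictPseudofunctor B C}

instance homCategory (F G : StrictPseudofunctor B C) : Category (TwoNatTrans F G) where
  Hom η θ := TwoModification η θ
  id η := TwoModification.mk (fun a => 𝟙 (η.app a)) (fun {a b} f => by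
    rw [Bicategory.whiskerLeft_id, Bicategory.id_whiskerRight, η.naturality])
  comp {η θ κ} Γ Θ := TwoModification.mk (fun a => Γ.app a ≫ Θ.app a) (fun f => by
    rw [Bicategory.whiskerLeft_comp, Bicategory.comp_whiskerRight]
    exact heq_comp (η.naturality f) (θ.naturality f) (κ.naturality f)
      (Γ.naturality f) (Θ.naturality f))
  id_comp _ := TwoModification.ext (funext fun _ => Category.id_comp _)
  comp_id _ := TwoModification.ext (funext fun _ => Category.comp_id _)
  assoc _ _ _ := TwoModification.ext (funext fun _ => Category.assoc _ _ _)

@[simp] theorem id_app₂ (η : TwoNatTrans F G) (a : B) :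
    TwoModification.app (𝟙 η) a = 𝟙 (η.app a) := rfl

@[simp] theorem comp_app₂ {η θ κ : TwoNatTrans F G} (Γ : η ⟶ θ) (Θ : θ ⟶ κ) (a : B) :
    TwoModification.app (Γ ≫ Θ) a = Γ.app a ≫ Θ.app a := rfl

theorem modification_ext {η θ : TwoNatTrans F G} {Γ Θ : η ⟶ θ}
    (h : ∀ a, Γ.app a = Θ.app a) : Γ = Θ := TwoModification.ext (funext h)

theorem eqToHom_app₂ {η θ : TwoNatTrans F G} (h : η = θ) (a : B) :
    TwoModification.app (eqToHom h) a = eqToHom (congrArg (fun t => t.app a) h) := by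
  subst h; rfl

/-- An invertible modification from its components. -/
@[simps]
def isoMk {η θ : TwoNatTrans F G} (e : ∀ a, η.app a ≅ θ.app a)
    (h : ∀ {a b : B} (f : a ⟶ b), F.map f ◁ (e b).hom ≍ (e a).hom ▷ G.map f)
    (h' : ∀ {a b : B} (f : a ⟶ b), F.map f ◁ (e b).inv ≍ (e a).inv ▷ G.map f) : η ≅ θ where
  hom := TwoModification.mk (fun a => (e a).hom) h
  inv := TwoModification.mk (fun a => (e a).inv) h'
  hom_inv_id := modification_ext fun a => (e a).hom_inv_id
  inv_hom_id := modification_ext fun a => (e a).inv_hom_id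

end

variable [Strict C]

instance categoryStruct : CategoryStruct (StrictPseudofunctor B C) where
  Hom := TwoNatTrans
  id F := TwoNatTrans.mk (fun a => 𝟙 (F.obj a))
    (fun f => (Strict.comp_id _).trans (Strict.id_comp _).symm)
    (fun η => (whiskerRight_id_heq _).trans (id_whiskerLeft_heq _).symm)
  comp {F G H} η θ := TwoNatTrans.mk (fun a => η.app a ≫ θ.app a)
    (fun f => by
      rw [← Strict.assoc, η.naturality, Strict.assoc, θ.naturality, Strict.assoc])
    (fun {a b f g} δ => (whiskerRight_comp_heq _ _ _).trans <|
      (whiskerRight_heq (η.naturality f) (η.naturality g) rfl (η.naturality₂ δ)).trans <|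
      (whisker_assoc_heq _ _ _).trans <|
      (whiskerLeft_heq rfl (θ.naturality f) (θ.naturality g) (θ.naturality₂ δ)).trans
      (comp_whiskerLeft_heq _ _ _).symm)

@[simp] theorem id_app (F : StrictPseudofunctor B C) (a : B) :
    TwoNatTrans.app (𝟙 F) a = 𝟙 (F.obj a) := rfl

@[simp] theorem comp_app {F G H : StrictPseudofunctor B C} (η : F ⟶ G) (θ : G ⟶ H) (a : B) :
    TwoNatTrans.app (η ≫ θ) a = η.app a ≫ θ.app a := rfl

/-- The bicategory structure on 2-functors, 2-natural transformations and modifications. -/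
instance bicategory : Bicategory (StrictPseudofunctor B C) where
  toCategoryStruct := categoryStruct
  homCategory := homCategory
  whiskerLeft {F G H} η {θ κ} Γ := TwoModification.mk (fun a => η.app a ◁ Γ.app a)
    (fun {a b} f => (comp_whiskerLeft_heq _ _ _).symm.trans <|
      (whiskerLeft_heq (η.naturality f) rfl rfl HEq.rfl).trans <|
      (comp_whiskerLeft_heq _ _ _).trans <|
      (whiskerLeft_heq rfl (θ.naturality f) (κ.naturality f) (Γ.naturality f)).trans
      (whisker_assoc_heq _ _ _).symm)
  whiskerRight {F G H η θ} Γ κ := TwoModification.mk (fun a => Γ.app a ▷ κ.app a)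
    (fun {a b} f => (whisker_assoc_heq _ _ _).symm.trans <|
      (whiskerRight_heq (η.naturality f) (θ.naturality f) rfl (Γ.naturality f)).trans <|
      (whiskerRight_comp_heq _ _ _).symm.trans <|
      (whiskerRight_heq rfl rfl (κ.naturality f) HEq.rfl).trans
      (whiskerRight_comp_heq _ _ _))
  associator {F G H I} η θ κ := isoMk (fun a => α_ (η.app a) (θ.app a) (κ.app a))
    (fun {a b} f => by
      rw [associator_hom, associator_hom, whiskerLeft_eqToHom, eqToHom_whiskerRight]
      exact eqToHom_heq_eqToHom _ _ (((η ≫ θ) ≫ κ).naturality f))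
    (fun {a b} f => by
      rw [associator_inv, associator_inv, whiskerLeft_eqToHom, eqToHom_whiskerRight]
      exact eqToHom_heq_eqToHom _ _ ((η ≫ θ ≫ κ).naturality f))
  leftUnitor {F G} η := isoMk (fun a => λ_ (η.app a))
    (fun {a b} f => by
      rw [leftUnitor_hom, leftUnitor_hom, whiskerLeft_eqToHom, eqToHom_whiskerRight]
      exact eqToHom_heq_eqToHom _ _ ((𝟙 F ≫ η).naturality f))
    (fun {a b} f => by
      rw [leftUnitor_inv, leftUnitor_inv, whiskerLeft_eqToHom, eqToHom_whiskerRight]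
      exact eqToHom_heq_eqToHom _ _ (η.naturality f))
  rightUnitor {F G} η := isoMk (fun a => ρ_ (η.app a))
    (fun {a b} f => by
      rw [rightUnitor_hom, rightUnitor_hom, whiskerLeft_eqToHom, eqToHom_whiskerRight]
      exact eqToHom_heq_eqToHom _ _ ((η ≫ 𝟙 G).naturality f))
    (fun {a b} f => by
      rw [rightUnitor_inv, rightUnitor_inv, whiskerLeft_eqToHom, eqToHom_whiskerRight]
      exact eqToHom_heq_eqToHom _ _ (η.naturality f))
  whiskerLeft_id _ _ := modification_ext fun _ => Bicategory.whiskerLeft_id _ _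
  whiskerLeft_comp _ _ _ _ _ _ := modification_ext fun _ => Bicategory.whiskerLeft_comp _ _ _
  id_whiskerLeft _ := modification_ext fun _ => Bicategory.id_whiskerLeft _
  comp_whiskerLeft _ _ _ _ _ := modification_ext fun _ => Bicategory.comp_whiskerLeft _ _ _
  id_whiskerRight _ _ := modification_ext fun _ => Bicategory.id_whiskerRight _ _
  comp_whiskerRight _ _ _ := modification_ext fun _ => Bicategory.comp_whiskerRight _ _ _
  whiskerRight_id _ := modification_ext fun _ => Bicategory.whiskerRight_id _
  whiskerRight_comp _ _ _ := modification_ext fun _ => Bicategory.whiskerRight_comp _ _ _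
  whisker_assoc _ _ _ _ _ := modification_ext fun _ => Bicategory.whisker_assoc _ _ _
  whisker_exchange _ _ := modification_ext fun _ => Bicategory.whisker_exchange _ _
  pentagon _ _ _ _ := modification_ext fun _ => Bicategory.pentagon _ _ _ _
  triangle _ _ := modification_ext fun _ => Bicategory.triangle _ _

@[simp] theorem whiskerLeft_app₂ {F G H : StrictPseudofunctor B C} (η : F ⟶ G) {θ κ : G ⟶ H}
    (Γ : θ ⟶ κ) (a : B) : (η ◁ Γ).app a = η.app a ◁ Γ.app a := rfl

@[simp] theorem whiskerRight_app₂ {F G H : StrictPseudofunctor B C} {η θ : F ⟶ G}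
    (Γ : η ⟶ θ) (κ : G ⟶ H) (a : B) : (Γ ▷ κ).app a = Γ.app a ▷ κ.app a := rfl

theorem modification_heq {F G : StrictPseudofunctor B C} {η θ η' θ' : F ⟶ G} (hη : η = η')
    (hθ : θ = θ') {Γ : η ⟶ θ} {Γ' : η' ⟶ θ'} (h : ∀ a, Γ.app a ≍ Γ'.app a) : Γ ≍ Γ' := by
  subst hη hθ
  exact heq_of_eq (modification_ext fun a => eq_of_heq (h a))

theorem twoNatTrans_ext {F G : StrictPseudofunctor B C} {η θ : F ⟶ G}
    (h : ∀ a, η.app a = θ.app a) : η = θ := TwoNatTrans.ext (funext h)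

/-- 2-functors, 2-natural transformations and modifications form a 2-category. -/
instance : Strict (StrictPseudofunctor B C) where
  id_comp η := twoNatTrans_ext fun _ => Strict.id_comp _
  comp_id η := twoNatTrans_ext fun _ => Strict.comp_id _
  assoc _ _ _ := twoNatTrans_ext fun _ => Strict.assoc _ _ _
  leftUnitor_eqToIso η := Iso.ext (modification_ext fun a => by
    rw [eqToIso.hom, eqToHom_app₂]; exact leftUnitor_hom _)
  rightUnitor_eqToIso η := Iso.ext (modification_ext fun a => by
    rw [eqToIso.hom, eqToHom_app₂]; exact rightUnitor_hom _)
  associator_eqToIso _ _ _ := Iso.ext (modification_ext fun a => by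
    rw [eqToIso.hom, eqToHom_app₂]; exact associator_hom _ _ _)

end TwoFunctor

/-- A 2-functor is fully faithful if it induces isomorphisms between hom-categories. -/
def IsFullyFaithful (F : StrictPseudofunctor B C) : Prop :=
  ∀ x y : B, Function.Bijective (fun f : x ⟶ y => F.map f) ∧
    ∀ f g : x ⟶ y, Function.Bijective (fun η : f ⟶ g => F.map₂ η)

end FunctorCategory

/-! ### Dense 2-functors and absolute 2-colimits -/

section Dense

variable {K : Type u} [Bicategory.{v, v} K] [Strict K] {L : Type u₁} [Bicategory.{v, v} L]
  [Strict L]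

open Bicategory.Opposite (op2)

theorem eq_conj_of_heq {D : Type u} [Category.{v} D] {a b a' b' : D} {f : a ⟶ b} {g : a' ⟶ b'}
    (h : f ≍ g) (ha : a = a') (hb : b = b') : f = eqToHom ha ≫ g ≫ eqToHom hb.symm :=
  (conj_eqToHom_iff_heq _ _ ha hb).2 h

theorem cat_hom_ext {X Y : Cat.{v₁, u₁}} {F G : X ⟶ Y}
    (h : ∀ x, F.toFunctor.obj x = G.toFunctor.obj x)
    (h' : ∀ {x y : X} (f : x ⟶ y), F.toFunctor.map f ≍ G.toFunctor.map f) : F = G :=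
  Cat.Hom.ext (CategoryTheory.Functor.hext h fun _ _ f => h' f)

theorem cat_hom₂_heq {X Y : Cat.{v₁, u₁}} {F G F' G' : X ⟶ Y} (hF : F = F') (hG : G = G')
    {η : F ⟶ G} {η' : F' ⟶ G'} (h : ∀ x, η.toNatTrans.app x ≍ η'.toNatTrans.app x) :
    η ≍ η' := by
  subst hF hG
  exact heq_of_eq (Cat.Hom₂.ext (NatTrans.ext (funext fun x => eq_of_heq (h x))))

/-- Precomposition with a morphism, as a functor between hom-categories. -/
@[simps]
def precompFunctor {a b : K} (f : a ⟶ b) (c : K) : (b ⟶ c) ⥤ (a ⟶ c) where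
  obj g := f ≫ g
  map η := f ◁ η

/-- Postcomposition with a morphism, as a functor between hom-categories. -/
@[simps]
def postcompFunctor (a : K) {b c : K} (h : b ⟶ c) : (a ⟶ b) ⥤ (a ⟶ c) where
  obj g := g ≫ h
  map η := η ▷ h

theorem map₂_whiskerLeft_heq (J : StrictPseudofunctor L K) {a b c : L} (f : a ⟶ b)
    {g g' : b ⟶ c} (η : g ⟶ g') : J.map₂ (f ◁ η) ≍ J.map f ◁ J.map₂ η := by
  rw [J.map₂_whisker_left, J.mapComp_eq_eqToIso, J.mapComp_eq_eqToIso, eqToIso.hom,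
    eqToIso.inv]
  exact (eqToHom_comp_heq _ _).trans (comp_eqToHom_heq _ _)

theorem map₂_whiskerRight_heq (J : StrictPseudofunctor L K) {a b c : L} {f f' : a ⟶ b}
    (η : f ⟶ f') (g : b ⟶ c) : J.map₂ (η ▷ g) ≍ J.map₂ η ▷ J.map g := by
  rw [J.map₂_whisker_right, J.mapComp_eq_eqToIso, J.mapComp_eq_eqToIso, eqToIso.hom,
    eqToIso.inv]
  exact (eqToHom_comp_heq _ _).trans (comp_eqToHom_heq _ _)

section

variable (J : StrictPseudofunctor L K) (F : K)

/-- Precomposition with `J f`, as a morphism of categories. -/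
abbrev nerveMap {l l' : Lᵒᵖ} (f : l ⟶ l') :
    Cat.of (J.obj l.unop ⟶ F) ⟶ Cat.of (J.obj l'.unop ⟶ F) :=
  (precompFunctor (J.map f.unop) F).toCatHom

/-- The natural transformation induced by `J δ` between precomposition functors. -/
abbrev nerveMap₂ {l l' : Lᵒᵖ} {f g : l ⟶ l'} (δ : f ⟶ g) :
    nerveMap J F f ⟶ nerveMap J F g :=
  NatTrans.toCatHom₂
    { app := fun x => J.map₂ δ.unop2 ▷ x
      naturality := fun x y η => whisker_exchange _ _ }

theorem nerveMap_id (l : Lᵒᵖ) : nerveMap J F (𝟙 l) = 𝟙 (Cat.of (J.obj l.unop ⟶ F)) :=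
  cat_hom_ext (fun x => (congrArg (· ≫ x) (J.map_id l.unop)).trans (Strict.id_comp x))
    (fun f => (whiskerLeft_heq (J.map_id l.unop) rfl rfl HEq.rfl).trans (id_whiskerLeft_heq f))

theorem nerveMap_comp {l l' l'' : Lᵒᵖ} (f : l ⟶ l') (g : l' ⟶ l'') :
    nerveMap J F (f ≫ g) = nerveMap J F f ≫ nerveMap J F g :=
  cat_hom_ext (fun x => (congrArg (· ≫ x) (J.map_comp g.unop f.unop)).trans (Strict.assoc _ _ _))
    (fun φ => (whiskerLeft_heq (J.map_comp g.unop f.unop) rfl rfl HEq.rfl).trans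
      (comp_whiskerLeft_heq _ _ _))

theorem nerveMap₂_whiskerLeft {l l' l'' : Lᵒᵖ} (f : l ⟶ l') {g g' : l' ⟶ l''} (δ : g ⟶ g') :
    nerveMap₂ J F (f ◁ δ) ≍ nerveMap J F f ◁ nerveMap₂ J F δ :=
  cat_hom₂_heq (nerveMap_comp J F f g) (nerveMap_comp J F f g') (fun x =>
    (whiskerRight_heq (J.map_comp _ _) (J.map_comp _ _) rfl
      (map₂_whiskerRight_heq J δ.unop2 f.unop)).trans (whiskerRight_comp_heq _ _ _).symm)

theorem nerveMap₂_whiskerRight {l l' l'' : Lᵒᵖ} {f f' : l ⟶ l'} (δ : f ⟶ f') (g : l' ⟶ l'') :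
    nerveMap₂ J F (δ ▷ g) ≍ nerveMap₂ J F δ ▷ nerveMap J F g :=
  cat_hom₂_heq (nerveMap_comp J F f g) (nerveMap_comp J F f' g) (fun x =>
    (whiskerRight_heq (J.map_comp _ _) (J.map_comp _ _) rfl
      (map₂_whiskerLeft_heq J g.unop δ.unop2)).trans (whisker_assoc_heq _ _ _))

/-- The 2-presheaf `K(J-, F)` on `L`. -/
def nerveObj : StrictPseudofunctor Lᵒᵖ Cat.{v, v} :=
  StrictPseudofunctor.mk''
    { obj l := Cat.of (J.obj l.unop ⟶ F)
      map f := nerveMap J F f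
      map₂ δ := nerveMap₂ J F δ
      map₂_id f := Cat.Hom₂.ext (NatTrans.ext (funext fun x =>
        (congrArg (· ▷ x) (J.map₂_id f.unop)).trans (Bicategory.id_whiskerRight _ _)))
      map₂_comp δ δ' := Cat.Hom₂.ext (NatTrans.ext (funext fun x =>
        (congrArg (· ▷ x) (J.map₂_comp δ.unop2 δ'.unop2)).trans
          (Bicategory.comp_whiskerRight _ _ _)))
      map_id l := nerveMap_id J F l
      map_comp f g := nerveMap_comp J F f g
      map₂_whisker_left f g g' δ := eq_conj_of_heq (nerveMap₂_whiskerLeft J F f δ)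
        (nerveMap_comp J F f g) (nerveMap_comp J F f g')
      map₂_whisker_right {_ _ _ f f'} δ g := eq_conj_of_heq (nerveMap₂_whiskerRight J F δ g)
        (nerveMap_comp J F f g) (nerveMap_comp J F f' g) }

end

/-- Postcomposition with `h : F ⟶ G`, as a 2-natural transformation `K(J-, F) → K(J-, G)`. -/
def nerveTrans (J : StrictPseudofunctor L K) {F G : K} (h : F ⟶ G) :
    nerveObj J F ⟶ nerveObj J G :=
  TwoNatTrans.mk (fun l => (postcompFunctor (J.obj l.unop) h).toCatHom)
    (fun f => cat_hom_ext (fun x => Strict.assoc _ _ _) (fun φ => whisker_assoc_heq _ _ _))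
    (fun {a b f g} δ => cat_hom₂_heq
      (cat_hom_ext (fun x => Strict.assoc _ _ _) (fun φ => whisker_assoc_heq _ _ _))
      (cat_hom_ext (fun x => Strict.assoc _ _ _) (fun φ => whisker_assoc_heq _ _ _))
      (fun x => (whiskerRight_comp_heq _ _ _).symm))

/-- Whiskering with `δ : h ⟶ h'`, as a modification. -/
def nerveModification (J : StrictPseudofunctor L K) {F G : K} {h h' : F ⟶ G} (δ : h ⟶ h') :
    nerveTrans J h ⟶ nerveTrans J h' :=
  TwoModification.mk
    (fun l => NatTrans.toCatHom₂
      { app := fun x => x ◁ δ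
        naturality := fun x y η => (whisker_exchange _ _).symm })
    (fun f => cat_hom₂_heq ((nerveTrans J h).naturality f) ((nerveTrans J h').naturality f)
      (fun x => comp_whiskerLeft_heq _ _ _))

section

variable (J : StrictPseudofunctor L K)

theorem nerveTrans_id (F : K) : nerveTrans J (𝟙 F) = 𝟙 (nerveObj J F) :=
  TwoFunctor.twoNatTrans_ext fun _ =>
    cat_hom_ext (fun x => Strict.comp_id x) (fun f => whiskerRight_id_heq f)

theorem nerveTrans_comp {F G H : K} (h : F ⟶ G) (k : G ⟶ H) :
    nerveTrans J (h ≫ k) = nerveTrans J h ≫ nerveTrans J k :=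
  TwoFunctor.twoNatTrans_ext fun _ =>
    cat_hom_ext (fun x => (Strict.assoc x h k).symm) (fun f => whiskerRight_comp_heq f h k)

theorem nerveModification_whiskerLeft {F G H : K} (h : F ⟶ G) {k k' : G ⟶ H} (δ : k ⟶ k') :
    nerveModification J (h ◁ δ) ≍ nerveTrans J h ◁ nerveModification J δ :=
  TwoFunctor.modification_heq (nerveTrans_comp J h k) (nerveTrans_comp J h k') fun l =>
    cat_hom₂_heq (congrArg (fun t => t.app l) (nerveTrans_comp J h k))
      (congrArg (fun t => t.app l) (nerveTrans_comp J h k'))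
      (fun x => (comp_whiskerLeft_heq x h δ).symm)

theorem nerveModification_whiskerRight {F G H : K} {h h' : F ⟶ G} (δ : h ⟶ h') (k : G ⟶ H) :
    nerveModification J (δ ▷ k) ≍ nerveModification J δ ▷ nerveTrans J k :=
  TwoFunctor.modification_heq (nerveTrans_comp J h k) (nerveTrans_comp J h' k) fun l =>
    cat_hom₂_heq (congrArg (fun t => t.app l) (nerveTrans_comp J h k))
      (congrArg (fun t => t.app l) (nerveTrans_comp J h' k))
      (fun x => (whisker_assoc_heq x δ k).symm)

/-- The 2-functor `K → [Lᵒᵖ, Cat]` that sends `F` to `K(J-, F)`. -/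
def tilde : StrictPseudofunctor K (StrictPseudofunctor Lᵒᵖ Cat.{v, v}) :=
  StrictPseudofunctor.mk''
    { obj F := nerveObj J F
      map h := nerveTrans J h
      map₂ δ := nerveModification J δ
      map₂_id h := TwoFunctor.modification_ext fun l =>
        Cat.Hom₂.ext (NatTrans.ext (funext fun x => Bicategory.whiskerLeft_id _ _))
      map₂_comp δ δ' := TwoFunctor.modification_ext fun l =>
        Cat.Hom₂.ext (NatTrans.ext (funext fun x => Bicategory.whiskerLeft_comp _ _ _))
      map_id F := nerveTrans_id J F
      map_comp f g := nerveTrans_comp J f g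
      map₂_whisker_left f g g' δ := eq_conj_of_heq (nerveModification_whiskerLeft J f δ)
        (nerveTrans_comp J f g) (nerveTrans_comp J f g')
      map₂_whisker_right {_ _ _ f f'} δ g := eq_conj_of_heq (nerveModification_whiskerRight J δ g)
        (nerveTrans_comp J f g) (nerveTrans_comp J f' g) }

/-- A 2-functor `J : L → K` is dense if the 2-functor `K → [Lᵒᵖ, Cat]` that sends `F` to
`K(J-, F)` is fully faithful. -/
def IsDense : Prop := IsFullyFaithful (tilde J)

/-- A 2-cocone in `K` is `J`-absolute if the 2-functor `K → [Lᵒᵖ, Cat]` that sends `F` to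
`K(J-, F)` sends it to a universal 2-cocone. -/
def IsAbsolute {A : Type u₂} [Bicategory.{w₂, v₂} A]
    {W : StrictPseudofunctor Aᵒᵖ Cat.{v₃, u₃}} {D : StrictPseudofunctor (Groth W) K} {C : K}
    (ζ : OplaxNormalCocone D C) : Prop :=
  (ζ.map (tilde J)).IsUniversal

end

end Dense

/-! ### Finite completeness -/

section Limits

variable {K : Type u} [Bicategory.{w, v} K]

/-- A (strict) 2-pullback of `f` and `g`. The heterogeneous equality in the 2-dimensional part
compares 2-cells whose domains and whose codomains are equal by `w`. -/
structure TwoPullback {X Y Z : K} (f : X ⟶ Z) (g : Y ⟶ Z) where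
  pt : K
  fst : pt ⟶ X
  snd : pt ⟶ Y
  w : fst ≫ f = snd ≫ g
  lift {T : K} (h : T ⟶ X) (k : T ⟶ Y) (e : h ≫ f = k ≫ g) : T ⟶ pt
  lift_fst {T : K} (h : T ⟶ X) (k : T ⟶ Y) (e : h ≫ f = k ≫ g) : lift h k e ≫ fst = h
  lift_snd {T : K} (h : T ⟶ X) (k : T ⟶ Y) (e : h ≫ f = k ≫ g) : lift h k e ≫ snd = k
  hom_ext {T : K} {m m' : T ⟶ pt} (h₁ : m ≫ fst = m' ≫ fst) (h₂ : m ≫ snd = m' ≫ snd) : m = m'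
  existsUnique_cell {T : K} {m m' : T ⟶ pt} (σ : m ≫ fst ⟶ m' ≫ fst) (ρ : m ≫ snd ⟶ m' ≫ snd)
    (e : σ ▷ f ≍ ρ ▷ g) : ∃! γ : m ⟶ m', γ ▷ fst = σ ∧ γ ▷ snd = ρ

/-- A (strict) 2-terminal object: every hom-category into it is the terminal category. -/
def IsTwoTerminal (T : K) : Prop :=
  ∀ X : K, ∃ t : X ⟶ T, (∀ f : X ⟶ T, f = t) ∧ ∀ η : t ⟶ t, η = 𝟙 t

/-- A (strict) power (cotensor) of `X` by the arrow category, presented by its universal 2-cell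
`cell`: morphisms `T ⟶ pt` are 2-cells between morphisms `T ⟶ X`, and 2-cells between such
morphisms are commutative squares of 2-cells. -/
structure ArrowPower (X : K) where
  pt : K
  src : pt ⟶ X
  tgt : pt ⟶ X
  cell : src ⟶ tgt
  existsUnique_hom {T : K} {f g : T ⟶ X} (η : f ⟶ g) :
    ∃! h : T ⟶ pt, h ≫ src = f ∧ h ≫ tgt = g ∧ h ◁ cell ≍ η
  existsUnique_cell {T : K} {h k : T ⟶ pt} (σ : h ≫ src ⟶ k ≫ src) (ρ : h ≫ tgt ⟶ k ≫ tgt)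
    (e : h ◁ cell ≫ ρ = σ ≫ k ◁ cell) : ∃! γ : h ⟶ k, γ ▷ src = σ ∧ γ ▷ tgt = ρ

variable (K) in
/-- A 2-category is finitely complete, that is, has all finite weighted (strict) 2-limits, if it
has a 2-terminal object, 2-pullbacks and powers by the arrow category; all the other finite
2-limits are constructed from these. -/
def IsFinitelyComplete : Prop :=
  (∃ T : K, IsTwoTerminal T) ∧
    (∀ {X Y Z : K} (f : X ⟶ Z) (g : Y ⟶ Z), Nonempty (TwoPullback f g)) ∧
      ∀ X : K, Nonempty (ArrowPower X)

end Limits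

/-! ### Split opfibrations and change of base -/

section ChangeOfBase

variable {K : Type u} [Bicategory.{w, v} K] [Strict K]

/-- The structure of a split Grothendieck opfibration on a morphism `τ : E ⟶ B` of a 2-category:
each functor `τ ∘ - : K(X, E) → K(X, B)` is a split Grothendieck opfibration, where the chosen
cocartesian lift of a 2-cell `β` from `τ ∘ e` is `lift e β : e ⟶ cod e β`, and the chosen
lifts are compatible with precomposition by every `h : X' ⟶ X`. -/
structure SplitOpfibration {E B : K} (τ : E ⟶ B) where
  cod {X : K} (e : X ⟶ E) {b : X ⟶ B} (β : e ≫ τ ⟶ b) : X ⟶ E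
  lift {X : K} (e : X ⟶ E) {b : X ⟶ B} (β : e ≫ τ ⟶ b) : e ⟶ cod e β
  cod_over {X : K} (e : X ⟶ E) {b : X ⟶ B} (β : e ≫ τ ⟶ b) : cod e β ≫ τ = b
  lift_over {X : K} (e : X ⟶ E) {b : X ⟶ B} (β : e ≫ τ ⟶ b) :
    lift e β ▷ τ = β ≫ eqToHom (cod_over e β).symm
  cocartesian {X : K} (e : X ⟶ E) {b : X ⟶ B} (β : e ≫ τ ⟶ b) {e' : X ⟶ E} (γ : e ⟶ e')
    (ψ : cod e β ≫ τ ⟶ e' ≫ τ) (h : lift e β ▷ τ ≫ ψ = γ ▷ τ) :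
    ∃! χ : cod e β ⟶ e', lift e β ≫ χ = γ ∧ χ ▷ τ = ψ
  cod_id {X : K} (e : X ⟶ E) : cod e (𝟙 (e ≫ τ)) = e
  lift_id {X : K} (e : X ⟶ E) : lift e (𝟙 (e ≫ τ)) = eqToHom (cod_id e).symm
  cod_comp {X : K} (e : X ⟶ E) {b b' : X ⟶ B} (β : e ≫ τ ⟶ b) (β' : b ⟶ b') :
    cod e (β ≫ β') = cod (cod e β) (eqToHom (cod_over e β) ≫ β')
  lift_comp {X : K} (e : X ⟶ E) {b b' : X ⟶ B} (β : e ≫ τ ⟶ b) (β' : b ⟶ b') :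
    lift e (β ≫ β') = lift e β ≫ lift (cod e β) (eqToHom (cod_over e β) ≫ β') ≫
      eqToHom (cod_comp e β β').symm
  cod_whisker {X X' : K} (h : X' ⟶ X) (e : X ⟶ E) {b : X ⟶ B} (β : e ≫ τ ⟶ b) :
    cod (h ≫ e) ((α_ h e τ).hom ≫ h ◁ β) = h ≫ cod e β
  lift_whisker {X X' : K} (h : X' ⟶ X) (e : X ⟶ E) {b : X ⟶ B} (β : e ≫ τ ⟶ b) :
    lift (h ≫ e) ((α_ h e τ).hom ≫ h ◁ β) = h ◁ lift e β ≫ eqToHom (cod_whisker h e β).symm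

namespace SplitOpfibration

variable {E B : K} {τ : E ⟶ B} (c : SplitOpfibration τ)

theorem cod_congr {X : K} {e e' : X ⟶ E} {b b' : X ⟶ B} {β : e ≫ τ ⟶ b} {β' : e' ≫ τ ⟶ b'}
    (he : e = e') (hb : b = b') (h : β ≍ β') : c.cod e β = c.cod e' β' := by
  subst he hb; rw [eq_of_heq h]

theorem lift_congr {X : K} {e e' : X ⟶ E} {b b' : X ⟶ B} {β : e ≫ τ ⟶ b} {β' : e' ≫ τ ⟶ b'}
    (he : e = e') (hb : b = b') (h : β ≍ β') : c.lift e β ≍ c.lift e' β' := by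
  subst he hb; rw [eq_of_heq h]

theorem lift_over_heq {X : K} (e : X ⟶ E) {b : X ⟶ B} (β : e ≫ τ ⟶ b) :
    c.lift e β ▷ τ ≍ β := by
  rw [c.lift_over]; exact comp_eqToHom_heq _ _

theorem cocartesian' {X : K} {e : X ⟶ E} {b : X ⟶ B} {β : e ≫ τ ⟶ b} {d : X ⟶ E} {u : e ⟶ d}
    (hd : d = c.cod e β) (hu : u ≍ c.lift e β) {e' : X ⟶ E} (γ : e ⟶ e')
    (ψ : d ≫ τ ⟶ e' ≫ τ) (h : u ▷ τ ≫ ψ = γ ▷ τ) :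
    ∃! χ : d ⟶ e', u ≫ χ = γ ∧ χ ▷ τ = ψ := by
  subst hd
  obtain rfl := eq_of_heq hu
  exact c.cocartesian e β γ ψ h

end SplitOpfibration

namespace ChangeOfBase

variable {E B : K} {τ : E ⟶ B} (c : SplitOpfibration τ)
  (P : ∀ (X : K) (F : X ⟶ B), TwoPullback F τ)

/-- The object part of `τ^*`: the pullback of `F` along `τ`. -/
abbrev obj (X : LaxSlice K B) : LaxSlice K E := LaxSlice.mk (P _ X.hom).pt (P _ X.hom).snd

variable {X Y Z : LaxSlice K B}

/-- The whiskering of the filling of the triangle `f` with the projection from the pullback. -/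
abbrev baseCell (f : X ⟶ Y) :
    (P _ X.hom).snd ≫ τ ⟶ ((P _ X.hom).fst ≫ f.map) ≫ Y.hom :=
  eqToHom (P _ X.hom).w.symm ≫ (P _ X.hom).fst ◁ f.cell ≫ (α_ _ _ _).inv

theorem baseCell_heq (f : X ⟶ Y) : baseCell P f ≍ (P _ X.hom).fst ◁ f.cell := by
  rw [baseCell, associator_inv]
  exact (eqToHom_comp_heq _ _).trans (comp_eqToHom_heq _ _)

/-- The morphism into the pullback that is induced by the codomain of the chosen lift of
`baseCell`. -/
abbrev mapHom (f : X ⟶ Y) : (P _ X.hom).pt ⟶ (P _ Y.hom).pt :=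
  (P _ Y.hom).lift ((P _ X.hom).fst ≫ f.map) (c.cod (P _ X.hom).snd (baseCell P f))
    (c.cod_over _ _).symm

theorem mapHom_fst (f : X ⟶ Y) : mapHom c P f ≫ (P _ Y.hom).fst = (P _ X.hom).fst ≫ f.map :=
  (P _ Y.hom).lift_fst _ _ _

theorem mapHom_snd (f : X ⟶ Y) :
    mapHom c P f ≫ (P _ Y.hom).snd = c.cod (P _ X.hom).snd (baseCell P f) :=
  (P _ Y.hom).lift_snd _ _ _

/-- The action of `τ^*` on morphisms: the triangle filled with the chosen lift of `baseCell`. -/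
abbrev map (f : X ⟶ Y) : obj P X ⟶ obj P Y :=
  LaxSlice.Hom.mk (mapHom c P f)
    (c.lift (P _ X.hom).snd (baseCell P f) ≫ eqToHom (mapHom_snd c P f).symm)

theorem map_cell_heq (f : X ⟶ Y) :
    (map c P f).cell ≍ c.lift (P _ X.hom).snd (baseCell P f) := comp_eqToHom_heq _ _

theorem map_cell_over_heq (f : X ⟶ Y) :
    (map c P f).cell ▷ τ ≍ (P _ X.hom).fst ◁ f.cell :=
  (whiskerRight_heq rfl (mapHom_snd c P f) rfl (map_cell_heq c P f)).trans <|
    (c.lift_over_heq _ _).trans (baseCell_heq P f)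

theorem whiskerRight_snd_heq {T : K} (F : T ⟶ B) {S : K} {m m' : S ⟶ (P _ F).pt} (γ : m ⟶ m') :
    γ ▷ (P _ F).snd ▷ τ ≍ γ ▷ (P _ F).fst ▷ F :=
  (whiskerRight_comp_heq _ _ _).symm.trans <|
    (whiskerRight_heq rfl rfl (P _ F).w.symm HEq.rfl).trans (whiskerRight_comp_heq _ _ _)

theorem existsUnique_map₂ {f g : X ⟶ Y} (δ : f ⟶ g) :
    ∃! Γ : map c P f ⟶ map c P g, Γ.cell ▷ (P _ Y.hom).fst ≍ (P _ X.hom).fst ◁ δ.cell := by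
  have hf := mapHom_fst c P f
  have hg := mapHom_fst c P g
  have hτ : ∀ m : (P _ X.hom).pt ⟶ (P _ Y.hom).pt,
      (m ≫ (P _ Y.hom).snd) ≫ τ = (m ≫ (P _ Y.hom).fst) ≫ Y.hom := fun m => by
    rw [Strict.assoc, Strict.assoc, (P _ Y.hom).w]
  let σ : mapHom c P f ≫ (P _ Y.hom).fst ⟶ mapHom c P g ≫ (P _ Y.hom).fst :=
    eqToHom hf ≫ (P _ X.hom).fst ◁ δ.cell ≫ eqToHom hg.symm
  have hσ : σ ≍ (P _ X.hom).fst ◁ δ.cell :=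
    (eqToHom_comp_heq _ _).trans (comp_eqToHom_heq _ _)
  let ψ : (mapHom c P f ≫ (P _ Y.hom).snd) ≫ τ ⟶ (mapHom c P g ≫ (P _ Y.hom).snd) ≫ τ :=
    eqToHom (hτ _) ≫ σ ▷ Y.hom ≫ eqToHom (hτ _).symm
  have hψ : ψ ≍ σ ▷ Y.hom := (eqToHom_comp_heq _ _).trans (comp_eqToHom_heq _ _)
  have key : (map c P f).cell ▷ τ ≫ ψ = (map c P g).cell ▷ τ := by
    refine eq_of_heq (HEq.trans ?_ (map_cell_over_heq c P g).symm)
    rw [← δ.w, Bicategory.whiskerLeft_comp]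
    have h₂ : ψ ≍ (P _ X.hom).fst ◁ δ.cell ▷ Y.hom :=
      hψ.trans ((whiskerRight_heq hf hg rfl hσ).trans (whisker_assoc_heq _ _ _))
    refine heq_comp (P _ X.hom).w.symm ?_ ?_ (map_cell_over_heq c P f) h₂
    · rw [hτ, hf, Strict.assoc]
    · rw [hτ, hg, Strict.assoc]
  obtain ⟨ρ, ⟨h₁, h₂⟩, hu⟩ := c.cocartesian' (mapHom_snd c P f) (map_cell_heq c P f)
    (map c P g).cell ψ key
  obtain ⟨γ, ⟨h₃, h₄⟩, hv⟩ := (P _ Y.hom).existsUnique_cell σ ρ (by rw [h₂]; exact hψ.symm)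
  refine ⟨LaxSlice.Hom₂.mk γ (by rw [h₄]; exact h₁), ?_, fun Γ hΓ => ?_⟩
  · exact (heq_of_eq h₃).trans hσ
  · have h₅ : Γ.cell ▷ (P _ Y.hom).fst = σ := eq_of_heq (hΓ.trans hσ.symm)
    refine LaxSlice.hom₂_ext (hv Γ.cell ⟨h₅, hu _ ⟨Γ.w, ?_⟩⟩)
    refine eq_of_heq ((whiskerRight_snd_heq P Y.hom Γ.cell).trans ?_)
    rw [h₅]
    exact hψ.symm

/-- The action of `τ^*` on 2-cells: the lift of the whiskering of `δ` with the projection from the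
pullback, along the pullback of `τ`. It is the only 2-cell of the lax slice between the triangles
`τ^* f` and `τ^* g` that is over this whiskering. -/
noncomputable def map₂ {f g : X ⟶ Y} (δ : f ⟶ g) : map c P f ⟶ map c P g :=
  (existsUnique_map₂ c P δ).choose

theorem map₂_over {f g : X ⟶ Y} (δ : f ⟶ g) :
    (map₂ c P δ).cell ▷ (P _ Y.hom).fst ≍ (P _ X.hom).fst ◁ δ.cell :=
  (existsUnique_map₂ c P δ).choose_spec.1

theorem map₂_unique {f g : X ⟶ Y} (δ : f ⟶ g) (Γ : map c P f ⟶ map c P g)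
    (h : Γ.cell ▷ (P _ Y.hom).fst ≍ (P _ X.hom).fst ◁ δ.cell) : map₂ c P δ = Γ :=
  ((existsUnique_map₂ c P δ).choose_spec.2 Γ h).symm

theorem map_id (X : LaxSlice K B) : map c P (𝟙 X) = 𝟙 (obj P X) := by
  have hb : ((P _ X.hom).fst ≫ 𝟙 X.dom) ≫ X.hom = (P _ X.hom).snd ≫ τ := by
    rw [Strict.comp_id, (P _ X.hom).w]
  have h : baseCell P (𝟙 X) ≍ 𝟙 ((P _ X.hom).snd ≫ τ) := by
    refine (baseCell_heq P (𝟙 X)).trans ?_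
    rw [LaxSlice.id_cell, leftUnitor_inv, whiskerLeft_eqToHom]
    exact eqToHom_heq_eqToHom _ rfl (P _ X.hom).w
  have h₁ := (c.cod_congr rfl hb h).trans (c.cod_id _)
  refine LaxSlice.hom_ext' ((P _ X.hom).hom_ext ?_ ?_) ?_
  · exact (mapHom_fst c P (𝟙 X)).trans ((Strict.comp_id _).trans (Strict.id_comp _).symm)
  · exact (mapHom_snd c P (𝟙 X)).trans (h₁.trans (Strict.id_comp _).symm)
  · refine (map_cell_heq c P (𝟙 X)).trans ((c.lift_congr rfl hb h).trans ?_)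
    rw [c.lift_id, LaxSlice.id_cell, leftUnitor_inv]
    exact eqToHom_heq_eqToHom _ _ rfl

theorem map_comp (f : X ⟶ Y) (g : Y ⟶ Z) : map c P (f ≫ g) = map c P f ≫ map c P g := by
  have hf := mapHom_fst c P f
  -- the second part of the composite 2-cell to be lifted
  let β : ((P _ X.hom).fst ≫ f.map) ≫ Y.hom ⟶ ((P _ X.hom).fst ≫ f.map) ≫ g.map ≫ Z.hom :=
    ((P _ X.hom).fst ≫ f.map) ◁ g.cell
  have hb₀ : (P _ X.hom).fst ≫ (f ≫ g).map ≫ Z.hom =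
      ((P _ X.hom).fst ≫ f.map) ≫ g.map ≫ Z.hom := by
    simp only [LaxSlice.comp_map, Strict.assoc]
  have hb := (Strict.assoc _ _ _).trans hb₀
  have h₁ : baseCell P (f ≫ g) ≍ baseCell P f ≫ β := by
    refine (baseCell_heq P (f ≫ g)).trans ?_
    rw [LaxSlice.comp_cell, associator_inv, Bicategory.whiskerLeft_comp]
    refine heq_comp (P _ X.hom).w (Strict.assoc _ _ _).symm hb₀ (baseCell_heq P f).symm ?_
    rw [Bicategory.whiskerLeft_comp, whiskerLeft_eqToHom]
    exact (comp_eqToHom_heq _ _).trans (comp_whiskerLeft_heq _ _ _).symm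
  have hb' : mapHom c P f ≫ ((P _ Y.hom).fst ≫ g.map) ≫ Z.hom =
      ((P _ X.hom).fst ≫ f.map) ≫ g.map ≫ Z.hom := by
    rw [← hf]; simp only [Strict.assoc]
  have h₂ : (α_ (mapHom c P f) (P _ Y.hom).snd τ).hom ≫ mapHom c P f ◁ baseCell P g ≍
      eqToHom (c.cod_over (P _ X.hom).snd (baseCell P f)) ≫ β := by
    rw [associator_hom]
    refine (eqToHom_comp_heq _ _).trans (HEq.trans ?_ (eqToHom_comp_heq _ _).symm)
    refine (whiskerLeft_heq rfl (P _ Y.hom).w.symm (Strict.assoc _ _ _)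
      (baseCell_heq P g)).trans ?_
    exact (comp_whiskerLeft_heq _ _ _).symm.trans (whiskerLeft_heq hf rfl rfl HEq.rfl)
  have hs := mapHom_snd c P f
  have e₁ : c.cod (P _ X.hom).snd (baseCell P (f ≫ g)) =
      c.cod (P _ X.hom).snd (baseCell P f ≫ β) := c.cod_congr rfl hb h₁
  have e₂ := c.cod_comp (P _ X.hom).snd (baseCell P f) β
  have e₃ := c.cod_congr hs hb' h₂
  have e₄ := c.cod_whisker (mapHom c P f) (P _ Y.hom).snd (baseCell P g)
  have e₅ : c.cod (P _ X.hom).snd (baseCell P (f ≫ g)) =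
      mapHom c P f ≫ c.cod (P _ Y.hom).snd (baseCell P g) :=
    e₁.trans (e₂.trans (e₃.symm.trans e₄))
  have e₆ : c.cod (P _ X.hom).snd (baseCell P (f ≫ g)) =
      (mapHom c P f ≫ mapHom c P g) ≫ (P _ Z.hom).snd :=
    e₅.trans ((congrArg (_ ≫ ·) (mapHom_snd c P g).symm).trans (Strict.assoc _ _ _).symm)
  refine LaxSlice.hom_ext' ((P _ Z.hom).hom_ext ?_ ?_) ?_
  · refine (mapHom_fst c P (f ≫ g)).trans ?_
    refine (Strict.assoc _ _ _).symm.trans ((congrArg (· ≫ g.map) hf.symm).trans ?_)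
    refine (Strict.assoc _ _ _).trans ((congrArg (_ ≫ ·) (mapHom_fst c P g).symm).trans ?_)
    exact (Strict.assoc _ _ _).symm
  · exact (mapHom_snd c P (f ≫ g)).trans e₆
  · refine (map_cell_heq c P (f ≫ g)).trans ((c.lift_congr rfl hb h₁).trans ?_)
    rw [c.lift_comp, LaxSlice.comp_cell, associator_inv]
    refine heq_comp rfl hs.symm (e₁.symm.trans e₆) (map_cell_heq c P f).symm ?_
    refine (comp_eqToHom_heq _ _).trans (HEq.trans ?_ (comp_eqToHom_heq _ _).symm)
    refine (c.lift_congr hs hb' h₂).symm.trans ?_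
    rw [c.lift_whisker]
    refine (comp_eqToHom_heq _ _).trans ?_
    exact whiskerLeft_heq rfl rfl (mapHom_snd c P g).symm (map_cell_heq c P g).symm

theorem map₂_id (f : X ⟶ Y) : map₂ c P (𝟙 f) = 𝟙 (map c P f) :=
  map₂_unique c P _ _ (by
    rw [LaxSlice.id₂_cell, LaxSlice.id₂_cell, Bicategory.id_whiskerRight,
      Bicategory.whiskerLeft_id, mapHom_fst])

theorem map₂_comp {f g h : X ⟶ Y} (δ : f ⟶ g) (θ : g ⟶ h) :
    map₂ c P (δ ≫ θ) = map₂ c P δ ≫ map₂ c P θ :=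
  map₂_unique c P _ _ (by
    rw [LaxSlice.comp₂_cell, LaxSlice.comp₂_cell, Bicategory.comp_whiskerRight,
      Bicategory.whiskerLeft_comp]
    exact heq_comp (mapHom_fst c P f) (mapHom_fst c P g) (mapHom_fst c P h)
      (map₂_over c P δ) (map₂_over c P θ))

theorem conj_whiskerRight_heq {M : K} {S T : LaxSlice K M} {f f' g g' : S ⟶ T} (h : f = g)
    (h' : f' = g') (Γ : g ⟶ g') {R : K} (k : T.dom ⟶ R) :
    (eqToHom h ≫ Γ ≫ eqToHom h'.symm).cell ▷ k ≍ Γ.cell ▷ k := by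
  subst h h'; simp

theorem map₂_whiskerLeft (f : X ⟶ Y) {g g' : Y ⟶ Z} (η : g ⟶ g') :
    map₂ c P (f ◁ η) = eqToHom (map_comp c P f g) ≫
      map c P f ◁ map₂ c P η ≫ eqToHom (map_comp c P f g').symm :=
  map₂_unique c P _ _ (by
    refine (conj_whiskerRight_heq (map_comp c P f g) (map_comp c P f g') _ _).trans ?_
    refine (whisker_assoc_heq _ _ _).trans ?_
    refine (whiskerLeft_heq rfl (mapHom_fst c P g) (mapHom_fst c P g')
      (map₂_over c P η)).trans ?_
    refine (comp_whiskerLeft_heq _ _ _).symm.trans ?_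
    exact (whiskerLeft_heq (mapHom_fst c P f) rfl rfl HEq.rfl).trans
      (comp_whiskerLeft_heq _ _ _))

theorem map₂_whiskerRight {f f' : X ⟶ Y} (η : f ⟶ f') (g : Y ⟶ Z) :
    map₂ c P (η ▷ g) = eqToHom (map_comp c P f g) ≫
      map₂ c P η ▷ map c P g ≫ eqToHom (map_comp c P f' g).symm :=
  map₂_unique c P _ _ (by
    refine (conj_whiskerRight_heq (map_comp c P f g) (map_comp c P f' g) _ _).trans ?_
    refine (whiskerRight_comp_heq _ _ _).symm.trans ?_
    refine (whiskerRight_heq rfl rfl (mapHom_fst c P g) HEq.rfl).trans ?_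
    refine (whiskerRight_comp_heq _ _ _).trans ?_
    exact (whiskerRight_heq (mapHom_fst c P f) (mapHom_fst c P f') rfl
      (map₂_over c P η)).trans (whisker_assoc_heq _ _ _))

/-- `τ^*` preserves tight morphisms. -/
theorem isTight_map {f : X ⟶ Y} (hf : LaxSlice.IsTight f) : LaxSlice.IsTight (map c P f) := by
  obtain ⟨h, e⟩ := hf
  have hb : ((P _ X.hom).fst ≫ f.map) ≫ Y.hom = (P _ X.hom).snd ≫ τ := by
    rw [Strict.assoc, ← h, (P _ X.hom).w]
  have h₀ : baseCell P f ≍ 𝟙 ((P _ X.hom).snd ≫ τ) := by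
    refine (baseCell_heq P f).trans ?_
    rw [e, whiskerLeft_eqToHom]
    exact eqToHom_heq_eqToHom _ rfl (P _ X.hom).w
  have h₁ := (c.cod_congr rfl hb h₀).trans (c.cod_id _)
  refine ⟨h₁.symm.trans (mapHom_snd c P f).symm, eq_of_heq ?_⟩
  refine (map_cell_heq c P f).trans ((c.lift_congr rfl hb h₀).trans ?_)
  rw [c.lift_id]
  exact eqToHom_heq_eqToHom _ _ rfl

end ChangeOfBase

/-- The 2-functor `τ^*` of change of base along a split opfibration `τ` between lax slices, for a
choice `P` of pullbacks along `τ`. -/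
noncomputable def changeOfBase {E B : K} {τ : E ⟶ B} (c : SplitOpfibration τ)
    (P : ∀ (X : K) (F : X ⟶ B), TwoPullback F τ) :
    StrictPseudofunctor (LaxSlice K B) (LaxSlice K E) :=
  StrictPseudofunctor.mk''
    { obj X := ChangeOfBase.obj P X
      map f := ChangeOfBase.map c P f
      map₂ δ := ChangeOfBase.map₂ c P δ
      map₂_id f := ChangeOfBase.map₂_id c P f
      map₂_comp δ θ := ChangeOfBase.map₂_comp c P δ θ
      map_id X := ChangeOfBase.map_id c P X
      map_comp f g := ChangeOfBase.map_comp c P f g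
      map₂_whisker_left f _ _ η := ChangeOfBase.map₂_whiskerLeft c P f η
      map₂_whisker_right η g := ChangeOfBase.map₂_whiskerRight c P η g }

end ChangeOfBase

end TwoCat

open TwoCat

/-! Universality is tested one hom-category at a time. Fix an object T of K. A 2-cocone ξ on C is
hom-universal at T (`HomUniversal`) if, for every category X, functors from K(T, C) to X correspond
bijectively to 2-cocones on X for the diagram K(T, D(-)); so K(T, C) is the oplax normal 2-colimit
of the categories K(T, D x). Only a bijection on objects is asked for: since X may be replaced by
its category of arrows, natural transformations are covered too (`HomUniversal.natTrans_heq`,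
`HomUniversal.exists_natTrans`).

Absoluteness makes dom ∘ ζ hom-universal at every T = J l (`IsAbsolute.homUniversal`). Evaluation of
2-presheaves at l has a right adjoint, which sends X to the coinduced 2-presheaf with value [L(l,
a), X] at a (`coind`). Evaluation at l therefore preserves the 2-colimit that absoluteness provides.

Change of base preserves hom-universality at T (`HomUniversal.changeOfBase`). The category K(T, P_F)
is the strict pullback of K(T, F) along the opfibration p = K(T, τ), and opfibrations are
exponentiable: a functor on the pullback of p along F : Y ⥤ 𝓑 is the same as a functor over 𝓑 from Y
to an exponential `FibreExp p X`. Pulling back along p thus preserves colimits over 𝓑. The lax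
triangles fit into this as follows. The filling of τ^* f is a cocartesian lift, so a 2-cell out of a
composite with τ^* f amounts to a 2-cell of the domains together with a morphism over the filling of
f, and the morphisms over the filling are exactly what indexes the components of a morphism of the
exponential. A 2-cocone σ for the domains of τ^* ∘ H hence transposes to one for the domains of H
(`transposeCell`, `ChangeOfBase.transposeCocone`). The latter extends along dom ∘ ζ; tightness of
the components of ζ puts the extension over K(T, C.hom) (`baseFunctor_of_restrict_eq`), so that it
transposes back to the functor that is sought (`exists_restrict_domCob`). Uniqueness follows the
same route (`restrict_domCob_injective`).

The way back to the lax slice has two steps. Density of J assembles hom-universality at all J l into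
universality in K (`HomUniversal.isUniversal`): the functors obtained at each l are 2-natural in l
by uniqueness, so they come from a morphism of K. Finally, for tight components, universality of the
domain implies universality in the lax slice (`LaxSlice.isUniversal_of_domFunctor`): the filling of
a triangle out of C is a 2-cell of K out of C.hom, and the 2-dimensional universal property
constructs it from the fillings of the given 2-cocone. -/

namespace TwoCat

/-! ### Transport of functors and arrows along heterogeneous equality -/

section FunctorHEq

variable {X : Type u₁} [Category.{v₁} X] {Y : Type u₂} [Category.{v₂} Y]

theorem functor_map_heq (F : X ⥤ Y) {a b a' b' : X} (ha : a = a') (hb : b = b') {f : a ⟶ b}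
    {f' : a' ⟶ b'} (h : f ≍ f') : F.map f ≍ F.map f' := by
  subst ha hb; rw [eq_of_heq h]

theorem map_heq_of_functor_eq {F G : X ⥤ Y} (h : F = G) {a b : X} (f : a ⟶ b) :
    F.map f ≍ G.map f := by
  subst h; rfl

theorem comp_heq_of_heq_id {a b c a' b' : X} {f : a ⟶ b} {g : b ⟶ c} {f' : a' ⟶ b'}
    (ha : a = a') (hb : b = b') (hc : b = c) (hf : f ≍ f') (hg : g ≍ 𝟙 b) : f ≫ g ≍ f' := by
  subst ha hb hc
  rw [eq_of_heq hg, Category.comp_id]; exact hf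

theorem comp_heq_of_id_heq {a b c b' c' : X} {f : a ⟶ b} {g : b ⟶ c} {g' : b' ⟶ c'}
    (ha : a = b) (hb : b = b') (hc : c = c') (hf : f ≍ 𝟙 b) (hg : g ≍ g') : f ≫ g ≍ g' := by
  subst ha hb hc
  rw [eq_of_heq hf, Category.id_comp]; exact hg

theorem heq_id_of_eqToHom {a b : X} (h : a = b) : eqToHom h ≍ 𝟙 a := by
  subst h; rfl

theorem arrowMk_inj_of_heq {a b a' b' : X} {f : a ⟶ b} {f' : a' ⟶ b'} (ha : a = a') (hb : b = b')
    (h : f ≍ f') : Arrow.mk f = Arrow.mk f' := by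
  subst ha hb; rw [eq_of_heq h]

theorem heq_of_arrowMk_eq {a b a' b' : X} {f : a ⟶ b} {f' : a' ⟶ b'}
    (h : Arrow.mk f = Arrow.mk f') : f ≍ f' := by
  cases h; rfl

theorem arrow_hom_heq {f g f' g' : Arrow X} (hf : f = f') (hg : g = g') {φ : f ⟶ g}
    {φ' : f' ⟶ g'} (hl : φ.left ≍ φ'.left) (hr : φ.right ≍ φ'.right) : φ ≍ φ' := by
  subst hf hg
  exact heq_of_eq (Arrow.hom_ext _ _ (eq_of_heq hl) (eq_of_heq hr))

theorem arrow_hom_left_heq {f g f' g' : Arrow X} (hf : f = f') (hg : g = g') {φ : f ⟶ g}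
    {φ' : f' ⟶ g'} (h : φ ≍ φ') : φ.left ≍ φ'.left := by
  subst hf hg; rw [eq_of_heq h]

theorem arrow_hom_right_heq {f g f' g' : Arrow X} (hf : f = f') (hg : g = g') {φ : f ⟶ g}
    {φ' : f' ⟶ g'} (h : φ ≍ φ') : φ.right ≍ φ'.right := by
  subst hf hg; rw [eq_of_heq h]

/-- A natural transformation, as a functor to the category of arrows. -/
@[simps]
def natTransToArrow {F G : X ⥤ Y} (α : F ⟶ G) : X ⥤ Arrow Y where
  obj x := Arrow.mk (α.app x)
  map f := Arrow.homMk (F.map f) (G.map f)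

end FunctorHEq

/-! ### 2-cocones represented by hom-categories -/

section HomCocone

variable {K : Type u} [Bicategory.{v, v} K] [Strict K] {A : Type u₁} [Bicategory.{w₁, v₁} A]
  {W : StrictPseudofunctor Aᵒᵖ Cat.{v₂, u₂}}

/-- An oplax normal 2-cocone on the category `X` for the 2-diagram `K(T, D(-))` of categories, in
terms of the components of its structure 2-cells. -/
@[ext]
structure HomCocone (T : K) (D : StrictPseudofunctor (Groth W) K) (X : Type v₃)
    [Category.{w₃} X] where
  app (x : Groth W) : (T ⟶ D.obj x) ⥤ X
  cell {x y : Groth W} (f : x ⟶ y) (d : T ⟶ D.obj x) :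
    (app x).obj d ⟶ (app y).obj (d ≫ D.map f)
  cell_natural {x y : Groth W} (f : x ⟶ y) {d d' : T ⟶ D.obj x} (η : d ⟶ d') :
    cell f d ≫ (app y).map (η ▷ D.map f) = (app x).map η ≫ cell f d'
  cell_id (x : Groth W) (d : T ⟶ D.obj x) : cell (𝟙 x) d ≍ 𝟙 ((app x).obj d)
  cell_comp {x y z : Groth W} (f : x ⟶ y) (g : y ⟶ z) (d : T ⟶ D.obj x) :
    cell (f ≫ g) d ≍ cell f d ≫ cell g (d ≫ D.map f)
  cell_map₂ {x y : Groth W} {f g : x ⟶ y} (δ : f ⟶ g) (d : T ⟶ D.obj x) :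
    cell f d ≫ (app y).map (d ◁ D.map₂ δ) = cell g d
  normal {x y : Groth W} (f : x ⟶ y) (hf : Groth.IsCleavage f) (d : T ⟶ D.obj x) :
    ∃ h : (app x).obj d = (app y).obj (d ≫ D.map f), cell f d = eqToHom h

namespace HomCocone

variable {T : K} {D : StrictPseudofunctor (Groth W) K} {X : Type v₃} [Category.{w₃} X]

theorem ext_of_heq {σ ρ : HomCocone T D X} (h : ∀ x, σ.app x = ρ.app x)
    (h' : ∀ {x y : Groth W} (f : x ⟶ y) (d : T ⟶ D.obj x), σ.cell f d ≍ ρ.cell f d) : σ = ρ := by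
  obtain ⟨a, b⟩ := σ
  obtain ⟨a', b'⟩ := ρ
  obtain rfl : a = a' := funext h
  obtain rfl : @b = @b' := by
    funext x y f d
    exact eq_of_heq (h' f d)
  rfl

theorem cell_heq_of_eq {σ ρ : HomCocone T D X} (h : σ = ρ) {x y : Groth W} (f : x ⟶ y)
    (d : T ⟶ D.obj x) : σ.cell f d ≍ ρ.cell f d := by
  subst h; rfl

/-- The 2-cocone obtained by composing with a functor. -/
@[simps]
def postcomp {Y : Type u₃} [Category.{w₂} Y] (σ : HomCocone T D X) (s : X ⥤ Y) :
    HomCocone T D Y where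
  app x := σ.app x ⋙ s
  cell f d := s.map (σ.cell f d)
  cell_natural {x y} f {d d'} η :=
    (s.map_comp _ _).symm.trans ((congrArg s.map (σ.cell_natural f η)).trans (s.map_comp _ _))
  cell_id x d := by
    have h : d ≫ D.map (𝟙 x) = d := by rw [D.map_id, Strict.comp_id]
    exact (functor_map_heq s rfl (by rw [h]) (σ.cell_id x d)).trans (heq_of_eq (s.map_id _))
  cell_comp {x y z} f g d := by
    have h : d ≫ D.map (f ≫ g) = (d ≫ D.map f) ≫ D.map g := by rw [D.map_comp, Strict.assoc]
    exact (functor_map_heq s rfl (by rw [h]) (σ.cell_comp f g d)).trans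
      (heq_of_eq (s.map_comp _ _))
  cell_map₂ δ d := (s.map_comp _ _).symm.trans (congrArg s.map (σ.cell_map₂ δ d))
  normal f hf d := by
    obtain ⟨h, e⟩ := σ.normal f hf d
    exact ⟨congrArg s.obj h, (congrArg s.map e).trans (eqToHom_map s h)⟩

variable {C : K}

/-- The structure 2-cell of a 2-cocone, whiskered with `d` and reassociated. -/
def slide (ξ : OplaxNormalCocone D C) {x y : Groth W} (f : x ⟶ y) (d : T ⟶ D.obj x) :
    d ≫ ξ.app x ⟶ (d ≫ D.map f) ≫ ξ.app y :=
  d ◁ ξ.cell f ≫ (α_ d (D.map f) (ξ.app y)).inv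

theorem slide_heq (ξ : OplaxNormalCocone D C) {x y : Groth W} (f : x ⟶ y) (d : T ⟶ D.obj x) :
    slide ξ f d ≍ d ◁ ξ.cell f := by
  rw [slide, associator_inv]
  exact comp_eqToHom_heq (d ◁ ξ.cell f) _

theorem slide_natural (ξ : OplaxNormalCocone D C) {x y : Groth W} (f : x ⟶ y)
    {d d' : T ⟶ D.obj x} (η : d ⟶ d') :
    slide ξ f d ≫ (η ▷ D.map f) ▷ ξ.app y = η ▷ ξ.app x ≫ slide ξ f d' := by
  rw [slide, Category.assoc (d ◁ ξ.cell f), ← associator_inv_naturality_left, whisker_exchange_assoc, slide]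

theorem slide_id (ξ : OplaxNormalCocone D C) (x : Groth W) (d : T ⟶ D.obj x) :
    slide ξ (𝟙 x) d ≍ 𝟙 (d ≫ ξ.app x) := by
  refine (slide_heq ξ _ d).trans ?_
  rw [ξ.cell_id, whiskerLeft_eqToHom]
  exact heq_id_of_eqToHom _

theorem slide_comp (ξ : OplaxNormalCocone D C) {x y z : Groth W} (f : x ⟶ y) (g : y ⟶ z)
    (d : T ⟶ D.obj x) :
    slide ξ (f ≫ g) d ≍ slide ξ f d ≫ slide ξ g (d ≫ D.map f) := by
  have h : D.map f ≫ D.map g ≫ ξ.app z = D.map (f ≫ g) ≫ ξ.app z := by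
    rw [D.map_comp, Strict.assoc]
  have e : ξ.cell (f ≫ g) ≍ ξ.cell f ≫ D.map f ◁ ξ.cell g := by
    rw [ξ.cell_comp, ← Category.assoc]
    exact comp_eqToHom_heq _ h
  refine (slide_heq ξ _ d).trans ((whiskerLeft_heq rfl rfl h.symm e).trans ?_)
  rw [Bicategory.whiskerLeft_comp]
  refine heq_comp rfl (Strict.assoc _ _ _).symm (by simp only [Strict.assoc])
    (slide_heq ξ f d).symm ?_
  exact (comp_whiskerLeft_heq _ _ _).symm.trans (slide_heq ξ g _).symm

theorem slide_map₂ (ξ : OplaxNormalCocone D C) {x y : Groth W} {f g : x ⟶ y} (δ : f ⟶ g)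
    (d : T ⟶ D.obj x) : slide ξ f d ≫ (d ◁ D.map₂ δ) ▷ ξ.app y = slide ξ g d := by
  rw [slide, slide, ← ξ.cell_naturality δ, Category.assoc (d ◁ ξ.cell f),
    Bicategory.whiskerLeft_comp, ← associator_inv_naturality_middle,
    Category.assoc (d ◁ ξ.cell f)]

theorem slide_normal (ξ : OplaxNormalCocone D C) {x y : Groth W} (f : x ⟶ y)
    (hf : Groth.IsCleavage f) (d : T ⟶ D.obj x) :
    ∃ h : d ≫ ξ.app x = (d ≫ D.map f) ≫ ξ.app y, slide ξ f d = eqToHom h := by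
  obtain ⟨h, e⟩ := ξ.normal f hf
  refine ⟨(congrArg (d ≫ ·) h).trans (Strict.assoc _ _ _).symm, ?_⟩
  rw [slide, e, associator_inv, whiskerLeft_eqToHom, eqToHom_trans]

/-- The 2-cocone on `K(T, C)` that is represented by a 2-cocone on `C`. -/
@[simps]
def ofCocone (T : K) (ξ : OplaxNormalCocone D C) : HomCocone T D (T ⟶ C) where
  app x := postcompFunctor T (ξ.app x)
  cell f d := slide ξ f d
  cell_natural {_ _} f {_ _} η := slide_natural ξ f η
  cell_id x d := slide_id ξ x d
  cell_comp f g d := slide_comp ξ f g d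
  cell_map₂ δ d := slide_map₂ ξ δ d
  normal f hf d := slide_normal ξ f hf d

/-- The 2-cocone obtained from a functor on `K(T, C)` by restricting it along a 2-cocone on
`C`. -/
abbrev restrict (T : K) (ξ : OplaxNormalCocone D C) (s : (T ⟶ C) ⥤ X) : HomCocone T D X :=
  (ofCocone T ξ).postcomp s

theorem restrict_cell_heq (ξ : OplaxNormalCocone D C) (s : (T ⟶ C) ⥤ X) {x y : Groth W}
    (f : x ⟶ y) (d : T ⟶ D.obj x) : (restrict T ξ s).cell f d ≍ s.map (d ◁ ξ.cell f) :=
  functor_map_heq s rfl (Strict.assoc _ _ _) (slide_heq ξ f d)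

/-- The structure 2-cells are tested on the plain whiskering `d ◁ ξ.cell f`: `slide` differs from it
by an associator, which is an identity in a strict 2-category. -/
theorem restrict_ext {ξ : OplaxNormalCocone D C} {s s' : (T ⟶ C) ⥤ X}
    (h : ∀ x, postcompFunctor T (ξ.app x) ⋙ s = postcompFunctor T (ξ.app x) ⋙ s')
    (h' : ∀ {x y : Groth W} (f : x ⟶ y) (d : T ⟶ D.obj x),
      s.map (d ◁ ξ.cell f) ≍ s'.map (d ◁ ξ.cell f)) : restrict T ξ s = restrict T ξ s' :=
  ext_of_heq h fun f d =>
    (restrict_cell_heq ξ s f d).trans ((h' f d).trans (restrict_cell_heq ξ s' f d).symm)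

theorem obj_of_restrict_eq {ξ : OplaxNormalCocone D C} {s : (T ⟶ C) ⥤ X}
    {σ : HomCocone T D X} (h : restrict T ξ s = σ) {x : Groth W} (d : T ⟶ D.obj x) :
    s.obj (d ≫ ξ.app x) = (σ.app x).obj d := by
  subst h; rfl

theorem map_of_restrict_eq {ξ : OplaxNormalCocone D C} {s : (T ⟶ C) ⥤ X}
    {σ : HomCocone T D X} (h : restrict T ξ s = σ) {x : Groth W} {d d' : T ⟶ D.obj x}
    (η : d ⟶ d') : s.map (η ▷ ξ.app x) ≍ (σ.app x).map η := by
  subst h; rfl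

theorem cell_of_restrict_eq {ξ : OplaxNormalCocone D C} {s : (T ⟶ C) ⥤ X}
    {σ : HomCocone T D X} (h : restrict T ξ s = σ) {x y : Groth W} (f : x ⟶ y)
    (d : T ⟶ D.obj x) : s.map (d ◁ ξ.cell f) ≍ σ.cell f d := by
  subst h; exact (restrict_cell_heq ξ s f d).symm

/-- The 2-cocone on the category of arrows that is given by a family of morphisms between the
values of two functors on `K(T, C)`. -/
def ofArrows (ξ : OplaxNormalCocone D C) {s s' : (T ⟶ C) ⥤ X}
    (a : ∀ (x : Groth W) (d : T ⟶ D.obj x), s.obj (d ≫ ξ.app x) ⟶ s'.obj (d ≫ ξ.app x))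
    (ha : ∀ (x : Groth W) {d d' : T ⟶ D.obj x} (η : d ⟶ d'),
      s.map (η ▷ ξ.app x) ≫ a x d' = a x d ≫ s'.map (η ▷ ξ.app x))
    (ha' : ∀ {x y : Groth W} (f : x ⟶ y) (d : T ⟶ D.obj x),
      (restrict T ξ s).cell f d ≫ a y (d ≫ D.map f) = a x d ≫ (restrict T ξ s').cell f d) :
    HomCocone T D (Arrow X) where
  app x :=
    { obj d := Arrow.mk (a x d)
      map η := Arrow.homMk (s.map (η ▷ ξ.app x)) (s'.map (η ▷ ξ.app x)) (ha x η)
      map_id d := by ext <;> simp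
      map_comp η θ := by ext <;> simp }
  cell f d := Arrow.homMk ((restrict T ξ s).cell f d) ((restrict T ξ s').cell f d) (ha' f d)
  cell_natural {_ _} f {d d'} η := by
    ext
    · exact (restrict T ξ s).cell_natural f η
    · exact (restrict T ξ s').cell_natural f η
  cell_id x d := by
    have h : d ≫ D.map (𝟙 x) = d := by rw [D.map_id, Strict.comp_id]
    refine arrow_hom_heq rfl (congrArg (fun d => Arrow.mk (a x d)) h) ?_ ?_
    · exact (restrict T ξ s).cell_id x d
    · exact (restrict T ξ s').cell_id x d
  cell_comp {x y z} f g d := by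
    have h : d ≫ D.map (f ≫ g) = (d ≫ D.map f) ≫ D.map g := by rw [D.map_comp, Strict.assoc]
    refine arrow_hom_heq rfl (congrArg (fun d => Arrow.mk (a z d)) h) ?_ ?_
    · exact (restrict T ξ s).cell_comp f g d
    · exact (restrict T ξ s').cell_comp f g d
  cell_map₂ δ d := by
    ext
    · exact (restrict T ξ s).cell_map₂ δ d
    · exact (restrict T ξ s').cell_map₂ δ d
  normal {x y} f hf d := by
    obtain ⟨h, e⟩ := (restrict T ξ s).normal f hf d
    obtain ⟨h', e'⟩ := (restrict T ξ s').normal f hf d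
    -- With both structure cells equal to identities, the compatibility square forces the arrows `a
    -- x d` and `a y (d ≫ D.map f)` to coincide. This is the equality of objects of `Arrow X` that
    -- normality asks for.
    have w := ha' f d
    rw [e, e'] at w
    have w' : Arrow.mk (a x d) = Arrow.mk (a y (d ≫ D.map f)) :=
      arrowMk_inj_of_heq h h' ((comp_eqToHom_heq (a x d) h').symm.trans
        ((heq_of_eq w.symm).trans (eqToHom_comp_heq _ _)))
    refine ⟨w', eq_of_heq ((arrow_hom_heq rfl w'.symm ?_ ?_).trans
      (heq_id_of_eqToHom w').symm)⟩
    · exact (heq_of_eq e).trans (heq_id_of_eqToHom h)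
    · exact (heq_of_eq e').trans (heq_id_of_eqToHom h')

end HomCocone

/-- A 2-cocone `ξ` on `C` is universal for the hom-categories out of `T` if restriction along `ξ`
is a bijection from functors on `K(T, C)` to 2-cocones on categories for `K(T, D(-))`. -/
def HomUniversal {D : StrictPseudofunctor (Groth W) K} {C : K} (T : K)
    (ξ : OplaxNormalCocone D C) : Prop :=
  ∀ (X : Type v) [Category.{v} X],
    Function.Bijective (HomCocone.restrict (X := X) T ξ)

namespace HomUniversal

variable {T : K} {D : StrictPseudofunctor (Groth W) K} {C : K} {ξ : OplaxNormalCocone D C}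
  {X : Type v} [Category.{v} X]

theorem functor_ext (hξ : HomUniversal T ξ) {s s' : (T ⟶ C) ⥤ X}
    (h : ∀ x, postcompFunctor T (ξ.app x) ⋙ s = postcompFunctor T (ξ.app x) ⋙ s')
    (h' : ∀ {x y : Groth W} (f : x ⟶ y) (d : T ⟶ D.obj x),
      s.map (d ◁ ξ.cell f) ≍ s'.map (d ◁ ξ.cell f)) : s = s' :=
  (hξ X).1 (HomCocone.restrict_ext h h')

/-- A natural transformation is a functor to the category of arrows, so the 2-dimensional uniqueness
is the injectivity of restriction for `Arrow X`. Equality on objects of the form `d ≫ ξ.app x`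
suffices, because in `Arrow X` morphisms are compared through their sides, which are values of the
same two functors. -/
theorem natTrans_heq (hξ : HomUniversal T ξ) {s s' t t' : (T ⟶ C) ⥤ X} (hs : s = t)
    (hs' : s' = t') {α : s ⟶ s'} {β : t ⟶ t'}
    (h : ∀ (x : Groth W) (d : T ⟶ D.obj x), α.app (d ≫ ξ.app x) ≍ β.app (d ≫ ξ.app x)) :
    α ≍ β := by
  subst hs hs'
  have e : natTransToArrow α = natTransToArrow β := by
    have o : ∀ (x : Groth W) (d : T ⟶ D.obj x), Arrow.mk (α.app (d ≫ ξ.app x)) =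
        Arrow.mk (β.app (d ≫ ξ.app x)) := fun x d => congrArg Arrow.mk (eq_of_heq (h x d))
    refine hξ.functor_ext (fun x => ?_) fun {x y} f d => ?_
    · refine Functor.hext (o x) fun d d' η => ?_
      exact arrow_hom_heq (o x d) (o x d') HEq.rfl HEq.rfl
    · refine arrow_hom_heq (o x d) ?_ HEq.rfl HEq.rfl
      change Arrow.mk (α.app (d ≫ D.map f ≫ ξ.app y)) = Arrow.mk (β.app (d ≫ D.map f ≫ ξ.app y))
      rw [← Strict.assoc]
      exact o y _
  refine heq_of_eq (NatTrans.ext (funext fun c => ?_))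
  exact eq_of_heq (heq_of_arrowMk_eq (Functor.congr_obj e c))

/-- The family `a` is a 2-cocone on `Arrow X`, and surjectivity of restriction for `Arrow X` extends
it to a functor; such a functor is a natural transformation. -/
theorem exists_natTrans (hξ : HomUniversal T ξ) {s s' : (T ⟶ C) ⥤ X}
    (a : ∀ (x : Groth W) (d : T ⟶ D.obj x), s.obj (d ≫ ξ.app x) ⟶ s'.obj (d ≫ ξ.app x))
    (ha : ∀ (x : Groth W) {d d' : T ⟶ D.obj x} (η : d ⟶ d'),
      s.map (η ▷ ξ.app x) ≫ a x d' = a x d ≫ s'.map (η ▷ ξ.app x))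
    (ha' : ∀ {x y : Groth W} (f : x ⟶ y) (d : T ⟶ D.obj x),
      (HomCocone.restrict T ξ s).cell f d ≫ a y (d ≫ D.map f) =
        a x d ≫ (HomCocone.restrict T ξ s').cell f d) :
    ∃ α : s ⟶ s', ∀ (x : Groth W) (d : T ⟶ D.obj x), α.app (d ≫ ξ.app x) = a x d := by
  obtain ⟨S, hS⟩ := (hξ (Arrow X)).2 (HomCocone.ofArrows ξ a ha ha')
  -- Source and target of the arrows given by `S` agree with `s` and `s'` a priori only after
  -- restriction. Injectivity for X itself makes them equal, after which whiskering with
  -- `Arrow.leftToRight` has the required type.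
  have hl : S ⋙ Arrow.leftFunc = s := hξ.functor_ext
    (fun x => Functor.hext
      (fun d => congrArg Comma.left (HomCocone.obj_of_restrict_eq hS d))
      (fun d d' η => arrow_hom_left_heq (HomCocone.obj_of_restrict_eq hS d)
        (HomCocone.obj_of_restrict_eq hS d') (HomCocone.map_of_restrict_eq hS η)))
    (fun {x y} f d => by
      refine (arrow_hom_left_heq (HomCocone.obj_of_restrict_eq hS d) ?_
        (HomCocone.cell_of_restrict_eq hS f d)).trans (HomCocone.restrict_cell_heq ξ s f d)
      rw [← Strict.assoc]
      exact HomCocone.obj_of_restrict_eq hS _)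
  have hr : S ⋙ Arrow.rightFunc = s' := hξ.functor_ext
    (fun x => Functor.hext
      (fun d => congrArg Comma.right (HomCocone.obj_of_restrict_eq hS d))
      (fun d d' η => arrow_hom_right_heq (HomCocone.obj_of_restrict_eq hS d)
        (HomCocone.obj_of_restrict_eq hS d') (HomCocone.map_of_restrict_eq hS η)))
    (fun {x y} f d => by
      refine (arrow_hom_right_heq (HomCocone.obj_of_restrict_eq hS d) ?_
        (HomCocone.cell_of_restrict_eq hS f d)).trans (HomCocone.restrict_cell_heq ξ s' f d)
      rw [← Strict.assoc]
      exact HomCocone.obj_of_restrict_eq hS _)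
  subst hl hr
  refine ⟨Functor.whiskerLeft S Arrow.leftToRight, fun x d => eq_of_heq (heq_of_arrowMk_eq ?_)⟩
  exact HomCocone.obj_of_restrict_eq hS d

end HomUniversal

end HomCocone

end TwoCat

namespace TwoCat

/-! ### The exponential of a category along an opfibration -/

section FibreExp

variable {𝓔 : Type u₁} [Category.{v₁} 𝓔] {𝓑 : Type u₂} [Category.{v₂} 𝓑] {p : 𝓔 ⥤ 𝓑}
  {X : Type u₃} [Category.{v₃} X]

theorem isHomLift_of_heq {a b : 𝓔} {R S : 𝓑} {f : R ⟶ S} {φ : a ⟶ b} (ha : p.obj a = R)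
    (hb : p.obj b = S) (h : p.map φ ≍ f) : p.IsHomLift f φ := by
  subst ha hb
  obtain rfl := eq_of_heq h
  infer_instance

theorem map_heq_of_isHomLift {a b : 𝓔} {R S : 𝓑} {f : R ⟶ S} {φ : a ⟶ b}
    (h : p.IsHomLift f φ) : p.map φ ≍ f := by
  obtain ⟨⟩ := h; rfl

theorem isHomLift_comp {a b c : 𝓔} {R S T : 𝓑} {f : R ⟶ S} {g : S ⟶ T} {φ : a ⟶ b} {ψ : b ⟶ c}
    (h : p.IsHomLift f φ) (h' : p.IsHomLift g ψ) : p.IsHomLift (f ≫ g) (φ ≫ ψ) :=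
  inferInstance

/-- A functor is an opfibration if every morphism of the base has cocartesian lifts. -/
class IsOpfibration (p : 𝓔 ⥤ 𝓑) : Prop where
  exists_lift {e : 𝓔} {b b' : 𝓑} (β : b ⟶ b') (h : p.obj e = b) :
    ∃ (e' : 𝓔) (l : e ⟶ e'), p.IsStronglyCocartesian β l

/-- An object of the exponential of `X` along `p`: an object `base` of the base of `p`, and a
functor to `X` from the fibre of `p` over it. -/
structure FibreExp (p : 𝓔 ⥤ 𝓑) (X : Type u₃) [Category.{v₃} X] where
  base : 𝓑
  obj (e : 𝓔) (h : p.obj e = base) : X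
  map {e e' : 𝓔} (h : p.obj e = base) (h' : p.obj e' = base) (t : e ⟶ e')
    (ht : p.IsHomLift (𝟙 base) t) : obj e h ⟶ obj e' h'
  map_id {e : 𝓔} (h : p.obj e = base) (ht : p.IsHomLift (𝟙 base) (𝟙 e)) :
    map h h (𝟙 e) ht = 𝟙 (obj e h)
  map_comp {e e' e'' : 𝓔} (h : p.obj e = base) (h' : p.obj e' = base) (h'' : p.obj e'' = base)
    (t : e ⟶ e') (t' : e' ⟶ e'') (ht : p.IsHomLift (𝟙 base) t) (ht' : p.IsHomLift (𝟙 base) t')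
    (htt' : p.IsHomLift (𝟙 base) (t ≫ t')) :
    map h h'' (t ≫ t') htt' = map h h' t ht ≫ map h' h'' t' ht'

namespace FibreExp

/-- A morphism of the exponential of `X` along `p`: a morphism `base` of the base of `p`, and
morphisms of `X` indexed by all the morphisms over `base` that are natural with respect to the
morphisms of the fibres. -/
@[ext]
structure Hom (P Q : FibreExp p X) where
  base : P.base ⟶ Q.base
  app {e e' : 𝓔} (h : p.obj e = P.base) (h' : p.obj e' = Q.base) (t : e ⟶ e')
    (ht : p.IsHomLift base t) : P.obj e h ⟶ Q.obj e' h'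
  map_app {e e' e'' : 𝓔} (h : p.obj e = P.base) (h' : p.obj e' = P.base)
    (h'' : p.obj e'' = Q.base) (t : e ⟶ e') (t' : e' ⟶ e'') (ht : p.IsHomLift (𝟙 P.base) t)
    (ht' : p.IsHomLift base t') (htt' : p.IsHomLift base (t ≫ t')) :
    app h h'' (t ≫ t') htt' = P.map h h' t ht ≫ app h' h'' t' ht'
  app_map {e e' e'' : 𝓔} (h : p.obj e = P.base) (h' : p.obj e' = Q.base)
    (h'' : p.obj e'' = Q.base) (t : e ⟶ e') (t' : e' ⟶ e'') (ht : p.IsHomLift base t)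
    (ht' : p.IsHomLift (𝟙 Q.base) t') (htt' : p.IsHomLift base (t ≫ t')) :
    app h h'' (t ≫ t') htt' = app h h' t ht ≫ Q.map h' h'' t' ht'

/-- The identity of an object of the exponential. -/
@[simps]
def Hom.id (P : FibreExp p X) : Hom P P where
  base := 𝟙 P.base
  app h h' t ht := P.map h h' t ht
  map_app h h' h'' t t' ht ht' htt' := P.map_comp h h' h'' t t' ht ht' htt'
  app_map h h' h'' t t' ht ht' htt' := P.map_comp h h' h'' t t' ht ht' htt'

section

variable [hp : IsOpfibration p] {P Q R S : FibreExp p X}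

/-- The codomain of a cocartesian lift. -/
noncomputable def liftCod {e : 𝓔} {b b' : 𝓑} (β : b ⟶ b') (h : p.obj e = b) : 𝓔 :=
  (hp.exists_lift β h).choose

/-- A cocartesian lift. -/
noncomputable def lift {e : 𝓔} {b b' : 𝓑} (β : b ⟶ b') (h : p.obj e = b) : e ⟶ liftCod β h :=
  (hp.exists_lift β h).choose_spec.choose

instance {e : 𝓔} {b b' : 𝓑} (β : b ⟶ b') (h : p.obj e = b) :
    p.IsStronglyCocartesian β (lift β h) :=
  (hp.exists_lift β h).choose_spec.choose_spec

theorem liftCod_over {e : 𝓔} {b b' : 𝓑} (β : b ⟶ b') (h : p.obj e = b) :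
    p.obj (liftCod β h) = b' :=
  IsHomLift.codomain_eq p β (lift β h)

/-- The factorization of a morphism through a cocartesian lift. -/
noncomputable def desc {e e' : 𝓔} {b b' b'' : 𝓑} (β : b ⟶ b') (β' : b' ⟶ b'')
    (h : p.obj e = b) (t : e ⟶ e') (ht : p.IsHomLift (β ≫ β') t) : liftCod β h ⟶ e' :=
  Functor.IsStronglyCocartesian.map p β (lift β h) (rfl : β ≫ β' = β ≫ β') t

theorem desc_over {e e' : 𝓔} {b b' b'' : 𝓑} (β : b ⟶ b') (β' : b' ⟶ b'')
    (h : p.obj e = b) (t : e ⟶ e') (ht : p.IsHomLift (β ≫ β') t) :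
    p.IsHomLift β' (desc β β' h t ht) :=
  Functor.IsStronglyCocartesian.map_isHomLift p β (lift β h) (rfl : β ≫ β' = β ≫ β') t

theorem lift_desc {e e' : 𝓔} {b b' b'' : 𝓑} (β : b ⟶ b') (β' : b' ⟶ b'')
    (h : p.obj e = b) (t : e ⟶ e') (ht : p.IsHomLift (β ≫ β') t) :
    lift β h ≫ desc β β' h t ht = t :=
  Functor.IsStronglyCocartesian.fac p β (lift β h) (rfl : β ≫ β' = β ≫ β') t

theorem desc_unique {e e' : 𝓔} {b b' b'' : 𝓑} (β : b ⟶ b') (β' : b' ⟶ b'')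
    (h : p.obj e = b) (t : e ⟶ e') (ht : p.IsHomLift (β ≫ β') t) (χ : liftCod β h ⟶ e')
    (hχ : p.IsHomLift β' χ) (w : lift β h ≫ χ = t) : desc β β' h t ht = χ :=
  (Functor.IsStronglyCocartesian.map_uniq p β (lift β h) (rfl : β ≫ β' = β ≫ β') t χ w).symm

/-- The component of the composite at `t`, in terms of a cocartesian lift through which `t`
factors. -/
noncomputable def compApp (φ : Hom P Q) (ψ : Hom Q R) {e e' : 𝓔} (h : p.obj e = P.base)
    (h' : p.obj e' = R.base) (t : e ⟶ e') (ht : p.IsHomLift (φ.base ≫ ψ.base) t) :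
    P.obj e h ⟶ R.obj e' h' :=
  φ.app h (liftCod_over φ.base h) (lift φ.base h) inferInstance ≫
    ψ.app (liftCod_over φ.base h) h' (desc φ.base ψ.base h t ht) (desc_over _ _ _ _ _)

/-- Independence of the factorization, as in Conduché's criterion. Any first factor `t` is the
cocartesian lift followed by a morphism u of the fibre, and the second factor of the chosen
factorization is then `u ≫ t'`. Naturality of φ and of ψ with respect to u moves u from one side of
the composite to the other. -/
theorem compApp_eq (φ : Hom P Q) (ψ : Hom Q R) {e e' e'' : 𝓔} (h : p.obj e = P.base)
    (h' : p.obj e' = Q.base) (h'' : p.obj e'' = R.base) (t : e ⟶ e') (t' : e' ⟶ e'')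
    (ht : p.IsHomLift φ.base t) (ht' : p.IsHomLift ψ.base t') {s : e ⟶ e''} (w : t ≫ t' = s)
    (hs : p.IsHomLift (φ.base ≫ ψ.base) s) :
    compApp φ ψ h h'' s hs = φ.app h h' t ht ≫ ψ.app h' h'' t' ht' := by
  -- Regarding `t` as a lift of `φ.base ≫ 𝟙` makes its factorization through the cocartesian lift
  -- vertical.
  have h₁ : p.IsHomLift (φ.base ≫ 𝟙 _) t := by rw [Category.comp_id]; exact ht
  have hv := desc_over φ.base (𝟙 _) h t h₁
  have e₁ : desc φ.base ψ.base h s hs = desc φ.base (𝟙 _) h t h₁ ≫ t' :=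
    desc_unique _ _ _ _ _ _ inferInstance (by rw [← Category.assoc, lift_desc, w])
  have e₂ : φ.app h h' t ht = φ.app h (liftCod_over φ.base h) (lift φ.base h) inferInstance ≫
      Q.map (liftCod_over φ.base h) h' (desc φ.base (𝟙 _) h t h₁) hv := by
    rw [← φ.app_map h (liftCod_over φ.base h) h' _ _ _ hv
      (by rw [lift_desc]; exact ht)]
    congr 1
    exact (lift_desc _ _ _ _ _).symm
  have e₃ := ψ.map_app (liftCod_over φ.base h) h' h'' (desc φ.base (𝟙 _) h t h₁) t' hv ht'
    inferInstance
  rw [e₂, Category.assoc, ← e₃, compApp]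
  congr 2

/-- Together with `compApp_eq` this allows a composite to be evaluated on whichever factorization is
convenient. -/
theorem exists_factor (β : P.base ⟶ Q.base) (β' : Q.base ⟶ R.base) {e e' : 𝓔}
    (h : p.obj e = P.base) (t : e ⟶ e') (ht : p.IsHomLift (β ≫ β') t) :
    ∃ (d : 𝓔) (_ : p.obj d = Q.base) (l : e ⟶ d) (χ : d ⟶ e'), p.IsHomLift β l ∧
      p.IsHomLift β' χ ∧ l ≫ χ = t :=
  ⟨_, liftCod_over β h, lift β h, desc β β' h t ht, inferInstance, desc_over _ _ _ _ _,
    lift_desc _ _ _ _ _⟩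

/-- The composite of morphisms of the exponential. -/
@[simps]
noncomputable def Hom.comp (φ : Hom P Q) (ψ : Hom Q R) : Hom P R where
  base := φ.base ≫ ψ.base
  app h h' t ht := compApp φ ψ h h' t ht
  map_app {e e' e''} h h' h'' t t' ht ht' htt' := by
    obtain ⟨d, hd, l, χ, hl, hχ, w⟩ := exists_factor φ.base ψ.base h' t' ht'
    have h₁ : p.IsHomLift φ.base (t ≫ l) := inferInstance
    rw [compApp_eq φ ψ h' hd h'' l χ hl hχ w,
      compApp_eq φ ψ h hd h'' (t ≫ l) χ h₁ hχ (by rw [Category.assoc, w]),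
      φ.map_app h h' hd t l ht hl h₁, Category.assoc]
  app_map {e e' e''} h h' h'' t t' ht ht' htt' := by
    obtain ⟨d, hd, l, χ, hl, hχ, w⟩ := exists_factor φ.base ψ.base h t ht
    have h₁ : p.IsHomLift ψ.base (χ ≫ t') := inferInstance
    rw [compApp_eq φ ψ h hd h' l χ hl hχ w,
      compApp_eq φ ψ h hd h'' l (χ ≫ t') hl h₁ (by rw [← w, Category.assoc]),
      ψ.app_map hd h' h'' χ t' hχ ht' h₁, Category.assoc]

theorem Hom.ext_of_app {φ ψ : Hom P Q} (hb : φ.base = ψ.base)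
    (ha : ∀ {e e' : 𝓔} (h : p.obj e = P.base) (h' : p.obj e' = Q.base) (t : e ⟶ e')
      (ht : p.IsHomLift φ.base t) (ht' : p.IsHomLift ψ.base t),
      φ.app h h' t ht = ψ.app h h' t ht') : φ = ψ := by
  obtain ⟨b, a, _, _⟩ := φ
  obtain ⟨b', a', _, _⟩ := ψ
  obtain rfl : b = b' := hb
  obtain rfl : @a = @a' := by
    funext e e' h h' t ht
    exact ha h h' t ht ht
  rfl

/-- For associativity, a morphism over a triple composite is split as `l ≫ l' ≫ χ'`, one factor over
each base morphism. On such a splitting both bracketings give the product of the three components.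
-/
noncomputable instance : Category (FibreExp p X) where
  Hom := Hom
  id := Hom.id
  comp := Hom.comp
  id_comp {P Q} φ := Hom.ext_of_app (Category.id_comp _) (fun {e e'} h h' t ht ht' => by
    have h₁ : p.IsHomLift (𝟙 P.base) (𝟙 e) := IsHomLift.id h
    refine (compApp_eq (Hom.id P) φ h h h' (𝟙 e) t h₁ ht' (Category.id_comp t) ht).trans ?_
    rw [Hom.id_app, P.map_id, Category.id_comp])
  comp_id {P Q} φ := Hom.ext_of_app (Category.comp_id _) (fun {e e'} h h' t ht ht' => by
    have h₁ : p.IsHomLift (𝟙 Q.base) (𝟙 e') := IsHomLift.id h'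
    refine (compApp_eq φ (Hom.id Q) h h' h' t (𝟙 e') ht' h₁ (Category.comp_id t) ht).trans ?_
    rw [Hom.id_app, Q.map_id, Category.comp_id])
  assoc {P Q R S} φ ψ θ := Hom.ext_of_app (Category.assoc _ _ _)
    (fun {e e'} h h' t ht ht' => by
      obtain ⟨d, hd, l, χ, hl, hχ, w⟩ := exists_factor φ.base (ψ.comp θ).base h t ht'
      obtain ⟨d', hd', l', χ', hl', hχ', w'⟩ := exists_factor ψ.base θ.base hd χ hχ
      have h₁ := compApp_eq φ (ψ.comp θ) h hd h' l χ hl hχ w ht'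
      have h₂ := compApp_eq ψ θ hd hd' h' l' χ' hl' hχ' w' hχ
      have h₃ : p.IsHomLift (φ.comp ψ).base (l ≫ l') := isHomLift_comp hl hl'
      have h₅ := compApp_eq (φ.comp ψ) θ h hd' h' (l ≫ l') χ' h₃ hχ'
        (by rw [Category.assoc, w', w]) ht
      have h₆ := compApp_eq φ ψ h hd hd' l l' hl hl' rfl h₃
      exact h₅.trans ((congrArg (· ≫ _) h₆).trans ((Category.assoc _ _ _).trans
        ((congrArg (_ ≫ ·) h₂.symm).trans h₁.symm))))

theorem comp_app (φ : P ⟶ Q) (ψ : Q ⟶ R) {e e' e'' : 𝓔} (h : p.obj e = P.base)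
    (h' : p.obj e' = Q.base) (h'' : p.obj e'' = R.base) (t : e ⟶ e') (t' : e' ⟶ e'')
    (ht : p.IsHomLift φ.base t) (ht' : p.IsHomLift ψ.base t') {s : e ⟶ e''} (w : t ≫ t' = s)
    (hs : p.IsHomLift (φ ≫ ψ).base s) :
    (φ ≫ ψ).app h h'' s hs = φ.app h h' t ht ≫ ψ.app h' h'' t' ht' :=
  compApp_eq φ ψ h h' h'' t t' ht ht' w hs

@[simp] theorem id_base (P : FibreExp p X) : Hom.base (𝟙 P) = 𝟙 P.base := rfl

@[simp] theorem comp_base (φ : P ⟶ Q) (ψ : Q ⟶ R) : (φ ≫ ψ).base = φ.base ≫ ψ.base := rfl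

theorem obj_ext {P P' : FibreExp p X} (hb : P.base = P'.base)
    (ho : ∀ (e : 𝓔) (h : p.obj e = P.base) (h' : p.obj e = P'.base), P.obj e h = P'.obj e h')
    (hm : ∀ {e e' : 𝓔} (h : p.obj e = P.base) (h' : p.obj e' = P.base) (h₁ : p.obj e = P'.base)
      (h₁' : p.obj e' = P'.base) (t : e ⟶ e') (ht : p.IsHomLift (𝟙 P.base) t)
      (ht' : p.IsHomLift (𝟙 P'.base) t), P.map h h' t ht ≍ P'.map h₁ h₁' t ht') : P = P' := by
  obtain ⟨b, o, m, _, _⟩ := P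
  obtain ⟨b', o', m', _, _⟩ := P'
  obtain rfl : b = b' := hb
  obtain rfl : o = o' := by
    funext e h
    exact ho e h h
  obtain rfl : @m = @m' := by
    funext e e' h h' t ht
    exact eq_of_heq (hm h h' h h' t ht ht)
  rfl

theorem hom_heq {P P' Q Q' : FibreExp p X} (hP : P = P') (hQ : Q = Q') {φ : P ⟶ Q}
    {φ' : P' ⟶ Q'} (hb : φ.base ≍ φ'.base)
    (ha : ∀ {e e' : 𝓔} (h : p.obj e = P.base) (h' : p.obj e' = Q.base) (h₁ : p.obj e = P'.base)
      (h₁' : p.obj e' = Q'.base) (t : e ⟶ e') (ht : p.IsHomLift φ.base t)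
      (ht' : p.IsHomLift φ'.base t), φ.app h h' t ht ≍ φ'.app h₁ h₁' t ht') : φ ≍ φ' := by
  subst hP hQ
  exact heq_of_eq (Hom.ext_of_app (eq_of_heq hb) fun h h' t ht ht' =>
    eq_of_heq (ha h h' h h' t ht ht'))

theorem obj_congr {P P' : FibreExp p X} (hP : P = P') {e e' : 𝓔} (he : e = e')
    (h : p.obj e = P.base) (h' : p.obj e' = P'.base) : P.obj e h = P'.obj e' h' := by
  subst hP he; rfl

theorem app_congr {P P' Q Q' : FibreExp p X} (hP : P = P') (hQ : Q = Q') {φ : P ⟶ Q}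
    {φ' : P' ⟶ Q'} (hφ : φ ≍ φ') {e e' e₁ e₁' : 𝓔} (he : e = e₁) (he' : e' = e₁') {t : e ⟶ e'}
    {t₁ : e₁ ⟶ e₁'} (hh : t ≍ t₁) (h : p.obj e = P.base) (h' : p.obj e' = Q.base)
    (h₁ : p.obj e₁ = P'.base) (h₁' : p.obj e₁' = Q'.base) (ht : p.IsHomLift φ.base t)
    (ht' : p.IsHomLift φ'.base t₁) : φ.app h h' t ht ≍ φ'.app h₁ h₁' t₁ ht' := by
  subst hP hQ he he'
  obtain rfl := eq_of_heq hφ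
  obtain rfl := eq_of_heq hh
  rfl

theorem base_congr {P P' Q Q' : FibreExp p X} (hP : P = P') (hQ : Q = Q') {φ : P ⟶ Q}
    {φ' : P' ⟶ Q'} (hφ : φ ≍ φ') : φ.base ≍ φ'.base := by
  subst hP hQ
  obtain rfl := eq_of_heq hφ
  rfl

/-- The projection from the exponential to the base. -/
@[simps]
noncomputable def baseFunctor (p : 𝓔 ⥤ 𝓑) [IsOpfibration p] (X : Type u₃) [Category.{v₃} X] :
    FibreExp p X ⥤ 𝓑 where
  obj P := P.base
  map φ := φ.base

end

end FibreExp

end FibreExp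

end TwoCat

namespace TwoCat

/-! ### Transposition between strict pullbacks of categories and exponentials -/

section CatPullback

variable {𝓔 : Type u₁} [Category.{v₁} 𝓔] {𝓑 : Type u₂} [Category.{v₂} 𝓑] {p : 𝓔 ⥤ 𝓑}
  {X : Type u₃} [Category.{v₃} X] {𝓨 : Type u} [Category.{v} 𝓨] {F : 𝓨 ⥤ 𝓑}

/-- An object of the strict pullback of categories of `p` along `F`. -/
@[ext]
structure CatPullback (F : 𝓨 ⥤ 𝓑) (p : 𝓔 ⥤ 𝓑) where
  left : 𝓨
  right : 𝓔
  w : p.obj right = F.obj left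

namespace CatPullback

/-- A morphism of the strict pullback of categories. -/
@[ext]
structure Hom (a b : CatPullback F p) where
  left : a.left ⟶ b.left
  right : a.right ⟶ b.right
  w : p.IsHomLift (F.map left) right

@[simps]
instance : Category (CatPullback F p) where
  Hom := Hom
  id a := Hom.mk (𝟙 a.left) (𝟙 a.right) (by rw [F.map_id]; exact IsHomLift.id a.w)
  comp φ ψ := Hom.mk (φ.left ≫ ψ.left) (φ.right ≫ ψ.right) (by
    rw [F.map_comp]; exact isHomLift_comp φ.w ψ.w)

theorem hom_ext {a b : CatPullback F p} {φ ψ : a ⟶ b} (h : φ.left = ψ.left)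
    (h' : φ.right = ψ.right) : φ = ψ := Hom.ext h h'

variable [IsOpfibration p]

/-- The functor to the exponential along `p` that corresponds to a functor on the pullback. -/
@[simps]
def transpose (S : CatPullback F p ⥤ X) : 𝓨 ⥤ FibreExp p X where
  obj y :=
    { base := F.obj y
      obj e h := S.obj (CatPullback.mk y e h)
      map {e e'} h h' t ht :=
        S.map (X := CatPullback.mk y e h) (Y := CatPullback.mk y e' h')
          (Hom.mk (𝟙 y) t (by rw [F.map_id]; exact ht))
      map_id h ht := S.map_id _
      map_comp h h' h'' t t' ht ht' htt' := by
        rw [← S.map_comp]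
        exact congrArg S.map (hom_ext (Category.comp_id _).symm rfl) }
  map {y y'} η :=
    { base := F.map η
      app {e e'} h h' t ht := S.map (X := CatPullback.mk y e h) (Y := CatPullback.mk y' e' h')
          (Hom.mk η t ht)
      map_app h h' h'' t t' ht ht' htt' := by
        rw [← S.map_comp]
        exact congrArg S.map (hom_ext (Category.id_comp _).symm rfl)
      app_map h h' h'' t t' ht ht' htt' := by
        rw [← S.map_comp]
        exact congrArg S.map (hom_ext (Category.comp_id _).symm rfl) }
  map_id y := FibreExp.Hom.ext_of_app (F.map_id y) fun h h' t ht ht' => rfl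
  map_comp {y y' y''} η θ := FibreExp.Hom.ext_of_app (F.map_comp η θ) fun {e e'} h h' t ht ht' => by
    -- A morphism over `F.map (η ≫ θ)` carries no splitting over `F.map η` and `F.map θ`; the
    -- opfibration supplies one, and functoriality of `S` is then applied to the two pieces.
    obtain ⟨d, hd, l, χ, hl, hχ, w⟩ := FibreExp.exists_factor (P := FibreExp.mk (F.obj y) 
      (fun e h => S.obj (CatPullback.mk y e h)) _ _ _) _ _ h t ht'
    refine Eq.trans ?_ (FibreExp.comp_app _ _ h hd h' l χ hl hχ w _).symm
    dsimp only
    rw [← S.map_comp]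
    exact congrArg S.map (hom_ext rfl w.symm)

/-- The functor on the pullback that corresponds to a functor to the exponential along `p`. -/
@[simps]
def untranspose (G : 𝓨 ⥤ FibreExp p X) (hG : G ⋙ FibreExp.baseFunctor p X = F) :
    CatPullback F p ⥤ X where
  obj a := (G.obj a.left).obj a.right (by subst hG; exact a.w)
  map φ := (G.map φ.left).app _ _ φ.right (by subst hG; exact φ.w)
  map_id a := by
    subst hG
    have h₁ : p.IsHomLift (𝟙 (G.obj a.left).base) (𝟙 a.right) := IsHomLift.id a.w
    refine Eq.trans ?_ ((G.obj a.left).map_id a.w h₁)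
    refine eq_of_heq (FibreExp.app_congr rfl rfl (φ' := 𝟙 (G.obj a.left)) (heq_of_eq ?_) rfl rfl
      HEq.rfl _ _ _ _ _ h₁)
    exact G.map_id a.left
  map_comp {a b d} φ ψ := by
    subst hG
    have h₁ : p.IsHomLift (G.map φ.left ≫ G.map ψ.left).base (φ.right ≫ ψ.right) :=
      isHomLift_comp φ.w ψ.w
    refine Eq.trans ?_ (FibreExp.comp_app (G.map φ.left) (G.map ψ.left) a.w b.w d.w φ.right
      ψ.right φ.w ψ.w rfl h₁)
    refine eq_of_heq (FibreExp.app_congr rfl rfl (heq_of_eq ?_) rfl rfl HEq.rfl _ _ _ _ _ h₁)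
    exact G.map_comp φ.left ψ.left

end CatPullback

end CatPullback

end TwoCat

namespace TwoCat

/-! ### Hom-categories into 2-pullbacks, and the fillings of change of base -/

section PullbackHom

variable {K : Type u} [Bicategory.{v, v} K] [Strict K] {T : K}

namespace TwoPullback

variable {X Y Z : K} {f : X ⟶ Z} {g : Y ⟶ Z} (P : TwoPullback f g)

theorem existsUnique_cell_heq {m m' : T ⟶ P.pt} {a a' : T ⟶ X} {b b' : T ⟶ Y}
    (ha : m ≫ P.fst = a) (ha' : m' ≫ P.fst = a') (hb : m ≫ P.snd = b) (hb' : m' ≫ P.snd = b')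
    (η : a ⟶ a') (t : b ⟶ b') (e : t ▷ g ≍ η ▷ f) :
    ∃! γ : m ⟶ m', γ ▷ P.fst ≍ η ∧ γ ▷ P.snd ≍ t := by
  subst ha ha' hb hb'
  simpa only [heq_eq_eq] using P.existsUnique_cell η t e.symm

theorem whiskerRight_fst_heq {m m' : T ⟶ P.pt} (γ : m ⟶ m') :
    γ ▷ P.snd ▷ g ≍ γ ▷ P.fst ▷ f :=
  (whiskerRight_comp_heq _ _ _).symm.trans <|
    (whiskerRight_heq rfl rfl P.w.symm HEq.rfl).trans (whiskerRight_comp_heq _ _ _)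

theorem cell_ext {m m' : T ⟶ P.pt} {γ γ' : m ⟶ m'} (h : γ ▷ P.fst = γ' ▷ P.fst)
    (h' : γ ▷ P.snd = γ' ▷ P.snd) : γ = γ' :=
  (P.existsUnique_cell (γ' ▷ P.fst) (γ' ▷ P.snd) (P.whiskerRight_fst_heq γ').symm).unique
    ⟨h, h'⟩ ⟨rfl, rfl⟩

theorem cell_heq {m m' n n' : T ⟶ P.pt} (hm : m = n) (hm' : m' = n') {γ : m ⟶ m'} {γ' : n ⟶ n'}
    (h : γ ▷ P.fst ≍ γ' ▷ P.fst) (h' : γ ▷ P.snd ≍ γ' ▷ P.snd) : γ ≍ γ' := by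
  subst hm hm'
  exact heq_of_eq (P.cell_ext (eq_of_heq h) (eq_of_heq h'))

theorem lift_fst_snd (m : T ⟶ P.pt) (h : (m ≫ P.fst) ≫ f = (m ≫ P.snd) ≫ g) :
    P.lift (m ≫ P.fst) (m ≫ P.snd) h = m :=
  P.hom_ext (P.lift_fst _ _ _) (P.lift_snd _ _ _)

theorem comp_fst_comp (m : T ⟶ P.pt) : (m ≫ P.snd) ≫ g = (m ≫ P.fst) ≫ f := by
  rw [Strict.assoc, Strict.assoc, P.w]

/-- The comparison from morphisms into a 2-pullback to the pullback of hom-categories. -/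
@[simps]
def toCatPullback (T : K) : (T ⟶ P.pt) ⥤ CatPullback (postcompFunctor T f) (postcompFunctor T g)
    where
  obj m := CatPullback.mk (m ≫ P.fst) (m ≫ P.snd) (P.comp_fst_comp m)
  map γ := CatPullback.Hom.mk (γ ▷ P.fst) (γ ▷ P.snd)
    (isHomLift_of_heq (P.comp_fst_comp _) (P.comp_fst_comp _) (P.whiskerRight_fst_heq γ))
  map_id m := CatPullback.hom_ext (Bicategory.id_whiskerRight _ _)
    (Bicategory.id_whiskerRight _ _)
  map_comp γ θ := CatPullback.hom_ext (Bicategory.comp_whiskerRight _ _ _)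
    (Bicategory.comp_whiskerRight _ _ _)

/-- The morphism into a 2-pullback that is given by an object of the pullback of
hom-categories. -/
abbrev ofCatPullbackObj (a : CatPullback (postcompFunctor T f) (postcompFunctor T g)) :
    T ⟶ P.pt :=
  P.lift a.left a.right a.w.symm

theorem existsUnique_map {a b : CatPullback (postcompFunctor T f) (postcompFunctor T g)}
    (φ : a ⟶ b) : ∃! γ : P.ofCatPullbackObj a ⟶ P.ofCatPullbackObj b,
      γ ▷ P.fst ≍ φ.left ∧ γ ▷ P.snd ≍ φ.right :=
  P.existsUnique_cell_heq (P.lift_fst _ _ _) (P.lift_fst _ _ _) (P.lift_snd _ _ _)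
    (P.lift_snd _ _ _) φ.left φ.right (map_heq_of_isHomLift φ.w)

/-- The functor from the pullback of hom-categories to the hom-category of a 2-pullback. -/
noncomputable def ofCatPullback (T : K) :
    CatPullback (postcompFunctor T f) (postcompFunctor T g) ⥤ (T ⟶ P.pt) where
  obj a := P.ofCatPullbackObj a
  map φ := (P.existsUnique_map φ).choose
  map_id a := (P.existsUnique_map (𝟙 a)).unique (P.existsUnique_map (𝟙 a)).choose_spec.1 (by
    rw [Bicategory.id_whiskerRight, Bicategory.id_whiskerRight]
    exact ⟨congr_arg_heq (fun z => 𝟙 z) (P.lift_fst _ _ _),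
      congr_arg_heq (fun z => 𝟙 z) (P.lift_snd _ _ _)⟩)
  map_comp φ ψ := (P.existsUnique_map (φ ≫ ψ)).unique
    (P.existsUnique_map (φ ≫ ψ)).choose_spec.1 (by
      rw [Bicategory.comp_whiskerRight, Bicategory.comp_whiskerRight]
      exact ⟨heq_comp (P.lift_fst _ _ _) (P.lift_fst _ _ _) (P.lift_fst _ _ _)
          (P.existsUnique_map φ).choose_spec.1.1 (P.existsUnique_map ψ).choose_spec.1.1,
        heq_comp (P.lift_snd _ _ _) (P.lift_snd _ _ _) (P.lift_snd _ _ _)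
          (P.existsUnique_map φ).choose_spec.1.2 (P.existsUnique_map ψ).choose_spec.1.2⟩)

theorem ofCatPullback_map_fst {a b : CatPullback (postcompFunctor T f) (postcompFunctor T g)}
    (φ : a ⟶ b) : (P.ofCatPullback T).map φ ▷ P.fst ≍ φ.left :=
  (P.existsUnique_map φ).choose_spec.1.1

theorem ofCatPullback_map_snd {a b : CatPullback (postcompFunctor T f) (postcompFunctor T g)}
    (φ : a ⟶ b) : (P.ofCatPullback T).map φ ▷ P.snd ≍ φ.right :=
  (P.existsUnique_map φ).choose_spec.1.2

theorem ofCatPullback_mk_toCatPullback_obj (m : T ⟶ P.pt) {a : T ⟶ X} {b : T ⟶ Y}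
    (ha : m ≫ P.fst = a) (hb : m ≫ P.snd = b) (h : b ≫ g = a ≫ f) :
    (P.ofCatPullback T).obj (CatPullback.mk a b h) = m := by
  subst ha hb
  exact P.lift_fst_snd m _

/-- Recognition principle: a 2-cell into the pullback is identified through its two projections.
Later comparisons of pair 2-cells all rest on it. -/
theorem ofCatPullback_map_heq {a b : CatPullback (postcompFunctor T f) (postcompFunctor T g)}
    (φ : a ⟶ b) {m m' : T ⟶ P.pt} (γ : m ⟶ m') (ha : m ≫ P.fst = a.left)
    (ha' : m ≫ P.snd = a.right) (hb : m' ≫ P.fst = b.left) (hb' : m' ≫ P.snd = b.right)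
    (h : γ ▷ P.fst ≍ φ.left) (h' : γ ▷ P.snd ≍ φ.right) : (P.ofCatPullback T).map φ ≍ γ :=
  P.cell_heq (P.ofCatPullback_mk_toCatPullback_obj m ha ha' a.w)
    (P.ofCatPullback_mk_toCatPullback_obj m' hb hb' b.w)
    ((P.ofCatPullback_map_fst φ).trans h.symm) ((P.ofCatPullback_map_snd φ).trans h'.symm)

/-- This composite reduces the equality of two functors on `T ⟶ P.pt` to the equality of their
restrictions to the pullback of hom-categories. -/
theorem toCatPullback_ofCatPullback :
    P.toCatPullback T ⋙ P.ofCatPullback T = 𝟭 (T ⟶ P.pt) :=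
  Functor.hext (fun m => P.lift_fst_snd m _)
    (fun m m' γ => P.ofCatPullback_map_heq _ γ rfl rfl rfl rfl HEq.rfl HEq.rfl)

end TwoPullback

namespace SplitOpfibration

variable {E B : K} {τ : E ⟶ B} (c : SplitOpfibration τ)

theorem existsUnique_heq {e d : T ⟶ E} {b b' : T ⟶ B} {β : e ≫ τ ⟶ b} (hd : d = c.cod e β)
    {u : e ⟶ d} (hu : u ≍ c.lift e β) {e' : T ⟶ E} (γ : e ⟶ e') (ψ : b ⟶ b')
    (he' : e' ≫ τ = b') (h : γ ▷ τ ≍ β ≫ ψ) :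
    ∃! χ : d ⟶ e', u ≫ χ = γ ∧ χ ▷ τ ≍ ψ := by
  subst he' hd
  obtain rfl := eq_of_heq hu
  have hψ : eqToHom (c.cod_over e β) ≫ ψ ≍ ψ := eqToHom_comp_heq _ _
  obtain ⟨χ, ⟨h₁, h₂⟩, h₃⟩ := c.cocartesian e β γ (eqToHom (c.cod_over e β) ≫ ψ) (by
    rw [c.lift_over]; simpa using (eq_of_heq h).symm)
  refine ⟨χ, ⟨h₁, (heq_of_eq h₂).trans hψ⟩, fun χ' hχ' => h₃ χ' ⟨hχ'.1, ?_⟩⟩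
  exact eq_of_heq (hχ'.2.trans hψ.symm)

/-- A 2-cell is a lift if it is a chosen cocartesian lift of a 2-cell of the base. -/
def IsLift {e d : T ⟶ E} (u : e ⟶ d) : Prop :=
  ∃ (b : T ⟶ B) (β : e ≫ τ ⟶ b), d = c.cod e β ∧ u ≍ c.lift e β

/-- The uniqueness half of cocartesianness: a 2-cell out of the codomain of a lift is determined by
its image in the base and its composite with the lift. -/
theorem IsLift.cell_ext {e d e' : T ⟶ E} {u : e ⟶ d} (hu : c.IsLift u) {χ χ' : d ⟶ e'}
    (h : u ≫ χ = u ≫ χ') (h' : χ ▷ τ = χ' ▷ τ) : χ = χ' := by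
  obtain ⟨b, β, rfl, hu⟩ := hu
  obtain rfl := eq_of_heq hu
  obtain ⟨χ₀, -, h₃⟩ := c.cocartesian e β (c.lift e β ≫ χ') (χ' ▷ τ) (by simp)
  rw [h₃ χ ⟨h, h'⟩, h₃ χ' ⟨rfl, rfl⟩]

/-- The splitting is forgotten here, since the exponential only needs the existence of cocartesian
lifts. The lifts are strongly cocartesian because the universal property of `c` allows an arbitrary
2-cell of the base as second factor. -/
theorem isOpfibration (c : SplitOpfibration τ) (T : K) : IsOpfibration (postcompFunctor T τ) where
  exists_lift {e b b'} β h := by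
    subst h
    have h₁ : (postcompFunctor T τ).IsHomLift β (c.lift e β) :=
      isHomLift_of_heq rfl (c.cod_over e β) (c.lift_over_heq e β)
    refine ⟨c.cod e β, c.lift e β, { toIsHomLift := h₁, universal_property' := ?_ }⟩
    intro e' g γ hγ
    obtain ⟨χ, ⟨h₂, h₃⟩, h₄⟩ := c.existsUnique_heq rfl HEq.rfl γ g rfl (map_heq_of_isHomLift hγ)
    refine ⟨χ, ⟨isHomLift_of_heq (c.cod_over e β) rfl h₃, h₂⟩, fun χ' hχ' => h₄ χ' ⟨hχ'.2, ?_⟩⟩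
    exact map_heq_of_isHomLift hχ'.1

end SplitOpfibration

namespace LaxSlice

variable {M : K} {X Y Z : LaxSlice K M}

/-- The filling of a triangle of the lax slice, whiskered with `d` and reassociated. -/
def slide (f : X ⟶ Y) (d : T ⟶ X.dom) : d ≫ X.hom ⟶ (d ≫ f.map) ≫ Y.hom :=
  d ◁ f.cell ≫ (α_ d f.map Y.hom).inv

theorem slide_heq (f : X ⟶ Y) (d : T ⟶ X.dom) : slide f d ≍ d ◁ f.cell := by
  rw [slide, associator_inv]
  exact comp_eqToHom_heq (d ◁ f.cell) _

theorem slide_natural (f : X ⟶ Y) {d d' : T ⟶ X.dom} (η : d ⟶ d') :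
    slide f d ≫ (η ▷ f.map) ▷ Y.hom = η ▷ X.hom ≫ slide f d' := by
  rw [slide, Category.assoc (d ◁ f.cell), ← associator_inv_naturality_left,
    whisker_exchange_assoc, slide]

theorem slide_comp (f : X ⟶ Y) (g : Y ⟶ Z) (d : T ⟶ X.dom) :
    slide (f ≫ g) d ≍ slide f d ≫ slide g (d ≫ f.map) := by
  have e : (f ≫ g).cell ≍ f.cell ≫ f.map ◁ g.cell := by
    rw [comp_cell, associator_inv, ← Category.assoc f.cell]
    exact comp_eqToHom_heq (f.cell ≫ f.map ◁ g.cell) _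
  refine (slide_heq _ d).trans ((whiskerLeft_heq rfl rfl (Strict.assoc _ _ _) e).trans ?_)
  rw [Bicategory.whiskerLeft_comp]
  refine heq_comp rfl (Strict.assoc _ _ _).symm (by simp only [Strict.assoc])
    (slide_heq f d).symm ?_
  exact (comp_whiskerLeft_heq _ _ _).symm.trans (slide_heq g _).symm

theorem slide_cell {f g : X ⟶ Y} (δ : f ⟶ g) (d : T ⟶ X.dom) :
    slide f d ≫ (d ◁ δ.cell) ▷ Y.hom = slide g d := by
  rw [slide, slide, ← hom₂_w δ, Category.assoc (d ◁ f.cell), Bicategory.whiskerLeft_comp,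
    ← associator_inv_naturality_middle, Category.assoc (d ◁ f.cell)]

theorem slide_of_isTight {f : X ⟶ Y} (hf : IsTight f) (d : T ⟶ X.dom) :
    slide f d ≍ 𝟙 (d ≫ X.hom) := by
  obtain ⟨h, e⟩ := hf
  refine (slide_heq f d).trans ?_
  rw [e, whiskerLeft_eqToHom]
  exact heq_id_of_eqToHom _

theorem IsTight.comp_hom {f : X ⟶ Y} (hf : IsTight f) (d : T ⟶ X.dom) :
    (d ≫ f.map) ≫ Y.hom = d ≫ X.hom := by
  obtain ⟨h, e⟩ := hf
  rw [h, Strict.assoc]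

end LaxSlice

namespace ChangeOfBase

variable {E B : K} {τ : E ⟶ B} (c : SplitOpfibration τ)
  (P : ∀ (X : K) (F : X ⟶ B), TwoPullback F τ) {X Y Z : LaxSlice K B}

theorem comp_mapHom_fst (f : X ⟶ Y) (m : T ⟶ (P _ X.hom).pt) :
    (m ≫ mapHom c P f) ≫ (P _ Y.hom).fst = (m ≫ (P _ X.hom).fst) ≫ f.map := by
  rw [Strict.assoc, mapHom_fst, Strict.assoc]

/-- Stability of the chosen lifts under precomposition with `m`: the whiskered filling of `τ^* f` is
again a chosen lift, namely of the filling of `f` whiskered with the first projection of `m`. The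
2-cell `β` is that whiskering with its domain rewritten by the equation of the pullback. -/
theorem slide_map (f : X ⟶ Y) (m : T ⟶ (P _ X.hom).pt) :
    ∃ β : (m ≫ (P _ X.hom).snd) ≫ τ ⟶ ((m ≫ (P _ X.hom).fst) ≫ f.map) ≫ Y.hom,
      β ≍ LaxSlice.slide f (m ≫ (P _ X.hom).fst) ∧
      (m ≫ mapHom c P f) ≫ (P _ Y.hom).snd = c.cod _ β ∧
      LaxSlice.slide (T := T) (X := obj P X) (Y := obj P Y) (map c P f) m ≍ c.lift _ β := by
  have h₁ := (P _ X.hom).comp_fst_comp m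
  let β : (m ≫ (P _ X.hom).snd) ≫ τ ⟶ ((m ≫ (P _ X.hom).fst) ≫ f.map) ≫ Y.hom :=
    eqToHom h₁ ≫ LaxSlice.slide f (m ≫ (P _ X.hom).fst)
  have hβ : β ≍ LaxSlice.slide f (m ≫ (P _ X.hom).fst) := eqToHom_comp_heq _ _
  have hb : m ≫ ((P _ X.hom).fst ≫ f.map) ≫ Y.hom =
      ((m ≫ (P _ X.hom).fst) ≫ f.map) ≫ Y.hom := by simp only [Strict.assoc]
  have h₂ : (α_ m (P _ X.hom).snd τ).hom ≫ m ◁ baseCell P f ≍ β := by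
    rw [associator_hom]
    refine (eqToHom_comp_heq _ _).trans (HEq.trans ?_ hβ.symm)
    refine (whiskerLeft_heq rfl (P _ X.hom).w.symm (Strict.assoc _ _ _)
      (baseCell_heq P f)).trans ?_
    exact (comp_whiskerLeft_heq _ _ _).symm.trans (LaxSlice.slide_heq _ _).symm
  have e₁ := c.cod_congr rfl hb h₂
  have e₂ := c.lift_congr rfl hb h₂
  rw [c.lift_whisker] at e₂
  refine ⟨β, hβ, ?_, ?_⟩
  · rw [Strict.assoc, mapHom_snd, ← e₁, c.cod_whisker]
  · refine (LaxSlice.slide_heq _ _).trans (HEq.trans ?_ ((comp_eqToHom_heq _ _).symm.trans e₂))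
    exact whiskerLeft_heq rfl rfl (mapHom_snd c P f) (map_cell_heq c P f)

theorem isLift_slide_map (f : X ⟶ Y) (m : T ⟶ (P _ X.hom).pt) :
    c.IsLift (LaxSlice.slide (T := T) (X := obj P X) (Y := obj P Y) (map c P f) m) := by
  obtain ⟨β, -, h, h'⟩ := slide_map c P f m
  exact ⟨_, β, h, h'⟩

theorem slide_map_over (f : X ⟶ Y) (m : T ⟶ (P _ X.hom).pt) :
    LaxSlice.slide (T := T) (X := obj P X) (Y := obj P Y) (map c P f) m ▷ τ ≍
      LaxSlice.slide f (m ≫ (P _ X.hom).fst) := by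
  obtain ⟨β, hβ, h, h'⟩ := slide_map c P f m
  exact (whiskerRight_heq rfl h rfl h').trans ((c.lift_over_heq _ _).trans hβ)

/-- A 2-cell out of a composite with `τ^* f` is determined by a 2-cell of `K(T, Y)` and a 2-cell
of `K(T, E)`. -/
theorem existsUnique_cell_comp_mapHom (f : X ⟶ Y) {m : T ⟶ (P _ X.hom).pt}
    {m' : T ⟶ (P _ Y.hom).pt} {d : T ⟶ X.dom} {d' : T ⟶ Y.dom} {e e' : T ⟶ E}
    (hd : m ≫ (P _ X.hom).fst = d) (hd' : m' ≫ (P _ Y.hom).fst = d')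
    (he : m ≫ (P _ X.hom).snd = e) (he' : m' ≫ (P _ Y.hom).snd = e')
    (η : d ≫ f.map ⟶ d') (t : e ⟶ e') (ht : t ▷ τ ≍ LaxSlice.slide f d ≫ η ▷ Y.hom) :
    ∃! κ : m ≫ mapHom c P f ⟶ m', κ ▷ (P _ Y.hom).fst ≍ η ∧
      LaxSlice.slide (T := T) (X := obj P X) (Y := obj P Y) (map c P f) m ≫
        κ ▷ (P _ Y.hom).snd ≍ t := by
  subst hd hd' he he'
  simp only [heq_eq_eq]
  obtain ⟨β, hβ, h, h'⟩ := slide_map c P f m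
  have hw := (P _ X.hom).comp_fst_comp m
  have hw' := (P _ Y.hom).comp_fst_comp m'
  -- Factoring `t` through the lift gives `χ` over `η ▷ Y.hom`, which is the condition for `η` and
  -- `χ` to be paired into a 2-cell of the pullback.
  obtain ⟨χ, ⟨h₁, h₂⟩, h₃⟩ := c.existsUnique_heq h h' t (η ▷ Y.hom) hw'
    (ht.trans (heq_comp hw.symm rfl rfl hβ.symm HEq.rfl))
  obtain ⟨κ, ⟨h₄, h₅⟩, h₆⟩ := (P _ Y.hom).existsUnique_cell_heq (m := m ≫ mapHom c P f) (m' := m')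
    (comp_mapHom_fst c P f m) rfl rfl rfl η χ h₂
  refine ⟨κ, ⟨h₄, by rw [eq_of_heq h₅]; exact h₁⟩, fun κ' hκ' => h₆ κ' ⟨hκ'.1, ?_⟩⟩
  refine heq_of_eq (h₃ _ ⟨hκ'.2, ?_⟩)
  exact ((P _ Y.hom).whiskerRight_fst_heq κ').trans
    (whiskerRight_heq (comp_mapHom_fst c P f m) rfl rfl hκ'.1)

/-- The uniqueness part of the universal property of composites with `τ^* f`. -/
theorem cell_heq_of_isLift {F : LaxSlice K B} {m m' n n' : T ⟶ (P _ F.hom).pt} (hm : m = n)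
    (hm' : m' = n') {e e' : T ⟶ E} (he : e = e') {u : e ⟶ m ≫ (P _ F.hom).snd}
    {u' : e' ⟶ n ≫ (P _ F.hom).snd} (hu : c.IsLift u) (huu' : u ≍ u') {κ : m ⟶ m'} {κ' : n ⟶ n'}
    (h : κ ▷ (P _ F.hom).fst ≍ κ' ▷ (P _ F.hom).fst)
    (h' : u ≫ κ ▷ (P _ F.hom).snd ≍ u' ≫ κ' ▷ (P _ F.hom).snd) : κ ≍ κ' := by
  subst hm hm' he
  obtain rfl := eq_of_heq huu'
  refine heq_of_eq ((P _ F.hom).cell_ext (eq_of_heq h) ?_)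
  refine SplitOpfibration.IsLift.cell_ext c hu (eq_of_heq h') (eq_of_heq ?_)
  refine ((P _ F.hom).whiskerRight_fst_heq κ).trans (HEq.trans ?_
    ((P _ F.hom).whiskerRight_fst_heq κ').symm)
  rw [eq_of_heq h]

end ChangeOfBase

end PullbackHom

end TwoCat

namespace TwoCat

/-! ### 2-cells out of composites with change of base -/

section LiftCell

variable {K : Type u} [Bicategory.{v, v} K] [Strict K] {T : K}

namespace ChangeOfBase

variable {E B : K} {τ : E ⟶ B} (c : SplitOpfibration τ)
  (P : ∀ (X : K) (F : X ⟶ B), TwoPullback F τ) {X Y Z : LaxSlice K B}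

/-- The filling of the triangle `τ^* f`, whiskered with `m` and reassociated. -/
abbrev slideMap (f : X ⟶ Y) (m : T ⟶ (P _ X.hom).pt) :
    m ≫ (P _ X.hom).snd ⟶ (m ≫ mapHom c P f) ≫ (P _ Y.hom).snd :=
  LaxSlice.slide (T := T) (X := obj P X) (Y := obj P Y) (map c P f) m

/-- The morphism into the pullback `τ^* X` with components `d` and `e`. -/
noncomputable abbrev pair (X : LaxSlice K B) (d : T ⟶ X.dom) (e : T ⟶ E)
    (h : e ≫ τ = d ≫ X.hom) : T ⟶ (P _ X.hom).pt :=
  ((P _ X.hom).ofCatPullback T).obj (CatPullback.mk d e h)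

theorem pair_fst (d : T ⟶ X.dom) (e : T ⟶ E) (h : e ≫ τ = d ≫ X.hom) :
    pair P X d e h ≫ (P _ X.hom).fst = d := (P _ X.hom).lift_fst _ _ _

theorem pair_snd (d : T ⟶ X.dom) (e : T ⟶ E) (h : e ≫ τ = d ≫ X.hom) :
    pair P X d e h ≫ (P _ X.hom).snd = e := (P _ X.hom).lift_snd _ _ _

/-- The 2-cell between morphisms into the pullback `τ^* X` with components `η` and `t`. -/
noncomputable abbrev pairMap {d d' : T ⟶ X.dom} {e e' : T ⟶ E} (h : e ≫ τ = d ≫ X.hom)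
    (h' : e' ≫ τ = d' ≫ X.hom) (η : d ⟶ d') (t : e ⟶ e')
    (ht : (postcompFunctor T τ).IsHomLift (η ▷ X.hom) t) : pair P X d e h ⟶ pair P X d' e' h' :=
  ((P _ X.hom).ofCatPullback T).map (X := CatPullback.mk d e h) (Y := CatPullback.mk d' e' h')
    (CatPullback.Hom.mk η t ht)

theorem pairMap_fst {d d' : T ⟶ X.dom} {e e' : T ⟶ E} (h : e ≫ τ = d ≫ X.hom)
    (h' : e' ≫ τ = d' ≫ X.hom) (η : d ⟶ d') (t : e ⟶ e')
    (ht : (postcompFunctor T τ).IsHomLift (η ▷ X.hom) t) :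
    pairMap P h h' η t ht ▷ (P _ X.hom).fst ≍ η :=
  (P _ X.hom).ofCatPullback_map_fst _

theorem pairMap_snd {d d' : T ⟶ X.dom} {e e' : T ⟶ E} (h : e ≫ τ = d ≫ X.hom)
    (h' : e' ≫ τ = d' ≫ X.hom) (η : d ⟶ d') (t : e ⟶ e')
    (ht : (postcompFunctor T τ).IsHomLift (η ▷ X.hom) t) :
    pairMap P h h' η t ht ▷ (P _ X.hom).snd ≍ t :=
  (P _ X.hom).ofCatPullback_map_snd _

theorem pairMap_id {d : T ⟶ X.dom} {e : T ⟶ E} (h : e ≫ τ = d ≫ X.hom)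
    (ht : (postcompFunctor T τ).IsHomLift (𝟙 d ▷ X.hom) (𝟙 e)) :
    pairMap P h h (𝟙 d) (𝟙 e) ht = 𝟙 _ :=
  ((P _ X.hom).ofCatPullback T).map_id _

/-- The case of an identity first projection: all the information lies in a morphism `t` over the
filling of `f`. Such morphisms index the components of a morphism of the exponential over `slide f
d`. -/
theorem existsUnique_liftCell (f : X ⟶ Y) {d : T ⟶ X.dom} {e e' : T ⟶ E}
    (h : e ≫ τ = d ≫ X.hom) (h' : e' ≫ τ = (d ≫ f.map) ≫ Y.hom) (t : e ⟶ e')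
    (ht : (postcompFunctor T τ).IsHomLift (LaxSlice.slide f d) t) :
    ∃! κ : pair P X d e h ≫ mapHom c P f ⟶ pair P Y (d ≫ f.map) e' h',
      κ ▷ (P _ Y.hom).fst ≍ 𝟙 (d ≫ f.map) ∧
        slideMap c P f (pair P X d e h) ≫ κ ▷ (P _ Y.hom).snd ≍ t :=
  existsUnique_cell_comp_mapHom c P f (pair_fst P d e h) (pair_fst P _ e' h') (pair_snd P d e h)
    (pair_snd P _ e' h') (𝟙 _) t ((map_heq_of_isHomLift ht).trans (heq_of_eq (by
      rw [Bicategory.id_whiskerRight]; exact (Category.comp_id (LaxSlice.slide f d)).symm)))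

/-- The 2-cell out of a composite with `τ^* f` that corresponds to a morphism `t` over the
filling of `f`. -/
noncomputable def liftCell (f : X ⟶ Y) {d : T ⟶ X.dom} {e e' : T ⟶ E}
    (h : e ≫ τ = d ≫ X.hom) (h' : e' ≫ τ = (d ≫ f.map) ≫ Y.hom) (t : e ⟶ e')
    (ht : (postcompFunctor T τ).IsHomLift (LaxSlice.slide f d) t) :
    pair P X d e h ≫ mapHom c P f ⟶ pair P Y (d ≫ f.map) e' h' :=
  (existsUnique_liftCell c P f h h' t ht).choose

theorem liftCell_fst (f : X ⟶ Y) {d : T ⟶ X.dom} {e e' : T ⟶ E}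
    (h : e ≫ τ = d ≫ X.hom) (h' : e' ≫ τ = (d ≫ f.map) ≫ Y.hom) (t : e ⟶ e')
    (ht : (postcompFunctor T τ).IsHomLift (LaxSlice.slide f d) t) :
    liftCell c P f h h' t ht ▷ (P _ Y.hom).fst ≍ 𝟙 (d ≫ f.map) :=
  (existsUnique_liftCell c P f h h' t ht).choose_spec.1.1

theorem liftCell_snd (f : X ⟶ Y) {d : T ⟶ X.dom} {e e' : T ⟶ E}
    (h : e ≫ τ = d ≫ X.hom) (h' : e' ≫ τ = (d ≫ f.map) ≫ Y.hom) (t : e ⟶ e')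
    (ht : (postcompFunctor T τ).IsHomLift (LaxSlice.slide f d) t) :
    slideMap c P f (pair P X d e h) ≫ liftCell c P f h h' t ht ▷ (P _ Y.hom).snd ≍ t :=
  (existsUnique_liftCell c P f h h' t ht).choose_spec.1.2

theorem whiskerRight_mapHom_fst (f : X ⟶ Y) {m m' : T ⟶ (P _ X.hom).pt} (γ : m ⟶ m') :
    γ ▷ mapHom c P f ▷ (P _ Y.hom).fst ≍ γ ▷ (P _ X.hom).fst ▷ f.map :=
  (whiskerRight_comp_heq _ _ _).symm.trans <|
    (whiskerRight_heq rfl rfl (mapHom_fst c P f) HEq.rfl).trans (whiskerRight_comp_heq _ _ _)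

/-- A 2-cell out of a composite with `mapHom` is determined by its first projection and by the
composite of its second projection with the filling (`cell_heq_of_isLift`). On both sides the former
is `η ▷ f.map`; the latter are `s ≫ s'` and `t ≫ t'`. The 2-cell `θ` is kept apart from `η ▷ f.map`
so that an identity can be put in its place without rewriting inside the proofs of `IsHomLift`. -/
theorem liftCell_natural (f : X ⟶ Y) {d d' : T ⟶ X.dom} {e e₁ e₂ e' : T ⟶ E}
    (h : e ≫ τ = d ≫ X.hom) (h₁ : e₁ ≫ τ = d' ≫ X.hom) (h₂ : e₂ ≫ τ = (d ≫ f.map) ≫ Y.hom)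
    (h' : e' ≫ τ = (d' ≫ f.map) ≫ Y.hom) (η : d ⟶ d') (θ : d ≫ f.map ⟶ d' ≫ f.map)
    (hθ : θ = η ▷ f.map) (s : e ⟶ e₁) (s' : e₁ ⟶ e') (t : e ⟶ e₂) (t' : e₂ ⟶ e')
    (hs : (postcompFunctor T τ).IsHomLift (η ▷ X.hom) s)
    (hs' : (postcompFunctor T τ).IsHomLift (LaxSlice.slide f d') s')
    (ht : (postcompFunctor T τ).IsHomLift (LaxSlice.slide f d) t)
    (ht' : (postcompFunctor T τ).IsHomLift (θ ▷ Y.hom) t') (w : s ≫ s' = t ≫ t') :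
    pairMap P h h₁ η s hs ▷ mapHom c P f ≫ liftCell c P f h₁ h' s' hs' =
      liftCell c P f h h₂ t ht ≫ pairMap P h₂ h' θ t' ht' := by
  have e₁f := comp_mapHom_fst c P f (pair P X d e h)
  have e₂f := comp_mapHom_fst c P f (pair P X d' e₁ h₁)
  refine eq_of_heq (cell_heq_of_isLift c P rfl rfl rfl (isLift_slide_map c P f _) HEq.rfl ?_ ?_)
  · rw [Bicategory.comp_whiskerRight, Bicategory.comp_whiskerRight]
    refine HEq.trans (b := η ▷ f.map ≫ 𝟙 (d' ≫ f.map)) ?_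
      (HEq.trans (b := 𝟙 (d ≫ f.map) ≫ θ) ?_ ?_)
    · refine heq_comp (e₁f.trans ?_) (e₂f.trans ?_) (pair_fst P _ _ _) ?_
        (liftCell_fst c P f h₁ h' s' hs')
      · rw [pair_fst]
      · rw [pair_fst]
      · exact (whiskerRight_mapHom_fst c P f _).trans
          (whiskerRight_heq (pair_fst P _ _ _) (pair_fst P _ _ _) rfl (pairMap_fst P h h₁ η s hs))
    · rw [hθ, Category.comp_id (η ▷ f.map), Category.id_comp (η ▷ f.map)]
    · refine heq_comp (e₁f.trans ?_).symm (pair_fst P _ _ _).symm (pair_fst P _ _ _).symm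
        (liftCell_fst c P f h h₂ t ht).symm (pairMap_fst P h₂ h' θ t' ht').symm
      rw [pair_fst]
  · rw [Bicategory.comp_whiskerRight, Bicategory.comp_whiskerRight,
      ← Category.assoc (slideMap c P f (pair P X d e h)),
      ← Category.assoc (slideMap c P f (pair P X d e h))]
    have h₃ := LaxSlice.slide_natural (T := T) (X := obj P X) (Y := obj P Y) (map c P f)
      (pairMap P h h₁ η s hs)
    refine HEq.trans (b := s ≫ s') ?_ ((heq_of_eq w).trans ?_)
    · refine (heq_of_eq (congrArg (· ≫ liftCell c P f h₁ h' s' hs' ▷ (P _ Y.hom).snd) h₃)).trans ?_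
      dsimp only
      rw [Category.assoc (pairMap P h h₁ η s hs ▷ (P _ X.hom).snd)]
      exact heq_comp (pair_snd P _ _ _) (pair_snd P _ _ _) (pair_snd P _ _ _)
        (pairMap_snd P h h₁ η s hs) (liftCell_snd c P f h₁ h' s' hs')
    · exact heq_comp (pair_snd P _ _ _).symm (pair_snd P _ _ _).symm (pair_snd P _ _ _).symm
        (liftCell_snd c P f h h₂ t ht).symm (pairMap_snd P h₂ h' θ t' ht').symm

/-- The same two tests, against the filling of `τ^* f`. The 2-cell `map₂ c P δ` carries this filling
to that of `τ^* g`, so the left-hand side yields `s`, and the right-hand side yields `t ≫ t'`. -/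
theorem liftCell_map₂ {f g : X ⟶ Y} (δ : f ⟶ g) {d : T ⟶ X.dom} {e e₂ e' : T ⟶ E}
    (h : e ≫ τ = d ≫ X.hom) (h₂ : e₂ ≫ τ = (d ≫ f.map) ≫ Y.hom)
    (h' : e' ≫ τ = (d ≫ g.map) ≫ Y.hom) (s : e ⟶ e') (t : e ⟶ e₂) (t' : e₂ ⟶ e')
    (hs : (postcompFunctor T τ).IsHomLift (LaxSlice.slide g d) s)
    (ht : (postcompFunctor T τ).IsHomLift (LaxSlice.slide f d) t)
    (ht' : (postcompFunctor T τ).IsHomLift ((d ◁ δ.cell) ▷ Y.hom) t') (w : s = t ≫ t') :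
    pair P X d e h ◁ (map₂ c P δ).cell ≫ liftCell c P g h h' s hs =
      liftCell c P f h h₂ t ht ≫ pairMap P h₂ h' (d ◁ δ.cell) t' ht' := by
  have e₁f := (comp_mapHom_fst c P f (pair P X d e h)).trans
    (congrArg (· ≫ f.map) (pair_fst P d e h))
  have e₂f := (comp_mapHom_fst c P g (pair P X d e h)).trans
    (congrArg (· ≫ g.map) (pair_fst P d e h))
  refine eq_of_heq (cell_heq_of_isLift c P rfl rfl rfl (isLift_slide_map c P f _) HEq.rfl ?_ ?_)
  · rw [Bicategory.comp_whiskerRight, Bicategory.comp_whiskerRight]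
    refine HEq.trans (b := d ◁ δ.cell ≫ 𝟙 (d ≫ g.map)) ?_
      (HEq.trans (b := 𝟙 (d ≫ f.map) ≫ d ◁ δ.cell) ?_ ?_)
    · refine heq_comp e₁f e₂f (pair_fst P _ _ _) ?_ (liftCell_fst c P g h h' s hs)
      refine (whisker_assoc_heq _ _ _).trans ?_
      refine (whiskerLeft_heq rfl (mapHom_fst c P f) (mapHom_fst c P g)
        (map₂_over c P δ)).trans ?_
      refine (comp_whiskerLeft_heq _ _ _).symm.trans ?_
      exact whiskerLeft_heq (pair_fst P d e h) rfl rfl HEq.rfl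
    · rw [Category.comp_id (d ◁ δ.cell), Category.id_comp (d ◁ δ.cell)]
    · exact heq_comp e₁f.symm (pair_fst P _ _ _).symm (pair_fst P _ _ _).symm
        (liftCell_fst c P f h h₂ t ht).symm (pairMap_fst P h₂ h' _ t' ht').symm
  · rw [Bicategory.comp_whiskerRight, Bicategory.comp_whiskerRight,
      ← Category.assoc (slideMap c P f (pair P X d e h)),
      ← Category.assoc (slideMap c P f (pair P X d e h))]
    have h₃ := LaxSlice.slide_cell (T := T) (X := obj P X) (Y := obj P Y) (map₂ c P δ)
      (pair P X d e h)
    refine HEq.trans (b := s) ?_ ((heq_of_eq w).trans ?_)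
    · refine (heq_of_eq (congrArg (· ≫ liftCell c P g h h' s hs ▷ (P _ Y.hom).snd) h₃)).trans ?_
      exact liftCell_snd c P g h h' s hs
    · exact heq_comp (pair_snd P _ _ _).symm (pair_snd P _ _ _).symm (pair_snd P _ _ _).symm
        (liftCell_snd c P f h h₂ t ht).symm (pairMap_snd P h₂ h' _ t' ht').symm

theorem comp_mapHom_comp (f : X ⟶ Y) (g : Y ⟶ Z) (m : T ⟶ (P _ X.hom).pt) :
    m ≫ mapHom c P (f ≫ g) = (m ≫ mapHom c P f) ≫ mapHom c P g :=
  (congrArg (fun k : obj P X ⟶ obj P Z => m ≫ k.map) (map_comp c P f g)).trans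
    (Strict.assoc _ _ _).symm

theorem slideMap_comp (f : X ⟶ Y) (g : Y ⟶ Z) (m : T ⟶ (P _ X.hom).pt) :
    slideMap c P (f ≫ g) m ≍ slideMap c P f m ≫ slideMap c P g (m ≫ mapHom c P f) := by
  refine HEq.trans ?_ (LaxSlice.slide_comp (T := T) (X := obj P X) (Y := obj P Y) (Z := obj P Z)
    (map c P f) (map c P g) m)
  exact congr_arg_heq (fun k : obj P X ⟶ obj P Z => LaxSlice.slide (T := T) k m)
    (map_comp c P f g)

/-- The filling of `τ^* (f ≫ g)` is the filling of `τ^* f` followed by a whiskering of that of `τ^*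
g`. Sliding the first lift cell past the second filling turns the test of the right-hand side into
`t ≫ t'`. -/
theorem liftCell_comp (f : X ⟶ Y) (g : Y ⟶ Z) {d : T ⟶ X.dom} {e e₁ e' : T ⟶ E}
    (h : e ≫ τ = d ≫ X.hom) (h₁ : e₁ ≫ τ = (d ≫ f.map) ≫ Y.hom)
    (h' : e' ≫ τ = ((d ≫ f.map) ≫ g.map) ≫ Z.hom) (h'' : e' ≫ τ = (d ≫ (f ≫ g).map) ≫ Z.hom)
    (s : e ⟶ e') (t : e ⟶ e₁) (t' : e₁ ⟶ e')
    (hs : (postcompFunctor T τ).IsHomLift (LaxSlice.slide (f ≫ g) d) s)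
    (ht : (postcompFunctor T τ).IsHomLift (LaxSlice.slide f d) t)
    (ht' : (postcompFunctor T τ).IsHomLift (LaxSlice.slide g (d ≫ f.map)) t') (w : s = t ≫ t') :
    liftCell c P (f ≫ g) h h'' s hs ≍
      liftCell c P f h h₁ t ht ▷ mapHom c P g ≫ liftCell c P g h₁ h' t' ht' := by
  have hd : d ≫ (f ≫ g).map = (d ≫ f.map) ≫ g.map := (Strict.assoc _ _ _).symm
  have e₁f := (comp_mapHom_fst c P f (pair P X d e h)).trans
    (congrArg (· ≫ f.map) (pair_fst P d e h))
  have e₂f := (comp_mapHom_fst c P g (pair P X d e h ≫ mapHom c P f)).trans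
    (congrArg (· ≫ g.map) e₁f)
  have e₃f := (comp_mapHom_fst c P g (pair P Y (d ≫ f.map) e₁ h₁)).trans
    (congrArg (· ≫ g.map) (pair_fst P _ e₁ h₁))
  have hz : pair P Z (d ≫ (f ≫ g).map) e' h'' = pair P Z ((d ≫ f.map) ≫ g.map) e' h' :=
    congrArg ((P _ Z.hom).ofCatPullback T).obj (CatPullback.ext hd rfl)
  refine cell_heq_of_isLift c P (comp_mapHom_comp c P f g _) hz rfl (isLift_slide_map c P _ _)
    (slideMap_comp c P f g _) ?_ ?_
  · rw [Bicategory.comp_whiskerRight]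
    refine (liftCell_fst c P (f ≫ g) h h'' s hs).trans ?_
    refine HEq.trans (b := 𝟙 ((d ≫ f.map) ≫ g.map) ≫ 𝟙 ((d ≫ f.map) ≫ g.map)) ?_ ?_
    · rw [Category.comp_id (𝟙 ((d ≫ f.map) ≫ g.map))]
      exact congr_arg_heq (fun z => 𝟙 z) hd
    · refine heq_comp e₂f.symm e₃f.symm (pair_fst P _ _ _).symm ?_
        (liftCell_fst c P g h₁ h' t' ht').symm
      refine HEq.trans ?_ (whiskerRight_mapHom_fst c P g _).symm
      refine HEq.trans ?_ (whiskerRight_heq e₁f (pair_fst P _ _ _) rfl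
        (liftCell_fst c P f h h₁ t ht)).symm
      rw [Bicategory.id_whiskerRight]
  · refine (liftCell_snd c P (f ≫ g) h h'' s hs).trans ((heq_of_eq w).trans ?_)
    have h₃ := LaxSlice.slide_natural (T := T) (X := obj P Y) (Y := obj P Z) (map c P g)
      (liftCell c P f h h₁ t ht)
    rw [Bicategory.comp_whiskerRight, Category.assoc (slideMap c P f (pair P X d e h)),
      ← Category.assoc (slideMap c P g (pair P X d e h ≫ mapHom c P f))]
    refine HEq.trans ?_ (heq_of_eq (congrArg (fun k => slideMap c P f (pair P X d e h) ≫
      k ≫ liftCell c P g h₁ h' t' ht' ▷ (P _ Z.hom).snd) h₃.symm))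
    dsimp only
    rw [Category.assoc (liftCell c P f h h₁ t ht ▷ (P _ Y.hom).snd),
      ← Category.assoc (slideMap c P f (pair P X d e h))]
    exact heq_comp (pair_snd P _ _ _).symm (pair_snd P _ _ _).symm (pair_snd P _ _ _).symm
      (liftCell_snd c P f h h₁ t ht).symm (liftCell_snd c P g h₁ h' t' ht').symm

theorem comp_mapHom_snd_of_isTight {f : X ⟶ Y} (hf : LaxSlice.IsTight f)
    (m : T ⟶ (P _ X.hom).pt) :
    (m ≫ mapHom c P f) ≫ (P _ Y.hom).snd = m ≫ (P _ X.hom).snd :=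
  (isTight_map c P hf).comp_hom (X := obj P X) (Y := obj P Y) m

theorem whiskerRight_mapHom_snd_of_isTight {f : X ⟶ Y} (hf : LaxSlice.IsTight f)
    {m m' : T ⟶ (P _ X.hom).pt} (γ : m ⟶ m') :
    γ ▷ mapHom c P f ▷ (P _ Y.hom).snd ≍ γ ▷ (P _ X.hom).snd := by
  obtain ⟨h, -⟩ := isTight_map c P hf
  exact (whiskerRight_comp_heq _ _ _).symm.trans (whiskerRight_heq rfl rfl h.symm HEq.rfl)

/-- Over a tight morphism the filling of `τ^* f` is an identity, so nothing is factored and the lift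
cell is the pair of an identity and `t`. -/
theorem liftCell_of_isTight {f : X ⟶ Y} (hf : LaxSlice.IsTight f) {d : T ⟶ X.dom} {e e' : T ⟶ E}
    (h : e ≫ τ = d ≫ X.hom) (h₁ : e ≫ τ = (d ≫ f.map) ≫ Y.hom)
    (h' : e' ≫ τ = (d ≫ f.map) ≫ Y.hom) (t : e ⟶ e')
    (ht : (postcompFunctor T τ).IsHomLift (LaxSlice.slide f d) t)
    (ht' : (postcompFunctor T τ).IsHomLift (𝟙 (d ≫ f.map) ▷ Y.hom) t) :
    liftCell c P f h h' t ht ≍ pairMap P h₁ h' (𝟙 _) t ht' := by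
  have e₁f := (comp_mapHom_fst c P f (pair P X d e h)).trans
    (congrArg (· ≫ f.map) (pair_fst P d e h))
  have e₁s := comp_mapHom_snd_of_isTight c P hf (pair P X d e h)
  refine ((P _ Y.hom).ofCatPullback_map_heq (a := CatPullback.mk (d ≫ f.map) e h₁)
    (b := CatPullback.mk (d ≫ f.map) e' h') (CatPullback.Hom.mk (𝟙 _) t ht')
    (liftCell c P f h h' t ht) e₁f (e₁s.trans (pair_snd P _ _ _))
    (pair_fst P _ _ _) (pair_snd P _ _ _) (liftCell_fst c P f h h' t ht) ?_).symm
  refine HEq.trans ?_ (liftCell_snd c P f h h' t ht)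
  have hs : slideMap c P f (pair P X d e h) ≍ 𝟙 (pair P X d e h ≫ (P _ X.hom).snd) :=
    LaxSlice.slide_of_isTight (X := obj P X) (Y := obj P Y) (isTight_map c P hf) (pair P X d e h)
  refine (comp_heq_of_id_heq e₁s.symm rfl rfl (hs.trans ?_) HEq.rfl).symm
  rw [e₁s]

end ChangeOfBase

end LiftCell

end TwoCat

namespace TwoCat

/-! ### Transposing a 2-cocone along the opfibration -/

section TransposeCocone

variable {K : Type u} [Bicategory.{v, v} K] [Strict K] {T : K} {A : Type u₁} [Bicategory.{w₁, v₁} A]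
  {W : StrictPseudofunctor Aᵒᵖ Cat.{v₂, u₂}}
  {E B : K} {τ : E ⟶ B} (c : SplitOpfibration τ)
  (P : ∀ (X : K) (F : X ⟶ B), TwoPullback F τ) {H : StrictPseudofunctor (Groth W) (LaxSlice K B)}
  {X : Type v₃} [Category.{w₃} X]

namespace ChangeOfBase

/-- The components of a 2-cocone for the domains of `τ^* ∘ H`. -/
def cobApp (σ : HomCocone T ((H.comp (changeOfBase c P)).comp (LaxSlice.domFunctor K E)) X)
    (x : Groth W) : (T ⟶ (P _ (H.obj x).hom).pt) ⥤ X := σ.app x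

variable (σ : HomCocone T ((H.comp (changeOfBase c P)).comp (LaxSlice.domFunctor K E)) X)

/-- The structure 2-cells of a 2-cocone for the domains of `τ^* ∘ H`. -/
def cobCell {x y : Groth W} (f : x ⟶ y) (m : T ⟶ (P _ (H.obj x).hom).pt) :
    (cobApp c P σ x).obj m ⟶ (cobApp c P σ y).obj (m ≫ mapHom c P (H.map f)) := σ.cell f m

/-- This and the next lemmas are laws of `σ` with the composite 2-functor unfolded, so that
rewriting sees `mapHom` and `map₂`. -/
theorem cobCell_natural {x y : Groth W} (f : x ⟶ y) {m m' : T ⟶ (P _ (H.obj x).hom).pt}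
    (γ : m ⟶ m') : cobCell c P σ f m ≫ (cobApp c P σ y).map (γ ▷ mapHom c P (H.map f)) =
      (cobApp c P σ x).map γ ≫ cobCell c P σ f m' := σ.cell_natural f γ

theorem cobCell_comp {x y z : Groth W} (f : x ⟶ y) (g : y ⟶ z)
    (m : T ⟶ (P _ (H.obj x).hom).pt) : cobCell c P σ (f ≫ g) m ≍
      cobCell c P σ f m ≫ cobCell c P σ g (m ≫ mapHom c P (H.map f)) := σ.cell_comp f g m

theorem cobCell_map₂ {x y : Groth W} {f g : x ⟶ y} (δ : f ⟶ g)
    (m : T ⟶ (P _ (H.obj x).hom).pt) : cobCell c P σ f m ≫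
      (cobApp c P σ y).map (m ◁ (map₂ c P (H.map₂ δ)).cell) = cobCell c P σ g m :=
  σ.cell_map₂ δ m

theorem cobCell_normal {x y : Groth W} (f : x ⟶ y) (hf : Groth.IsCleavage f)
    (m : T ⟶ (P _ (H.obj x).hom).pt) :
    ∃ h : (cobApp c P σ x).obj m = (cobApp c P σ y).obj (m ≫ mapHom c P (H.map f)),
      cobCell c P σ f m = eqToHom h := σ.normal f hf m

theorem cobApp_map_pairMap_id (x : Groth W) {d : T ⟶ (H.obj x).dom} {e : T ⟶ E}
    (h : e ≫ τ = d ≫ (H.obj x).hom)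
    (ht : (postcompFunctor T τ).IsHomLift (𝟙 d ▷ (H.obj x).hom) (𝟙 e)) :
    (cobApp c P σ x).map (pairMap P h h (𝟙 d) (𝟙 e) ht) = 𝟙 _ := by
  rw [pairMap_id, CategoryTheory.Functor.map_id]

/-- One square serves three purposes: for identity `η` it gives the compatibility of the transposed
cell with the morphisms of the fibre at the source and at the target, and for general `η` its
naturality in `d`. -/
theorem cobCell_liftCell_natural {x y : Groth W} (f : x ⟶ y) {d d' : T ⟶ (H.obj x).dom}
    {e e₁ e₂ e' : T ⟶ E}
    (h : e ≫ τ = d ≫ (H.obj x).hom) (h₁ : e₁ ≫ τ = d' ≫ (H.obj x).hom)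
    (h₂ : e₂ ≫ τ = (d ≫ (H.map f).map) ≫ (H.obj y).hom)
    (h' : e' ≫ τ = (d' ≫ (H.map f).map) ≫ (H.obj y).hom) (η : d ⟶ d')
    (θ : d ≫ (H.map f).map ⟶ d' ≫ (H.map f).map)
    (hθ : θ = η ▷ (H.map f).map) (s : e ⟶ e₁) (s' : e₁ ⟶ e') (t : e ⟶ e₂) (t' : e₂ ⟶ e')
    (hs : (postcompFunctor T τ).IsHomLift (η ▷ (H.obj x).hom) s)
    (hs' : (postcompFunctor T τ).IsHomLift (LaxSlice.slide (H.map f) d') s')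
    (ht : (postcompFunctor T τ).IsHomLift (LaxSlice.slide (H.map f) d) t)
    (ht' : (postcompFunctor T τ).IsHomLift (θ ▷ (H.obj y).hom) t') (w : s ≫ s' = t ≫ t') :
    (cobApp c P σ x).map (pairMap P h h₁ η s hs) ≫ cobCell c P σ f (pair P _ d' e₁ h₁) ≫
        (cobApp c P σ y).map (liftCell c P (H.map f) h₁ h' s' hs') =
      (cobCell c P σ f (pair P _ d e h) ≫
        (cobApp c P σ y).map (liftCell c P (H.map f) h h₂ t ht)) ≫
          (cobApp c P σ y).map (pairMap P h₂ h' θ t' ht') := by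
  rw [← Category.assoc, ← cobCell_natural, Category.assoc, Category.assoc, ← Functor.map_comp,
    ← Functor.map_comp, liftCell_natural c P (H.map f) h h₁ h₂ h' η θ hθ s s' t t' hs hs' ht ht' w]

theorem cobCell_liftCell_comp {x y z : Groth W} (f : x ⟶ y) (g : y ⟶ z)
    {d : T ⟶ (H.obj x).dom} {e e₁ e' : T ⟶ E}
    (h : e ≫ τ = d ≫ (H.obj x).hom) (h₁ : e₁ ≫ τ = (d ≫ (H.map f).map) ≫ (H.obj y).hom)
    (h' : e' ≫ τ = ((d ≫ (H.map f).map) ≫ (H.map g).map) ≫ (H.obj z).hom)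
    (h'' : e' ≫ τ = (d ≫ (H.map (f ≫ g)).map) ≫ (H.obj z).hom)
    (s : e ⟶ e') (t : e ⟶ e₁) (t' : e₁ ⟶ e')
    (hs : (postcompFunctor T τ).IsHomLift (LaxSlice.slide (H.map (f ≫ g)) d) s)
    (ht : (postcompFunctor T τ).IsHomLift (LaxSlice.slide (H.map f) d) t)
    (ht' : (postcompFunctor T τ).IsHomLift (LaxSlice.slide (H.map g) (d ≫ (H.map f).map)) t')
    (w : s = t ≫ t') :
    cobCell c P σ (f ≫ g) (pair P _ d e h) ≫
        (cobApp c P σ z).map (liftCell c P (H.map (f ≫ g)) h h'' s hs) ≍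
      (cobCell c P σ f (pair P _ d e h) ≫
        (cobApp c P σ y).map (liftCell c P (H.map f) h h₁ t ht)) ≫
          cobCell c P σ g (pair P _ (d ≫ (H.map f).map) e₁ h₁) ≫
            (cobApp c P σ z).map (liftCell c P (H.map g) h₁ h' t' ht') := by
  have hH := H.map_comp f g
  rw [Category.assoc (cobCell c P σ f (pair P _ d e h)),
    ← Category.assoc ((cobApp c P σ y).map _), ← cobCell_natural,
    Category.assoc (cobCell c P σ g (pair P _ d e h ≫ mapHom c P (H.map f))),
    ← Functor.map_comp, ← Category.assoc (cobCell c P σ f (pair P _ d e h))]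
  have hm : pair P _ d e h ≫ mapHom c P (H.map (f ≫ g)) =
      (pair P _ d e h ≫ mapHom c P (H.map f)) ≫ mapHom c P (H.map g) :=
    (congrArg (fun k => pair P _ d e h ≫ mapHom c P k) hH).trans (comp_mapHom_comp c P _ _ _)
  -- The morphism `H.map (f ≫ g)` occurs in the types of `h''` and `hs`, so it is generalized to `F`
  -- before the equation with `H.map f ≫ H.map g` is substituted.
  have key : ∀ (F : H.obj x ⟶ H.obj z) (hF : F = H.map f ≫ H.map g)
      (h'' : e' ≫ τ = (d ≫ F.map) ≫ (H.obj z).hom)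
      (hs : (postcompFunctor T τ).IsHomLift (LaxSlice.slide F d) s),
      pair P _ (d ≫ F.map) e' h'' = pair P _ ((d ≫ (H.map f).map) ≫ (H.map g).map) e' h' ∧
      (cobApp c P σ z).map (liftCell c P F h h'' s hs) ≍ (cobApp c P σ z).map
        (liftCell c P (H.map f) h h₁ t ht ▷ mapHom c P (H.map g) ≫
          liftCell c P (H.map g) h₁ h' t' ht') := by
    intro F hF h'' hs
    subst hF
    have hp : pair P (H.obj z) (d ≫ (H.map f ≫ H.map g).map) e' h'' =
        pair P _ ((d ≫ (H.map f).map) ≫ (H.map g).map) e' h' :=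
      congrArg ((P _ (H.obj z).hom).ofCatPullback T).obj
        (CatPullback.ext (Strict.assoc _ _ _).symm rfl)
    exact ⟨hp, functor_map_heq _ (comp_mapHom_comp c P _ _ _) hp
      (liftCell_comp c P (H.map f) (H.map g) h h₁ h' h'' s t t' hs ht ht' w)⟩
  obtain ⟨hp, hl⟩ := key _ hH h'' hs
  exact heq_comp rfl (congrArg _ hm) (congrArg _ hp) (cobCell_comp c P σ f g _) hl

theorem cobCell_liftCell_map₂ {x y : Groth W} {f g : x ⟶ y} (δ : f ⟶ g)
    {d : T ⟶ (H.obj x).dom} {e e₂ e' : T ⟶ E}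
    (h : e ≫ τ = d ≫ (H.obj x).hom) (h₂ : e₂ ≫ τ = (d ≫ (H.map f).map) ≫ (H.obj y).hom)
    (h' : e' ≫ τ = (d ≫ (H.map g).map) ≫ (H.obj y).hom) (s : e ⟶ e') (t : e ⟶ e₂) (t' : e₂ ⟶ e')
    (hs : (postcompFunctor T τ).IsHomLift (LaxSlice.slide (H.map g) d) s)
    (ht : (postcompFunctor T τ).IsHomLift (LaxSlice.slide (H.map f) d) t)
    (ht' : (postcompFunctor T τ).IsHomLift ((d ◁ (H.map₂ δ).cell) ▷ (H.obj y).hom) t')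
    (w : s = t ≫ t') :
    (cobCell c P σ f (pair P _ d e h) ≫
        (cobApp c P σ y).map (liftCell c P (H.map f) h h₂ t ht)) ≫
          (cobApp c P σ y).map (pairMap P h₂ h' (d ◁ (H.map₂ δ).cell) t' ht') =
      cobCell c P σ g (pair P _ d e h) ≫
        (cobApp c P σ y).map (liftCell c P (H.map g) h h' s hs) := by
  rw [← cobCell_map₂ c P σ δ, Category.assoc, Category.assoc, ← Functor.map_comp,
    ← Functor.map_comp, liftCell_map₂ c P (H.map₂ δ) h h₂ h' s t t' hs ht ht' w]

/-- The transpose of a component of a 2-cocone for the domains of `τ^* ∘ H`. -/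
noncomputable def transposeApp [IsOpfibration (postcompFunctor T τ)] (x : Groth W) :
    (T ⟶ (H.obj x).dom) ⥤ FibreExp (postcompFunctor T τ) X :=
  CatPullback.transpose ((P _ (H.obj x).hom).ofCatPullback T ⋙ cobApp c P σ x)

variable [IsOpfibration (postcompFunctor T τ)]

theorem isHomLift_id_whiskerRight {Y : LaxSlice K B} {d : T ⟶ Y.dom} {e e' : T ⟶ E} {t : e ⟶ e'}
    (ht : (postcompFunctor T τ).IsHomLift (𝟙 (d ≫ Y.hom)) t) :
    (postcompFunctor T τ).IsHomLift (𝟙 d ▷ Y.hom) t := by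
  rw [Bicategory.id_whiskerRight]; exact ht

/-- The structure 2-cells of the transpose of a 2-cocone for the domains of `τ^* ∘ H`. -/
noncomputable def transposeCell {x y : Groth W} (f : x ⟶ y) (d : T ⟶ (H.obj x).dom) :
    (transposeApp c P σ x).obj d ⟶ (transposeApp c P σ y).obj (d ≫ (H.map f).map) :=
  FibreExp.Hom.mk (P := (transposeApp c P σ x).obj d)
    (Q := (transposeApp c P σ y).obj (d ≫ (H.map f).map))
    (LaxSlice.slide (H.map f) d)
    (fun {e e'} h h' t ht => cobCell c P σ f (pair P _ d e h) ≫
      (cobApp c P σ y).map (liftCell c P (H.map f) h h' t ht))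
    (fun {e e' e''} h h' h'' t t' ht ht' htt' => by
      have h₁ : (postcompFunctor T τ).IsHomLift (𝟙 (d ≫ (H.map f).map) ▷ (H.obj y).hom) (𝟙 e'') :=
        isHomLift_id_whiskerRight (IsHomLift.id h'')
      -- The naturality square is used with an identity as the last factor on its right-hand side.
      -- The other compatibility, below, uses it with an identity as the first factor on its
      -- left-hand side.
      have h₂ := cobCell_liftCell_natural c P σ f h h' h'' h'' (𝟙 d) (𝟙 _)
        (Bicategory.id_whiskerRight _ _).symm t t' (t ≫ t') (𝟙 _)
        (isHomLift_id_whiskerRight ht) ht' htt' h₁ (Category.comp_id _).symm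
      exact ((Category.comp_id _).symm.trans (congrArg (_ ≫ ·)
        (cobApp_map_pairMap_id c P σ y h'' h₁).symm)).trans h₂.symm)
    (fun {e e' e''} h h' h'' t t' ht ht' htt' => by
      have h₁ : (postcompFunctor T τ).IsHomLift (𝟙 d ▷ (H.obj x).hom) (𝟙 e) :=
        isHomLift_id_whiskerRight (IsHomLift.id h)
      have h₂ := cobCell_liftCell_natural c P σ f h h h' h'' (𝟙 d) (𝟙 _)
        (Bicategory.id_whiskerRight _ _).symm (𝟙 e) (t ≫ t') t t' h₁ htt' ht
        (isHomLift_id_whiskerRight ht') (Category.id_comp _)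
      exact ((Category.id_comp _).symm.trans (congrArg (· ≫ _)
        (cobApp_map_pairMap_id c P σ x h h₁).symm)).trans h₂)

/-- Each composite is evaluated at `t` on a factorization of its own. The two factorizations form
the square of `cobCell_liftCell_natural`, as both compose to `t`. -/
theorem transposeCell_natural {x y : Groth W} (f : x ⟶ y) {d d' : T ⟶ (H.obj x).dom}
    (η : d ⟶ d') : transposeCell c P σ f d ≫ (transposeApp c P σ y).map (η ▷ (H.map f).map) =
      (transposeApp c P σ x).map η ≫ transposeCell c P σ f d' := by
  refine FibreExp.Hom.ext_of_app (LaxSlice.slide_natural (H.map f) η) ?_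
  intro e e' h h' t ht ht'
  obtain ⟨k, hk, l, χ, hl, hχ, w⟩ := FibreExp.exists_factor
    (transposeCell c P σ f d).base ((transposeApp c P σ y).map (η ▷ (H.map f).map)).base h t ht
  obtain ⟨k', hk', l', χ', hl', hχ', w'⟩ := FibreExp.exists_factor
    ((transposeApp c P σ x).map η).base (transposeCell c P σ f d').base h t ht'
  rw [FibreExp.comp_app _ _ h hk h' l χ hl hχ w ht,
    FibreExp.comp_app _ _ h hk' h' l' χ' hl' hχ' w' ht']
  exact (cobCell_liftCell_natural c P σ f h hk' hk h' η _ rfl l' χ' l χ hl' hχ' hl hχ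
    (w'.trans w.symm)).symm

theorem transposeCell_comp {x y z : Groth W} (f : x ⟶ y) (g : y ⟶ z) (d : T ⟶ (H.obj x).dom) :
    transposeCell c P σ (f ≫ g) d ≍
      transposeCell c P σ f d ≫ transposeCell c P σ g (d ≫ (H.map f).map) := by
  have hH := H.map_comp f g
  have hd : d ≫ (H.map (f ≫ g)).map = (d ≫ (H.map f).map) ≫ (H.map g).map := by
    rw [hH]; exact (Strict.assoc _ _ _).symm
  have hbase : LaxSlice.slide (H.map (f ≫ g)) d ≍
      LaxSlice.slide (H.map f) d ≫ LaxSlice.slide (H.map g) (d ≫ (H.map f).map) :=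
    (congr_arg_heq (fun k => LaxSlice.slide k d) hH).trans (LaxSlice.slide_comp _ _ d)
  refine FibreExp.hom_heq rfl (congrArg _ hd) hbase ?_
  intro e e' h h' h₁ h₁' t ht ht'
  obtain ⟨k, hk, l, χ, hl, hχ, w⟩ := FibreExp.exists_factor
    (transposeCell c P σ f d).base (transposeCell c P σ g (d ≫ (H.map f).map)).base h t ht'
  rw [FibreExp.comp_app _ _ h hk h₁' l χ hl hχ w ht']
  exact cobCell_liftCell_comp c P σ f g h hk h₁' h' t l χ ht hl hχ w.symm

theorem transposeCell_map₂ {x y : Groth W} {f g : x ⟶ y} (δ : f ⟶ g) (d : T ⟶ (H.obj x).dom) :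
    transposeCell c P σ f d ≫ (transposeApp c P σ y).map (d ◁ (H.map₂ δ).cell) =
      transposeCell c P σ g d := by
  refine FibreExp.Hom.ext_of_app (LaxSlice.slide_cell (H.map₂ δ) d) ?_
  intro e e' h h' t ht ht'
  obtain ⟨k, hk, l, χ, hl, hχ, w⟩ := FibreExp.exists_factor
    (transposeCell c P σ f d).base ((transposeApp c P σ y).map (d ◁ (H.map₂ δ).cell)).base h t ht
  rw [FibreExp.comp_app _ _ h hk h' l χ hl hχ w ht]
  exact cobCell_liftCell_map₂ c P σ δ h hk h' t l χ ht' hl hχ w.symm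

/-- For `f` in the cleavage, `H.map f` is tight and the structure cell of σ is an identity. Hence
the base of the transposed cell is an identity, the lift cells are plain pairs, and the components
reduce to the action of the source object on the fibre, that is, to the components of an identity.
-/
theorem transposeCell_normal
    (hH : ∀ {x y : Groth W} (f : x ⟶ y), Groth.IsCleavage f → LaxSlice.IsTight (H.map f))
    {x y : Groth W} (f : x ⟶ y) (hf : Groth.IsCleavage f) (d : T ⟶ (H.obj x).dom) :
    ∃ h : (transposeApp c P σ x).obj d = (transposeApp c P σ y).obj (d ≫ (H.map f).map),
      transposeCell c P σ f d = eqToHom h := by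
  have hT := hH f hf
  have hb : (d ≫ (H.map f).map) ≫ (H.obj y).hom = d ≫ (H.obj x).hom := hT.comp_hom d
  have hm : ∀ (e : T ⟶ E) (h : e ≫ τ = d ≫ (H.obj x).hom)
      (h' : e ≫ τ = (d ≫ (H.map f).map) ≫ (H.obj y).hom),
      pair P _ d e h ≫ mapHom c P (H.map f) = pair P _ (d ≫ (H.map f).map) e h' := fun e h h' =>
    ((P _ (H.obj y).hom).ofCatPullback_mk_toCatPullback_obj _
      ((comp_mapHom_fst c P _ _).trans (congrArg (· ≫ (H.map f).map) (pair_fst P d e h)))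
      ((comp_mapHom_snd_of_isTight c P hT _).trans (pair_snd P d e h)) h').symm
  have hcell : ∀ (e : T ⟶ E) (h : e ≫ τ = d ≫ (H.obj x).hom),
      cobCell c P σ f (pair P _ d e h) ≍ 𝟙 ((cobApp c P σ x).obj (pair P _ d e h)) := fun e h => by
    obtain ⟨h₁, h₂⟩ := cobCell_normal c P σ f hf (pair P _ d e h)
    rw [h₂]
    exact heq_id_of_eqToHom _
  -- Writing `t` as `t ≫ 𝟙` reduces the claim to the component at an identity: there the structure
  -- cell is an identity by normality of σ, and the lift cell is one by `liftCell_of_isTight`.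
  have happ : ∀ {e e' : T ⟶ E} (h : e ≫ τ = d ≫ (H.obj x).hom)
      (h' : e' ≫ τ = d ≫ (H.obj x).hom)
      (h₁ : e ≫ τ = (d ≫ (H.map f).map) ≫ (H.obj y).hom)
      (h₁' : e' ≫ τ = (d ≫ (H.map f).map) ≫ (H.obj y).hom) (t : e ⟶ e')
      (ht : (postcompFunctor T τ).IsHomLift (𝟙 (d ≫ (H.obj x).hom)) t)
      (ht' : (postcompFunctor T τ).IsHomLift (LaxSlice.slide (H.map f) d) t),
      (transposeCell c P σ f d).app h h₁' t ht' ≍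
        ((transposeApp c P σ x).obj d).map h h' t ht := by
    intro e e' h h' h₁ h₁' t ht ht'
    have h₂ : (postcompFunctor T τ).IsHomLift (LaxSlice.slide (H.map f) d) (𝟙 e') := by
      refine isHomLift_of_heq h' h₁' ((heq_of_eq ((postcompFunctor T τ).map_id _)).trans ?_)
      exact (congr_arg_heq (fun z => 𝟙 z) h').trans (LaxSlice.slide_of_isTight hT d).symm
    have h₃ : (postcompFunctor T τ).IsHomLift (𝟙 (d ≫ (H.map f).map) ▷ (H.obj y).hom) (𝟙 e') :=
      isHomLift_id_whiskerRight (IsHomLift.id h₁')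
    have h₄ : liftCell c P (H.map f) h' h₁' (𝟙 e') h₂ ≍
        𝟙 (pair P (H.obj y) (d ≫ (H.map f).map) e' h₁') :=
      (liftCell_of_isTight c P hT h' h₁' h₁' (𝟙 e') h₂ h₃).trans (heq_of_eq (pairMap_id P _ _))
    have h₅ := (transposeCell c P σ f d).map_app h h' h₁' t (𝟙 e') ht h₂
      (by rw [Category.comp_id]; exact ht')
    refine HEq.trans (b := (transposeCell c P σ f d).app h h₁' (t ≫ 𝟙 e')
      (by rw [Category.comp_id]; exact ht')) ?_ ((heq_of_eq h₅).trans ?_)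
    · congr 1
      exact (Category.comp_id t).symm
    · have ho : (cobApp c P σ x).obj (pair P _ d e' h') =
          (cobApp c P σ y).obj (pair P _ d e' h' ≫ mapHom c P (H.map f)) :=
        (cobCell_normal c P σ f hf _).1
      refine comp_heq_of_heq_id rfl rfl (ho.trans (congrArg _ (hm e' h' h₁'))) HEq.rfl ?_
      refine comp_heq_of_heq_id rfl ho.symm (congrArg _ (hm e' h' h₁')) (hcell e' h') ?_
      refine (functor_map_heq _ (hm e' h' h₁') rfl h₄).trans ?_
      rw [CategoryTheory.Functor.map_id, hm e' h' h₁']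
  -- On objects of the fibre the equality is normality of σ. On a morphism `t` the two actions are
  -- compared through the component of the transposed cell at `t`: `happ` expresses it by the source
  -- object, and `t = 𝟙 ≫ t` with `app_map` expresses it by the target object.
  have ho : (transposeApp c P σ x).obj d = (transposeApp c P σ y).obj (d ≫ (H.map f).map) := by
    refine FibreExp.obj_ext hb.symm (fun e h h' => ?_) ?_
    · exact (cobCell_normal c P σ f hf _).1.trans (congrArg _ (hm e h h'))
    · intro e e' h h' h₁ h₁' t ht ht'
      have h₂ : (postcompFunctor T τ).IsHomLift (LaxSlice.slide (H.map f) d) (𝟙 e) := by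
        refine isHomLift_of_heq h h₁ ((heq_of_eq ((postcompFunctor T τ).map_id _)).trans ?_)
        exact (congr_arg_heq (fun z => 𝟙 z) h).trans (LaxSlice.slide_of_isTight hT d).symm
      have h₂' : (postcompFunctor T τ).IsHomLift (LaxSlice.slide (H.map f) d) t := by
        refine isHomLift_of_heq h h₁' ((map_heq_of_isHomLift ht).trans ?_)
        exact (LaxSlice.slide_of_isTight hT d).symm
      have h₅ := (transposeCell c P σ f d).app_map h h₁ h₁' (𝟙 e) t h₂ ht'
        (by rw [Category.id_comp]; exact h₂')
      have h₆ := happ h h h₁ h₁ (𝟙 e) (IsHomLift.id h) h₂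
      replace h₆ := h₆.trans (heq_of_eq (((transposeApp c P σ x).obj d).map_id h _))
      have h₇ : (transposeCell c P σ f d).app h h₁' (𝟙 e ≫ t)
          (by rw [Category.id_comp]; exact h₂') = (transposeCell c P σ f d).app h h₁' t h₂' := by
        congr 1
        exact Category.id_comp t
      have e₁ : ((transposeApp c P σ x).obj d).obj e h =
          ((transposeApp c P σ y).obj (d ≫ (H.map f).map)).obj e h₁ :=
        (cobCell_normal c P σ f hf _).1.trans (congrArg _ (hm e h h₁))
      refine (happ h h' h₁ h₁' t ht h₂').symm.trans ((heq_of_eq (h₇.symm.trans h₅)).trans ?_)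
      refine comp_heq_of_id_heq e₁ rfl rfl (h₆.trans ?_) HEq.rfl
      exact congr_arg_heq (fun z => 𝟙 z) e₁
  refine ⟨ho, eq_of_heq (HEq.trans ?_ (heq_id_of_eqToHom ho).symm)⟩
  refine FibreExp.hom_heq rfl ho.symm (LaxSlice.slide_of_isTight hT d) ?_
  intro e e' h h' h₁ h₁' t ht ht'
  exact happ h h₁' (h.trans hb.symm) h' t ht' ht

end ChangeOfBase

end TransposeCocone

end TwoCat

namespace TwoCat

/-! ### Tight morphisms and the transposed 2-cocone -/

section TransposedUniversal

/-- The fibre component of an identity is a unit constraint of the strict 2-functor `W`, hence an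
identity up to transport. Through this lemma the unit laws of 2-cocones follow from normality. -/
theorem Groth.isCleavage_id {A : Type u₁} [Bicategory.{w₁, v₁} A]
    {W : StrictPseudofunctor Aᵒᵖ Cat.{v₂, u₂}} (x : Groth W) : Groth.IsCleavage (𝟙 x) := by
  have h : ∀ {F : Cat.of (W.obj (op x.base)) ⟶ W.obj (op x.base)} (e : F = 𝟙 _),
      ∃ h : x.fiber = F.toFunctor.obj x.fiber,
        (eqToIso e).inv.toNatTrans.app x.fiber = eqToHom h := by
    rintro F rfl
    exact ⟨rfl, rfl⟩
  rw [Groth.IsCleavage, Groth.id_fiber, W.mapId_eq_eqToIso]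
  exact h _

theorem OplaxNormalCocone.map_cell_heq {A : Type u₁} [Bicategory.{w₁, v₁} A]
    {W : StrictPseudofunctor Aᵒᵖ Cat.{v₂, u₂}} {S : Type u} [Bicategory.{w, v} S] [Strict S]
    {T : Type u₃} [Bicategory.{w₃, v₃} T] [Strict T] {D : StrictPseudofunctor (Groth W) S} {C : S}
    (F : StrictPseudofunctor S T) (ζ : OplaxNormalCocone D C) {x y : Groth W} (f : x ⟶ y) :
    (ζ.map F).cell f ≍ F.map₂ (ζ.cell f) :=
  comp_eqToHom_heq _ _

variable {K : Type u} [Bicategory.{v, v} K] [Strict K]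

namespace LaxSlice

variable {M : K} {X Y Z : LaxSlice K M}

theorem cell_comp_heq_of_isTight (f : X ⟶ Y) {b : Y ⟶ Z} (hb : IsTight b) :
    (f ≫ b).cell ≍ f.cell := by
  obtain ⟨h, e⟩ := hb
  rw [comp_cell, e, associator_inv, whiskerLeft_eqToHom, eqToHom_trans]
  exact comp_eqToHom_heq f.cell _

/-- When `a` and `b` have identity fillings, the equation satisfied by a 2-cell of the lax slice
says that `δ` whiskered with `Z.hom` is the filling of `f`. For the structure 2-cells of ζ, this
identifies their image in `B` with the fillings of `H`. -/
theorem cell_whiskerRight_heq_of_isTight {f : X ⟶ Y} {a : X ⟶ Z} {b : Y ⟶ Z} (ha : IsTight a)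
    (hb : IsTight b) (δ : a ⟶ f ≫ b) : δ.cell ▷ Z.hom ≍ f.cell := by
  obtain ⟨h, e⟩ := ha
  refine HEq.trans ?_ (cell_comp_heq_of_isTight f hb)
  rw [← hom₂_w δ, e]
  exact (eqToHom_comp_heq (δ.cell ▷ Z.hom) h).symm

theorem whiskerLeft_cell_whiskerRight_heq {T : K} {f : X ⟶ Y} {a : X ⟶ Z} {b : Y ⟶ Z}
    (ha : IsTight a) (hb : IsTight b) (δ : a ⟶ f ≫ b) (d : T ⟶ X.dom) :
    (d ◁ δ.cell) ▷ Z.hom ≍ slide f d := by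
  have h := cell_whiskerRight_heq_of_isTight ha hb δ
  obtain ⟨ha, -⟩ := ha
  obtain ⟨hb, -⟩ := hb
  refine (whisker_assoc_heq _ _ _).trans (HEq.trans ?_ (slide_heq f d).symm)
  refine whiskerLeft_heq rfl ha.symm ?_ h
  rw [comp_map, Strict.assoc, ← hb]

end LaxSlice

variable {T : K} {A : Type u₁} [Bicategory.{w₁, v₁} A]
  {W : StrictPseudofunctor Aᵒᵖ Cat.{v₂, u₂}}
  {E B : K} {τ : E ⟶ B} (c : SplitOpfibration τ)
  (P : ∀ (X : K) (F : X ⟶ B), TwoPullback F τ) {H : StrictPseudofunctor (Groth W) (LaxSlice K B)}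
  {X : Type v₃} [Category.{w₃} X]

namespace ChangeOfBase

theorem pair_comp_mapHom_of_isTight {S Y : LaxSlice K B} {f : S ⟶ Y} (hf : LaxSlice.IsTight f)
    {d : T ⟶ S.dom} {e : T ⟶ E} (h : e ≫ τ = d ≫ S.hom) (h' : e ≫ τ = (d ≫ f.map) ≫ Y.hom) :
    pair P S d e h ≫ mapHom c P f = pair P Y (d ≫ f.map) e h' :=
  ((P _ Y.hom).ofCatPullback_mk_toCatPullback_obj _
    ((comp_mapHom_fst c P _ _).trans (congrArg (· ≫ f.map) (pair_fst P d e h)))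
    ((comp_mapHom_snd_of_isTight c P hf _).trans (pair_snd P d e h)) h').symm

theorem pairMap_whiskerRight_of_isTight {S Y : LaxSlice K B} {f : S ⟶ Y}
    (hf : LaxSlice.IsTight f) {d d' : T ⟶ S.dom} {e e' : T ⟶ E} (h : e ≫ τ = d ≫ S.hom)
    (h' : e' ≫ τ = d' ≫ S.hom) (h₁ : e ≫ τ = (d ≫ f.map) ≫ Y.hom)
    (h₁' : e' ≫ τ = (d' ≫ f.map) ≫ Y.hom) (η : d ⟶ d') (t : e ⟶ e')
    (ht : (postcompFunctor T τ).IsHomLift (η ▷ S.hom) t)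
    (ht' : (postcompFunctor T τ).IsHomLift ((η ▷ f.map) ▷ Y.hom) t) :
    pairMap P h₁ h₁' (η ▷ f.map) t ht' ≍ pairMap P h h' η t ht ▷ mapHom c P f := by
  refine (P _ Y.hom).ofCatPullback_map_heq (a := CatPullback.mk (d ≫ f.map) e h₁)
    (b := CatPullback.mk (d' ≫ f.map) e' h₁') (CatPullback.Hom.mk (η ▷ f.map) t ht')
    (pairMap P h h' η t ht ▷ mapHom c P f) ?_ ?_ ?_ ?_ ?_ ?_
  · exact (comp_mapHom_fst c P _ _).trans (congrArg (· ≫ f.map) (pair_fst P _ _ _))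
  · exact (comp_mapHom_snd_of_isTight c P hf _).trans (pair_snd P _ _ _)
  · exact (comp_mapHom_fst c P _ _).trans (congrArg (· ≫ f.map) (pair_fst P _ _ _))
  · exact (comp_mapHom_snd_of_isTight c P hf _).trans (pair_snd P _ _ _)
  · exact (whiskerRight_mapHom_fst c P f _).trans (whiskerRight_heq (pair_fst P _ _ _)
      (pair_fst P _ _ _) rfl (pairMap_fst P h h' η t ht))
  · exact (whiskerRight_mapHom_snd_of_isTight c P hf _).trans (pairMap_snd P h h' η t ht)

/-- The factorization of a cocartesian lift through itself is an identity. Consequently the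
transposed cell, evaluated at the cocartesian lift, returns the original structure cell of σ. -/
theorem liftCell_slideMap_heq {S Y : LaxSlice K B} (f : S ⟶ Y) (m : T ⟶ (P _ S.hom).pt)
    (h : (m ≫ (P _ S.hom).snd) ≫ τ = (m ≫ (P _ S.hom).fst) ≫ S.hom)
    (h' : ((m ≫ mapHom c P f) ≫ (P _ Y.hom).snd) ≫ τ =
      ((m ≫ (P _ S.hom).fst) ≫ f.map) ≫ Y.hom)
    (ht : (postcompFunctor T τ).IsHomLift (LaxSlice.slide f (m ≫ (P _ S.hom).fst))
      (slideMap c P f m)) :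
    liftCell c P f h h' (slideMap c P f m) ht ≍ 𝟙 (m ≫ mapHom c P f) := by
  have hm : pair P S (m ≫ (P _ S.hom).fst) (m ≫ (P _ S.hom).snd) h = m :=
    (P _ S.hom).ofCatPullback_mk_toCatPullback_obj m rfl rfl h
  have hm' : pair P Y ((m ≫ (P _ S.hom).fst) ≫ f.map) ((m ≫ mapHom c P f) ≫ (P _ Y.hom).snd) h' =
      m ≫ mapHom c P f :=
    (P _ Y.hom).ofCatPullback_mk_toCatPullback_obj _ (comp_mapHom_fst c P f m) rfl h'
  refine cell_heq_of_isLift c P (congrArg (· ≫ mapHom c P f) hm) hm'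
    (congrArg (· ≫ (P _ S.hom).snd) hm) (isLift_slide_map c P f _)
    (congr_arg_heq (fun k => slideMap c P f k) hm) ?_ ?_
  · refine (liftCell_fst c P f h h' _ ht).trans ?_
    rw [Bicategory.id_whiskerRight, comp_mapHom_fst]
  · refine (liftCell_snd c P f h h' _ ht).trans ?_
    rw [Bicategory.id_whiskerRight]
    exact heq_of_eq (Category.comp_id (slideMap c P f m)).symm

variable (σ : HomCocone T ((H.comp (changeOfBase c P)).comp (LaxSlice.domFunctor K E)) X)

theorem cobCell_liftCell_slideMap {x y : Groth W} (f : x ⟶ y) (m : T ⟶ (P _ (H.obj x).hom).pt)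
    (h : (m ≫ (P _ (H.obj x).hom).snd) ≫ τ = (m ≫ (P _ (H.obj x).hom).fst) ≫ (H.obj x).hom)
    (h' : ((m ≫ mapHom c P (H.map f)) ≫ (P _ (H.obj y).hom).snd) ≫ τ =
      ((m ≫ (P _ (H.obj x).hom).fst) ≫ (H.map f).map) ≫ (H.obj y).hom)
    (ht : (postcompFunctor T τ).IsHomLift
      (LaxSlice.slide (H.map f) (m ≫ (P _ (H.obj x).hom).fst)) (slideMap c P (H.map f) m)) :
    cobCell c P σ f (pair P _ _ _ h) ≫
      (cobApp c P σ y).map (liftCell c P (H.map f) h h' _ ht) ≍ cobCell c P σ f m := by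
  have hm : pair P _ (m ≫ (P _ (H.obj x).hom).fst) (m ≫ (P _ (H.obj x).hom).snd) h = m :=
    (P _ (H.obj x).hom).ofCatPullback_mk_toCatPullback_obj m rfl rfl h
  have hm' : pair P _ ((m ≫ (P _ (H.obj x).hom).fst) ≫ (H.map f).map)
      ((m ≫ mapHom c P (H.map f)) ≫ (P _ (H.obj y).hom).snd) h' = m ≫ mapHom c P (H.map f) :=
    (P _ (H.obj y).hom).ofCatPullback_mk_toCatPullback_obj _ (comp_mapHom_fst c P _ m) rfl h'
  refine comp_heq_of_heq_id (congrArg _ hm) (by rw [hm]) (by rw [hm', hm])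
    (congr_arg_heq (fun k => cobCell c P σ f k) hm) ?_
  refine (functor_map_heq _ (by rw [hm]) hm' (liftCell_slideMap_heq c P (H.map f) m h h' ht)).trans
    ?_
  rw [CategoryTheory.Functor.map_id, hm]

/-- The transpose of a 2-cocone for the domains of `τ^* ∘ H`. -/
noncomputable def transposeCocone [IsOpfibration (postcompFunctor T τ)]
    (hH : ∀ {x y : Groth W} (f : x ⟶ y), Groth.IsCleavage f → LaxSlice.IsTight (H.map f)) :
    HomCocone T (H.comp (LaxSlice.domFunctor K B)) (FibreExp (postcompFunctor T τ) X) where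
  app x := transposeApp c P σ x
  cell f d := transposeCell c P σ f d
  cell_natural f _ _ η := transposeCell_natural c P σ f η
  cell_id x d := by
    -- Identities belong to the cleavage, so the unit law is an instance of normality.
    obtain ⟨h, e⟩ := transposeCell_normal c P σ hH (𝟙 x) (Groth.isCleavage_id x) d
    exact (heq_of_eq e).trans (heq_id_of_eqToHom h)
  cell_comp f g d := transposeCell_comp c P σ f g d
  cell_map₂ δ d := transposeCell_map₂ c P σ δ d
  normal f hf d := transposeCell_normal c P σ hH f hf d

end ChangeOfBase

end TransposedUniversal

end TwoCat

/-! ### Change of base preserves universality for hom-categories -/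

namespace TwoCat

theorem LaxSlice.hom₂_cell_heq {K : Type u} [Bicategory.{w, v} K] [Strict K] {M : K}
    {X Y : LaxSlice K M} {f f' g g' : X ⟶ Y} (hf : f = f')
    (hg : g = g') {δ : f ⟶ g} {δ' : f' ⟶ g'} (h : δ ≍ δ') : δ.cell ≍ δ'.cell := by
  subst hf hg
  rw [eq_of_heq h]

section ChangeOfBaseUniversal

variable {K : Type u} [Bicategory.{v, v} K] [Strict K]
  {T : K} {A : Type u₁} [Bicategory.{w₁, v₁} A]
  {W : StrictPseudofunctor Aᵒᵖ Cat.{v₂, u₂}}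
  {E B : K} {τ : E ⟶ B} (c : SplitOpfibration τ)
  (P : ∀ (X : K) (F : X ⟶ B), TwoPullback F τ) {H : StrictPseudofunctor (Groth W) (LaxSlice K B)}
  {X : Type v₃} [Category.{w₃} X] {C : LaxSlice K B} (ζ : OplaxNormalCocone H C)

namespace ChangeOfBase

/-- The domain of the 2-cocone `τ^* ∘ ζ`. -/
noncomputable abbrev domCob :
    OplaxNormalCocone ((H.comp (changeOfBase c P)).comp (LaxSlice.domFunctor K E))
      (P _ C.hom).pt :=
  (ζ.map (changeOfBase c P)).map (LaxSlice.domFunctor K E)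

/-- The structure 2-cells of the domain of the 2-cocone `τ^* ∘ ζ`. -/
noncomputable def domCobCell {x y : Groth W} (f : x ⟶ y) :
    mapHom c P (ζ.app x) ⟶ mapHom c P (H.map f) ≫ mapHom c P (ζ.app y) :=
  ((ζ.map (changeOfBase c P)).cell f).cell

theorem domCob_cell_heq {x y : Groth W} (f : x ⟶ y) :
    (domCob c P ζ).cell f ≍ domCobCell c P ζ f :=
  (ζ.map (changeOfBase c P)).map_cell_heq (LaxSlice.domFunctor K E) f

theorem pair_congr {S : LaxSlice K B} {d d' : T ⟶ S.dom} {e : T ⟶ E} (hd : d = d')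
    (h : e ≫ τ = d ≫ S.hom) (h' : e ≫ τ = d' ≫ S.hom) : pair P S d e h = pair P S d' e h' := by
  subst hd; rfl

theorem domCobCell_fst {x y : Groth W} (f : x ⟶ y) :
    domCobCell c P ζ f ▷ (P _ C.hom).fst ≍ (P _ (H.obj x).hom).fst ◁ (ζ.cell f).cell := by
  have h : domCobCell c P ζ f ≍ (map₂ c P (ζ.cell f)).cell :=
    LaxSlice.hom₂_cell_heq (M := E) (X := obj P (H.obj x)) (Y := obj P C) rfl
      (map_comp c P _ _).symm (ζ.map_cell_heq (changeOfBase c P) f)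
  refine HEq.trans ?_ (map₂_over c P (ζ.cell f))
  exact whiskerRight_heq rfl (congrArg LaxSlice.Hom.map (map_comp c P (H.map f) (ζ.app y))).symm
    rfl h

theorem whiskerLeft_domCobCell_fst {x y : Groth W} (f : x ⟶ y)
    (m : T ⟶ (P _ (H.obj x).hom).pt) :
    (m ◁ domCobCell c P ζ f) ▷ (P _ C.hom).fst ≍
      (m ≫ (P _ (H.obj x).hom).fst) ◁ (ζ.cell f).cell := by
  refine (whisker_assoc_heq _ _ _).trans (HEq.trans ?_ (comp_whiskerLeft_heq _ _ _).symm)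
  refine whiskerLeft_heq rfl (mapHom_fst c P _) ?_ (domCobCell_fst c P ζ f)
  rw [Strict.assoc, mapHom_fst, ← Strict.assoc, mapHom_fst, Strict.assoc, LaxSlice.comp_map]

/-- Since `τ^*` preserves tightness, the structure 2-cells of `τ^* ∘ ζ` project in `E` to the
fillings of `τ^* ∘ H`, which are cocartesian lifts. Their projections to the domain of `C` are the
structure 2-cells of `ζ`, by `whiskerLeft_domCobCell_fst`. -/
theorem whiskerLeft_domCobCell_snd (ht : ∀ x, LaxSlice.IsTight (ζ.app x)) {x y : Groth W}
    (f : x ⟶ y) (m : T ⟶ (P _ (H.obj x).hom).pt) :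
    (m ◁ domCobCell c P ζ f) ▷ (P _ C.hom).snd ≍ slideMap c P (H.map f) m :=
  LaxSlice.whiskerLeft_cell_whiskerRight_heq (X := obj P (H.obj x)) (Y := obj P (H.obj y))
    (Z := obj P C) (isTight_map c P (ht x)) (isTight_map c P (ht y))
    ((ζ.map (changeOfBase c P)).cell f) m

end ChangeOfBase

open ChangeOfBase

variable {ζ} [IsOpfibration (postcompFunctor T τ)]

theorem domFunctor_cell_heq {M : K} {H : StrictPseudofunctor (Groth W) (LaxSlice K M)}
    {C : LaxSlice K M} (ζ : OplaxNormalCocone H C) {x y : Groth W} (f : x ⟶ y) :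
    (ζ.map (LaxSlice.domFunctor K M)).cell f ≍ (ζ.cell f).cell :=
  ζ.map_cell_heq (LaxSlice.domFunctor K M) f

/-- Universality is applied with the hom-category `T ⟶ B` as test category. The two functors have
the same restriction: on the components because `ζ.app x` is tight, and on the structure 2-cells
because both sides give the filling of `H.map f`. -/
theorem baseFunctor_of_restrict_eq (hζ : HomUniversal T (ζ.map (LaxSlice.domFunctor K B)))
    (ht : ∀ x, LaxSlice.IsTight (ζ.app x)) {X : Type v} [Category.{v} X]
    (hH : ∀ {x y : Groth W} (f : x ⟶ y), Groth.IsCleavage f → LaxSlice.IsTight (H.map f))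
    (σ : HomCocone T ((H.comp (changeOfBase c P)).comp (LaxSlice.domFunctor K E)) X)
    (s : (T ⟶ C.dom) ⥤ FibreExp (postcompFunctor T τ) X)
    (hs : HomCocone.restrict T (ζ.map (LaxSlice.domFunctor K B)) s = transposeCocone c P σ hH) :
    s ⋙ FibreExp.baseFunctor (postcompFunctor T τ) X = postcompFunctor T C.hom := by
  have hobj : ∀ {x : Groth W} (d : T ⟶ (H.obj x).dom), s.obj (d ≫ (ζ.app x).map) =
      (transposeApp c P σ x).obj d := fun d => HomCocone.obj_of_restrict_eq hs d
  have hmap : ∀ {x : Groth W} {d d' : T ⟶ (H.obj x).dom} (η : d ⟶ d'),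
      s.map (η ▷ (ζ.app x).map) ≍ (transposeApp c P σ x).map η :=
    fun η => HomCocone.map_of_restrict_eq hs η
  have hcell : ∀ {x y : Groth W} (f : x ⟶ y) (d : T ⟶ (H.obj x).dom),
      s.map (d ◁ (ζ.map (LaxSlice.domFunctor K B)).cell f) ≍ transposeCell c P σ f d :=
    fun f d => HomCocone.cell_of_restrict_eq hs f d
  refine hζ.functor_ext (fun x => ?_) (fun {x y} f d => ?_)
  · refine CategoryTheory.Functor.hext (fun d => ?_) (fun d d' η => ?_)
    · exact (congrArg FibreExp.base (hobj d)).trans ((ht x).comp_hom d).symm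
    · refine (FibreExp.base_congr (hobj d) (hobj d') (hmap η)).trans ?_
      obtain ⟨h, -⟩ := ht x
      exact (whiskerRight_heq rfl rfl h HEq.rfl).trans (whiskerRight_comp_heq _ _ _)
  · have h₁ : s.obj (d ≫ (H.map f).map ≫ (ζ.app y).map) =
        (transposeApp c P σ y).obj (d ≫ (H.map f).map) :=
      (congrArg s.obj (Strict.assoc _ _ _).symm).trans (hobj _)
    refine (FibreExp.base_congr (hobj d) h₁ (hcell f d)).trans ?_
    refine (LaxSlice.whiskerLeft_cell_whiskerRight_heq (ht x) (ht y) (ζ.cell f) d).symm.trans ?_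
    exact whiskerRight_heq rfl rfl rfl
      (whiskerLeft_heq rfl rfl rfl (domFunctor_cell_heq ζ f).symm)

/-- The transpose of σ extends along the domain of ζ to a functor `s` with values in the
exponential. As `s` lies over postcomposition with `C.hom`, it transposes back to a functor on `T ⟶
(P _ C.hom).pt`. -/
theorem exists_restrict_domCob (hζ : HomUniversal T (ζ.map (LaxSlice.domFunctor K B)))
    (ht : ∀ x, LaxSlice.IsTight (ζ.app x)) {X : Type v} [Category.{v} X]
    (hH : ∀ {x y : Groth W} (f : x ⟶ y), Groth.IsCleavage f → LaxSlice.IsTight (H.map f))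
    (σ : HomCocone T ((H.comp (changeOfBase c P)).comp (LaxSlice.domFunctor K E)) X) :
    ∃ s, HomCocone.restrict T (domCob c P ζ) s = σ := by
  obtain ⟨s, hs⟩ := (hζ (FibreExp (postcompFunctor T τ) X)).2 (transposeCocone c P σ hH)
  have hb := baseFunctor_of_restrict_eq c P hζ ht hH σ s hs
  have hobj : ∀ {x : Groth W} (d : T ⟶ (H.obj x).dom), s.obj (d ≫ (ζ.app x).map) =
      (transposeApp c P σ x).obj d := fun d => HomCocone.obj_of_restrict_eq hs d
  have hmap : ∀ {x : Groth W} {d d' : T ⟶ (H.obj x).dom} (η : d ⟶ d'),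
      s.map (η ▷ (ζ.app x).map) ≍ (transposeApp c P σ x).map η :=
    fun η => HomCocone.map_of_restrict_eq hs η
  have hcell : ∀ {x y : Groth W} (f : x ⟶ y) (d : T ⟶ (H.obj x).dom),
      s.map (d ◁ (ζ.map (LaxSlice.domFunctor K B)).cell f) ≍ transposeCell c P σ f d :=
    fun f d => HomCocone.cell_of_restrict_eq hs f d
  have hobj' : ∀ {x : Groth W} (m : T ⟶ (P _ (H.obj x).hom).pt),
      s.obj ((m ≫ mapHom c P (ζ.app x)) ≫ (P _ C.hom).fst) =
        (transposeApp c P σ x).obj (m ≫ (P _ (H.obj x).hom).fst) := fun {x} m =>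
    (congrArg s.obj (comp_mapHom_fst c P (ζ.app x) m)).trans (hobj _)
  have hpair : ∀ {x : Groth W} (m : T ⟶ (P _ (H.obj x).hom).pt),
      pair P _ (m ≫ (P _ (H.obj x).hom).fst) (m ≫ (P _ (H.obj x).hom).snd)
        ((P _ (H.obj x).hom).comp_fst_comp m) = m := fun m =>
    (P _ _).ofCatPullback_mk_toCatPullback_obj m rfl rfl _
  let S : (T ⟶ (P _ C.hom).pt) ⥤ X := (P _ C.hom).toCatPullback T ⋙ CatPullback.untranspose s hb
  have hSobj : ∀ {x : Groth W} (m : T ⟶ (P _ (H.obj x).hom).pt),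
      S.obj (m ≫ mapHom c P (ζ.app x)) = (cobApp c P σ x).obj m := fun {x} m =>
    (FibreExp.obj_congr (hobj' m) (comp_mapHom_snd_of_isTight c P (ht x) m) _
      ((P _ (H.obj x).hom).comp_fst_comp m)).trans (congrArg (cobApp c P σ x).obj (hpair m))
  refine ⟨S, HomCocone.ext_of_heq (fun x => ?_)
    (fun {x y} f (m : T ⟶ (P _ (H.obj x).hom).pt) => ?_)⟩
  · refine CategoryTheory.Functor.hext (fun m => hSobj m) (fun m m' γ => ?_)
    have hl : (postcompFunctor T τ).IsHomLift ((γ ▷ (P _ (H.obj x).hom).fst) ▷ (H.obj x).hom)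
        (γ ▷ (P _ (H.obj x).hom).snd) :=
      isHomLift_of_heq ((P _ (H.obj x).hom).comp_fst_comp m)
        ((P _ (H.obj x).hom).comp_fst_comp m') ((P _ (H.obj x).hom).whiskerRight_fst_heq γ)
    have h₁ : s.map ((γ ▷ mapHom c P (ζ.app x)) ▷ (P _ C.hom).fst) ≍
        (transposeApp c P σ x).map (γ ▷ (P _ (H.obj x).hom).fst) :=
      (functor_map_heq s (comp_mapHom_fst c P _ _) (comp_mapHom_fst c P _ _)
        (whiskerRight_mapHom_fst c P _ γ)).trans (hmap _)
    refine (FibreExp.app_congr (hobj' m) (hobj' m') h₁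
      (comp_mapHom_snd_of_isTight c P (ht x) m) (comp_mapHom_snd_of_isTight c P (ht x) m')
      (whiskerRight_mapHom_snd_of_isTight c P (ht x) γ) _ _
      ((P _ (H.obj x).hom).comp_fst_comp m) ((P _ (H.obj x).hom).comp_fst_comp m') _ hl).trans ?_
    exact functor_map_heq (cobApp c P σ x) (hpair m) (hpair m')
      ((P _ (H.obj x).hom).ofCatPullback_map_heq _ γ rfl rfl rfl rfl HEq.rfl HEq.rfl)
  · refine (HomCocone.restrict_cell_heq (domCob c P ζ) S f m).trans ?_
    have e₁ : (m ≫ mapHom c P (H.map f) ≫ mapHom c P (ζ.app y)) =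
      (m ≫ mapHom c P (H.map f)) ≫ mapHom c P (ζ.app y) := (Strict.assoc _ _ _).symm
    have e₂ : (m ≫ mapHom c P (H.map f) ≫ mapHom c P (ζ.app y)) ≫ (P _ C.hom).fst =
        (m ≫ (P _ (H.obj x).hom).fst) ≫ (H.map f).map ≫ (ζ.app y).map := by
      rw [e₁, comp_mapHom_fst, comp_mapHom_fst, Strict.assoc]
    have e₃ : (m ≫ mapHom c P (H.map f) ≫ mapHom c P (ζ.app y)) ≫ (P _ C.hom).snd =
        (m ≫ mapHom c P (H.map f)) ≫ (P _ (H.obj y).hom).snd := by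
      rw [e₁]; exact comp_mapHom_snd_of_isTight c P (ht y) _
    have h₁ : s.map ((m ◁ domCobCell c P ζ f) ▷ (P _ C.hom).fst) ≍
        transposeCell c P σ f (m ≫ (P _ (H.obj x).hom).fst) := by
      refine (functor_map_heq s (comp_mapHom_fst c P _ _) e₂ ?_).trans (hcell f _)
      exact (whiskerLeft_domCobCell_fst c P ζ f m).trans
        (whiskerLeft_heq rfl rfl rfl (domFunctor_cell_heq ζ f).symm)
    have h₂ : s.obj ((m ≫ mapHom c P (H.map f) ≫ mapHom c P (ζ.app y)) ≫ (P _ C.hom).fst) =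
        (transposeApp c P σ y).obj ((m ≫ (P _ (H.obj x).hom).fst) ≫ (H.map f).map) :=
      (congrArg s.obj (e₂.trans (Strict.assoc _ _ _).symm)).trans (hobj _)
    have h₃ : ((m ≫ mapHom c P (H.map f)) ≫ (P _ (H.obj y).hom).snd) ≫ τ =
        ((m ≫ (P _ (H.obj x).hom).fst) ≫ (H.map f).map) ≫ (H.obj y).hom := by
      rw [(P _ (H.obj y).hom).comp_fst_comp, comp_mapHom_fst]
    have hl : (postcompFunctor T τ).IsHomLift
        (LaxSlice.slide (H.map f) (m ≫ (P _ (H.obj x).hom).fst)) (slideMap c P (H.map f) m) :=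
      isHomLift_of_heq ((P _ (H.obj x).hom).comp_fst_comp m) h₃ (slide_map_over c P (H.map f) m)
    -- The first projection of the structure 2-cell is sent by `s` to the transposed cell of σ, and
    -- its second projection is the cocartesian lift. Untransposing thus evaluates the transposed
    -- cell at that lift, where it equals `σ.cell f m`.
    have h₄ : S.map (m ◁ domCobCell c P ζ f) ≍
        (transposeCell c P σ f (m ≫ (P _ (H.obj x).hom).fst)).app _ h₃ _ hl :=
      FibreExp.app_congr (hobj' m) h₂ h₁ (comp_mapHom_snd_of_isTight c P (ht x) m) e₃
        (whiskerLeft_domCobCell_snd c P ζ ht f m) _ _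
        ((P _ (H.obj x).hom).comp_fst_comp m) h₃ _ hl
    refine (functor_map_heq S rfl rfl
      (whiskerLeft_heq rfl rfl rfl (domCob_cell_heq c P ζ f))).trans (h₄.trans ?_)
    exact cobCell_liftCell_slideMap c P σ f m _ h₃ hl

/-- Because `ζ.app x` is tight, a pair whose first entry factors through it is the image under `τ^*
(ζ.app x)` of a pair over the domain of `H.obj x`, with the same entry in `E`. On such images `s`
and `s'` agree by hypothesis. -/
theorem map_pairMap_heq (ht : ∀ x, LaxSlice.IsTight (ζ.app x)) {X : Type v₃} [Category.{w₃} X]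
    {s s' : (T ⟶ (P _ C.hom).pt) ⥤ X}
    (hs : HomCocone.restrict T (domCob c P ζ) s = HomCocone.restrict T (domCob c P ζ) s')
    {x : Groth W} {d d' : T ⟶ (H.obj x).dom} {e e' : T ⟶ E}
    (h : e ≫ τ = (d ≫ (ζ.app x).map) ≫ C.hom) (h' : e' ≫ τ = (d' ≫ (ζ.app x).map) ≫ C.hom)
    (η : d ⟶ d') (t : e ⟶ e')
    (hl : (postcompFunctor T τ).IsHomLift ((η ▷ (ζ.app x).map) ▷ C.hom) t) :
    s.map (pairMap P h h' (η ▷ (ζ.app x).map) t hl) ≍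
      s'.map (pairMap P h h' (η ▷ (ζ.app x).map) t hl) := by
  have h₁ : e ≫ τ = d ≫ (H.obj x).hom := h.trans ((ht x).comp_hom d)
  have h₁' : e' ≫ τ = d' ≫ (H.obj x).hom := h'.trans ((ht x).comp_hom d')
  have hl' : (postcompFunctor T τ).IsHomLift (η ▷ (H.obj x).hom) t := by
    refine isHomLift_of_heq h₁ h₁' ((map_heq_of_isHomLift hl).trans ?_)
    obtain ⟨h₂, -⟩ := ht x
    exact ((whiskerRight_heq rfl rfl h₂ HEq.rfl).trans (whiskerRight_comp_heq _ _ _)).symm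
  have key := pairMap_whiskerRight_of_isTight c P (ht x) h₁ h₁' h h' η t hl' hl
  have e₁ := (pair_comp_mapHom_of_isTight c P (ht x) h₁ h).symm
  have e₂ := (pair_comp_mapHom_of_isTight c P (ht x) h₁' h').symm
  have happ := congrArg (fun σ : HomCocone _ _ _ => σ.app x) hs
  exact (functor_map_heq s e₁ e₂ key).trans ((map_heq_of_functor_eq happ
    (pairMap P h₁ h₁' η t hl')).trans (functor_map_heq s' e₁ e₂ key).symm)

theorem obj_pair_eq (ht : ∀ x, LaxSlice.IsTight (ζ.app x)) {X : Type v₃} [Category.{w₃} X]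
    {s s' : (T ⟶ (P _ C.hom).pt) ⥤ X}
    (hs : HomCocone.restrict T (domCob c P ζ) s = HomCocone.restrict T (domCob c P ζ) s')
    {x : Groth W} {d : T ⟶ (H.obj x).dom} {e : T ⟶ E}
    (h : e ≫ τ = (d ≫ (ζ.app x).map) ≫ C.hom) :
    s.obj (pair P C (d ≫ (ζ.app x).map) e h) = s'.obj (pair P C (d ≫ (ζ.app x).map) e h) := by
  have e₁ := (pair_comp_mapHom_of_isTight c P (ht x) (h.trans ((ht x).comp_hom d)) h).symm
  have happ := congrArg (fun σ : HomCocone _ _ _ => σ.app x) hs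
  exact (congrArg s.obj e₁).trans ((CategoryTheory.Functor.congr_obj happ _).trans
    (congrArg s'.obj e₁.symm))

/-- A morphism of the pullback over a structure 2-cell of ζ factors as the structure 2-cell of `τ^*
∘ ζ`, whose part in `E` is the cocartesian lift, followed by the image of a lift cell. The values of
a functor on both factors are determined by its restriction. -/
theorem pairMap_cell_heq (ht : ∀ x, LaxSlice.IsTight (ζ.app x)) {x y : Groth W} (f : x ⟶ y)
    {d : T ⟶ (H.obj x).dom} {e e' : T ⟶ E} (h₁ : e ≫ τ = d ≫ (H.obj x).hom)
    (h₁' : e' ≫ τ = (d ≫ (H.map f).map) ≫ (H.obj y).hom)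
    (h : e ≫ τ = (d ≫ (ζ.app x).map) ≫ C.hom)
    (h' : e' ≫ τ = (d ≫ (H.map f).map ≫ (ζ.app y).map) ≫ C.hom)
    (δ : d ≫ (ζ.app x).map ⟶ d ≫ (H.map f).map ≫ (ζ.app y).map) (hδ : δ = d ◁ (ζ.cell f).cell)
    (t : e ⟶ e') (hl : (postcompFunctor T τ).IsHomLift (δ ▷ C.hom) t)
    (hl' : (postcompFunctor T τ).IsHomLift (LaxSlice.slide (H.map f) d) t) :
    pairMap P h h' δ t hl ≍ HomCocone.slide (domCob c P ζ) f (pair P _ d e h₁) ≫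
      liftCell c P (H.map f) h₁ h₁' t hl' ▷ mapHom c P (ζ.app y) := by
  have hm := pair_fst P d e h₁
  have hm' := pair_snd P d e h₁
  have hx := comp_mapHom_fst c P (ζ.app x) (pair P _ d e h₁)
  have hx' := comp_mapHom_snd_of_isTight c P (ht x) (pair P _ d e h₁)
  have hf := comp_mapHom_fst c P (H.map f) (pair P _ d e h₁)
  have hy := comp_mapHom_fst c P (ζ.app y) (pair P _ d e h₁ ≫ mapHom c P (H.map f))
  have hy' := comp_mapHom_snd_of_isTight c P (ht y) (pair P _ d e h₁ ≫ mapHom c P (H.map f))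
  have hz := comp_mapHom_fst c P (ζ.app y) (pair P _ (d ≫ (H.map f).map) e' h₁')
  have hz' := comp_mapHom_snd_of_isTight c P (ht y) (pair P _ (d ≫ (H.map f).map) e' h₁')
  have hs : HomCocone.slide (domCob c P ζ) f (pair P _ d e h₁) ≍
      pair P _ d e h₁ ◁ domCobCell c P ζ f :=
    (HomCocone.slide_heq _ f _).trans (whiskerLeft_heq rfl rfl rfl (domCob_cell_heq c P ζ f))
  have hassoc : (pair P _ d e h₁ ≫ mapHom c P (H.map f)) ≫ mapHom c P (ζ.app y) =
      pair P _ d e h₁ ≫ mapHom c P (H.map f) ≫ mapHom c P (ζ.app y) := Strict.assoc _ _ _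
  refine (P _ C.hom).ofCatPullback_map_heq (a := CatPullback.mk (d ≫ (ζ.app x).map) e h)
    (b := CatPullback.mk (d ≫ (H.map f).map ≫ (ζ.app y).map) e' h') (CatPullback.Hom.mk δ t hl)
    _ (hx.trans (congrArg (· ≫ _) hm)) (hx'.trans hm')
    (hz.trans ((congrArg (· ≫ _) (pair_fst P _ _ _)).trans (Strict.assoc _ _ _)))
    (hz'.trans (pair_snd P _ _ _)) ?_ ?_
  · refine (heq_of_eq (Bicategory.comp_whiskerRight _ _ _)).trans ?_
    refine comp_heq_of_heq_id (hx.trans (congrArg (· ≫ _) hm)) ?_ ?_ ?_ ?_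
    · exact hy.trans ((congrArg (· ≫ _) (hf.trans (congrArg (· ≫ _) hm))).trans
        (Strict.assoc _ _ _))
    · exact hy.trans ((congrArg (· ≫ _) (hf.trans ((congrArg (· ≫ _) hm).trans
        (pair_fst P _ _ _).symm))).trans hz.symm)
    · refine (whiskerRight_heq rfl hassoc rfl hs).trans ?_
      refine (whiskerLeft_domCobCell_fst c P ζ f _).trans ?_
      exact (whiskerLeft_heq hm rfl rfl HEq.rfl).trans (heq_of_eq hδ.symm)
    · refine (whiskerRight_mapHom_fst c P (ζ.app y) _).trans ?_
      refine (whiskerRight_heq (hf.trans (congrArg (· ≫ _) hm)) (pair_fst P _ _ _) rfl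
        (liftCell_fst c P (H.map f) h₁ h₁' t hl')).trans ?_
      rw [Bicategory.id_whiskerRight]
      exact congr_arg_heq (fun z => 𝟙 z) (hy.trans (congrArg (· ≫ _)
        (hf.trans (congrArg (· ≫ _) hm)))).symm
  · refine (heq_of_eq (Bicategory.comp_whiskerRight _ _ _)).trans ?_
    refine HEq.trans ?_ (liftCell_snd c P (H.map f) h₁ h₁' t hl')
    refine heq_comp hx' hy' hz' ?_ ?_
    · exact (whiskerRight_heq rfl hassoc rfl hs).trans (whiskerLeft_domCobCell_snd c P ζ ht f _)
    · exact whiskerRight_mapHom_snd_of_isTight c P (ht y) _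

/-- The transposes of `s` and `s'` are functors on `T ⟶ C.dom`, where injectivity for the domain of
ζ applies. They agree on morphisms of the form `η ▷ (ζ.app x).map` by `map_pairMap_heq` and on
structure 2-cells by `pairMap_cell_heq`. -/
theorem restrict_domCob_injective (hζ : HomUniversal T (ζ.map (LaxSlice.domFunctor K B)))
    (ht : ∀ x, LaxSlice.IsTight (ζ.app x)) {X : Type v} [Category.{v} X]
    {s s' : (T ⟶ (P _ C.hom).pt) ⥤ X}
    (hs : HomCocone.restrict T (domCob c P ζ) s = HomCocone.restrict T (domCob c P ζ) s') :
    s = s' := by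
  have hG : CatPullback.transpose ((P _ C.hom).ofCatPullback T ⋙ s) =
      CatPullback.transpose ((P _ C.hom).ofCatPullback T ⋙ s') := by
    have hobj : ∀ (x : Groth W) (d : T ⟶ (H.obj x).dom),
        (CatPullback.transpose ((P _ C.hom).ofCatPullback T ⋙ s)).obj (d ≫ (ζ.app x).map) =
          (CatPullback.transpose ((P _ C.hom).ofCatPullback T ⋙ s')).obj
            (d ≫ (ζ.app x).map) := by
      intro x d
      refine FibreExp.obj_ext rfl (fun e h h' => obj_pair_eq c P ht hs h)
        (fun {e e'} h h' h₁ h₁' t hl hl' => ?_)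
      have hid : 𝟙 (d ≫ (ζ.app x).map) = 𝟙 d ▷ (ζ.app x).map :=
        (Bicategory.id_whiskerRight _ _).symm
      have hl₂ : (postcompFunctor T τ).IsHomLift (𝟙 (d ≫ (ζ.app x).map) ▷ C.hom) t :=
        isHomLift_id_whiskerRight hl
      -- The transpose acts on the fibre through an identity 2-cell, whereas the lemma speaks of a
      -- whiskered one. The 2-cell is generalized to `θ` because the proof that `t` is a lift
      -- depends on it.
      have key : ∀ (θ : d ≫ (ζ.app x).map ⟶ d ≫ (ζ.app x).map) (hθ : θ = 𝟙 d ▷ (ζ.app x).map)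
          (hl₃ : (postcompFunctor T τ).IsHomLift (θ ▷ C.hom) t),
          s.map (pairMap P h h' θ t hl₃) ≍ s'.map (pairMap P h h' θ t hl₃) := by
        rintro θ rfl hl₃
        exact map_pairMap_heq c P ht hs h h' (𝟙 d) t hl₃
      exact key _ hid hl₂
    refine hζ.functor_ext (fun x => CategoryTheory.Functor.hext (hobj x) (fun d d' η => ?_))
      (fun {x y} f d => ?_)
    · refine FibreExp.hom_heq (hobj x d) (hobj x d') HEq.rfl ?_
      intro e e' h h' h₁ h₁' t hl hl'
      exact map_pairMap_heq c P ht hs h h' η t hl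
    · have e₁ : d ≫ (H.map f).map ≫ (ζ.app y).map = (d ≫ (H.map f).map) ≫ (ζ.app y).map :=
        (Strict.assoc _ _ _).symm
      refine FibreExp.hom_heq (hobj x d) ?_ HEq.rfl ?_
      · exact (congrArg _ e₁).trans ((hobj y _).trans (congrArg _ e₁.symm))
      · intro e e' h h' h₁ h₁' t hl hl'
        have k : e ≫ τ = d ≫ (H.obj x).hom := h.trans ((ht x).comp_hom d)
        have k' : e' ≫ τ = (d ≫ (H.map f).map) ≫ (H.obj y).hom :=
          h'.trans ((congrArg (· ≫ C.hom) e₁).trans ((ht y).comp_hom _))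
        have hδ : d ◁ (ζ.map (LaxSlice.domFunctor K B)).cell f = d ◁ (ζ.cell f).cell :=
          congrArg (d ◁ ·) (eq_of_heq (domFunctor_cell_heq ζ f))
        have kl : (postcompFunctor T τ).IsHomLift (LaxSlice.slide (H.map f) d) t := by
          refine isHomLift_of_heq k k' ((map_heq_of_isHomLift hl).trans ?_)
          refine HEq.trans ?_ (LaxSlice.whiskerLeft_cell_whiskerRight_heq (ht x) (ht y)
            (ζ.cell f) d)
          exact whiskerRight_heq rfl rfl rfl (heq_of_eq hδ)
        have key := pairMap_cell_heq c P ht f k k' h h' _ hδ t hl kl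
        have o₁ := (pair_comp_mapHom_of_isTight c P (ht x) k h).symm
        have o₂ : pair P C (d ≫ (H.map f).map ≫ (ζ.app y).map) e' h' =
            pair P _ (d ≫ (H.map f).map) e' k' ≫ mapHom c P (ζ.app y) :=
          (pair_congr P e₁ h' (h'.trans (congrArg (· ≫ C.hom) e₁))).trans
            (pair_comp_mapHom_of_isTight c P (ht y) k'
              (h'.trans (congrArg (· ≫ C.hom) e₁))).symm
        have happ : ∀ z, postcompFunctor T (mapHom c P (ζ.app z)) ⋙ s =
            postcompFunctor T (mapHom c P (ζ.app z)) ⋙ s' := fun z =>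
          congrArg (fun σ : HomCocone _ _ _ => σ.app z) hs
        have hc := HomCocone.cell_heq_of_eq hs f (pair P _ d e k)
        refine (functor_map_heq s o₁ o₂ key).trans
          (HEq.trans ?_ (functor_map_heq s' o₁ o₂ key).symm)
        refine (heq_of_eq (s.map_comp _ _)).trans (HEq.trans ?_ (heq_of_eq (s'.map_comp _ _).symm))
        exact heq_comp (CategoryTheory.Functor.congr_obj (happ x) _)
          (CategoryTheory.Functor.congr_obj (happ y) _)
          (CategoryTheory.Functor.congr_obj (happ y) _) hc (map_heq_of_functor_eq (happ y) _)
  -- A functor on the pullback is recovered from its transpose: its value at `φ` is the component at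
  -- `φ.right` of the image of `φ.left`.
  have hS : (P _ C.hom).ofCatPullback T ⋙ s = (P _ C.hom).ofCatPullback T ⋙ s' := by
    refine CategoryTheory.Functor.hext (fun a => ?_) (fun a b φ => ?_)
    · exact FibreExp.obj_congr (CategoryTheory.Functor.congr_obj hG a.left) rfl a.w a.w
    · exact FibreExp.app_congr (CategoryTheory.Functor.congr_obj hG a.left)
        (CategoryTheory.Functor.congr_obj hG b.left) (map_heq_of_functor_eq hG φ.left) rfl rfl
        (HEq.refl φ.right) a.w b.w a.w b.w φ.w φ.w
  have e := (P _ C.hom).toCatPullback_ofCatPullback (T := T)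
  calc s = ((P _ C.hom).toCatPullback T ⋙ (P _ C.hom).ofCatPullback T) ⋙ s := by rw [e]; rfl
    _ = ((P _ C.hom).toCatPullback T ⋙ (P _ C.hom).ofCatPullback T) ⋙ s' :=
      congrArg ((P _ C.hom).toCatPullback T ⋙ ·) hS
    _ = s' := by rw [e]; rfl

end ChangeOfBaseUniversal

/-- Change of base along a split opfibration preserves universality for the hom-categories out of
`T`. -/
theorem HomUniversal.changeOfBase {K : Type u} [Bicategory.{v, v} K] [Strict K]
    {T : K} {A : Type u₁} [Bicategory.{w₁, v₁} A] {W : StrictPseudofunctor Aᵒᵖ Cat.{v₂, u₂}}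
    {E B : K} {τ : E ⟶ B} (c : SplitOpfibration τ)
    (P : ∀ (X : K) (F : X ⟶ B), TwoPullback F τ)
    {H : StrictPseudofunctor (Groth W) (LaxSlice K B)} {C : LaxSlice K B}
    {ζ : OplaxNormalCocone H C}
    (hζ : HomUniversal T (ζ.map (LaxSlice.domFunctor K B)))
    (ht : ∀ x, LaxSlice.IsTight (ζ.app x))
    (hH : ∀ {x y : Groth W} (f : x ⟶ y), Groth.IsCleavage f → LaxSlice.IsTight (H.map f)) :
    HomUniversal T ((ζ.map (changeOfBase c P)).map (LaxSlice.domFunctor K E)) := by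
  have := c.isOpfibration T
  exact fun X _ => ⟨fun s s' hs => restrict_domCob_injective c P hζ ht hs,
    fun σ => exists_restrict_domCob c P hζ ht hH σ⟩

end TwoCat

/-! ### Universal 2-cocones in the lax slice -/

namespace TwoCat

namespace OplaxNormalCocone

variable {A : Type u₁} [Bicategory.{w₁, v₁} A] {W : StrictPseudofunctor Aᵒᵖ Cat.{v₂, u₂}}
  {S : Type u} [Bicategory.{w, v} S] [Strict S] {D : StrictPseudofunctor (Groth W) S} {C : S}

theorem ext_of_heq {σ ρ : OplaxNormalCocone D C} (h : ∀ x, σ.app x = ρ.app x)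
    (h' : ∀ {x y : Groth W} (f : x ⟶ y), σ.cell f ≍ ρ.cell f) : σ = ρ := by
  obtain ⟨a, b⟩ := σ
  obtain ⟨a', b'⟩ := ρ
  obtain rfl : a = a' := funext h
  obtain rfl : @b = @b' := by
    funext x y f
    exact eq_of_heq (h' f)
  rfl

theorem cell_heq_of_eq {σ ρ : OplaxNormalCocone D C} (h : σ = ρ) {x y : Groth W} (f : x ⟶ y) :
    σ.cell f ≍ ρ.cell f := by
  subst h; rfl

theorem postcompObj_cell_heq (ζ : OplaxNormalCocone D C) {Q : S} (q : C ⟶ Q) {x y : Groth W}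
    (f : x ⟶ y) : (ζ.postcompObj q).cell f ≍ ζ.cell f ▷ q := by
  change ζ.cell f ▷ q ≫ (α_ (D.map f) (ζ.app y) q).hom ≍ _
  rw [associator_hom]
  exact comp_eqToHom_heq _ _

theorem postcompObj_eq_of_heq {ζ : OplaxNormalCocone D C} {Q : S} {q : C ⟶ Q}
    {ρ : OplaxNormalCocone D Q} (h : ∀ x, ζ.app x ≫ q = ρ.app x)
    (h' : ∀ {x y : Groth W} (f : x ⟶ y), ζ.cell f ▷ q ≍ ρ.cell f) : ζ.postcompObj q = ρ :=
  ext_of_heq h fun f => (ζ.postcompObj_cell_heq q f).trans (h' f)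

theorem app_of_postcompObj_eq {ζ : OplaxNormalCocone D C} {Q : S} {q : C ⟶ Q}
    {ρ : OplaxNormalCocone D Q} (h : ζ.postcompObj q = ρ) (x : Groth W) :
    ζ.app x ≫ q = ρ.app x := congrArg (fun σ => σ.app x) h

theorem cell_of_postcompObj_eq {ζ : OplaxNormalCocone D C} {Q : S} {q : C ⟶ Q}
    {ρ : OplaxNormalCocone D Q} (h : ζ.postcompObj q = ρ) {x y : Groth W} (f : x ⟶ y) :
    ζ.cell f ▷ q ≍ ρ.cell f :=
  (ζ.postcompObj_cell_heq q f).symm.trans (cell_heq_of_eq h f)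

namespace IsUniversal

variable {ζ : OplaxNormalCocone D C} {Q : S}

theorem cell_ext (hζ : ζ.IsUniversal) {q q' : C ⟶ Q} {η θ : q ⟶ q'}
    (h : ∀ x, ζ.app x ◁ η = ζ.app x ◁ θ) : η = θ := by
  have := (hζ Q).2.2
  exact (ζ.postcomp Q).map_injective (OplaxNormalCocone.Hom.ext (funext h))

theorem exists_cell (hζ : ζ.IsUniversal) {q q' : C ⟶ Q}
    (a : ∀ x, ζ.app x ≫ q ⟶ ζ.app x ≫ q')
    (ha : ∀ {x y : Groth W} (f : x ⟶ y), (ζ.postcompObj q).cell f ≫ D.map f ◁ a y =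
      a x ≫ (ζ.postcompObj q').cell f) :
    ∃ η : q ⟶ q', ∀ x, ζ.app x ◁ η = a x := by
  have := (hζ Q).2.1
  obtain ⟨η, hη⟩ := (ζ.postcomp Q).map_surjective
    (OplaxNormalCocone.Hom.mk a ha : (ζ.postcomp Q).obj q ⟶ (ζ.postcomp Q).obj q')
  exact ⟨η, fun x => congrArg (fun Γ : OplaxNormalCocone.Hom _ _ => Γ.app x) hη⟩

theorem of_bijective (hinj : ∀ {Q : S} {q q' : C ⟶ Q}, ζ.postcompObj q = ζ.postcompObj q' → q = q')
    (hsurj : ∀ {Q : S} (ρ : OplaxNormalCocone D Q), ∃ q, ζ.postcompObj q = ρ)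
    (hfull : ∀ {Q : S} {q q' : C ⟶ Q} (Γ : OplaxNormalCocone.Hom (ζ.postcompObj q) (ζ.postcompObj q')),
      ∃ η : q ⟶ q', ∀ x, ζ.app x ◁ η = Γ.app x)
    (hfaithful : ∀ {Q : S} {q q' : C ⟶ Q} {η θ : q ⟶ q'},
      (∀ x, ζ.app x ◁ η = ζ.app x ◁ θ) → η = θ) : ζ.IsUniversal := by
  refine fun Q => ⟨⟨fun q q' h => hinj h, fun ρ => hsurj ρ⟩, ⟨fun {q q'} Γ => ?_⟩,
    ⟨fun {q q' η θ} h => hfaithful fun x => ?_⟩⟩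
  · obtain ⟨η, hη⟩ := hfull Γ
    exact ⟨η, OplaxNormalCocone.Hom.ext (funext hη)⟩
  · exact congrArg (fun Γ : OplaxNormalCocone.Hom _ _ => Γ.app x) h

end IsUniversal

end OplaxNormalCocone

section LaxSliceUniversal

variable {K : Type u} [Bicategory.{v, v} K] [Strict K] {M : K}

namespace LaxSlice

theorem hom₂_heq {X Y : LaxSlice K M} {f f' g g' : X ⟶ Y} (hf : f = f') (hg : g = g')
    {δ : f ⟶ g} {δ' : f' ⟶ g'} (h : δ.cell ≍ δ'.cell) : δ ≍ δ' := by
  subst hf hg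
  exact heq_of_eq (hom₂_ext (eq_of_heq h))

theorem comp_cell_heq_of_isTight {X Y Z : LaxSlice K M} {a : X ⟶ Y} (ha : IsTight a) (g : Y ⟶ Z) :
    (a ≫ g).cell ≍ a.map ◁ g.cell := by
  obtain ⟨h, e⟩ := ha
  rw [comp_cell, e, associator_inv]
  exact (eqToHom_comp_heq _ _).trans (comp_eqToHom_heq (a.map ◁ g.cell) _)

theorem comp_cell_heq {X Y Z : LaxSlice K M} (f : X ⟶ Y) (g : Y ⟶ Z) :
    (f ≫ g).cell ≍ f.cell ≫ f.map ◁ g.cell := by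
  rw [comp_cell, associator_inv, ← Category.assoc f.cell]
  exact comp_eqToHom_heq (f.cell ≫ f.map ◁ g.cell) _

end LaxSlice

variable {A : Type u₁} [Bicategory.{w₁, v₁} A] {W : StrictPseudofunctor Aᵒᵖ Cat.{v₂, u₂}}
  {H : StrictPseudofunctor (Groth W) (LaxSlice K M)} {C : LaxSlice K M}
  {ζ : OplaxNormalCocone H C}

namespace LaxSlice

theorem map_domFunctor_cell {Q : LaxSlice K M} (ρ : OplaxNormalCocone H Q) {x y : Groth W}
    (f : x ⟶ y) : (ρ.map (domFunctor K M)).cell f = (ρ.cell f).cell :=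
  eq_of_heq (ρ.map_cell_heq (domFunctor K M) f)

/-- The underlying morphism `q` comes from the universal property of the domain. Its filling is a
2-cell from `C.hom` to `q ≫ Q.hom`, obtained from the 2-dimensional universal property with target
`M`: the fillings of the components of ρ form the required modification. -/
theorem exists_postcompObj_eq (ht : ∀ x, IsTight (ζ.app x))
    (hζ : (ζ.map (domFunctor K M)).IsUniversal) {Q : LaxSlice K M} (ρ : OplaxNormalCocone H Q) :
    ∃ q, ζ.postcompObj q = ρ := by
  obtain ⟨q, hq⟩ : ∃ q : C.dom ⟶ Q.dom, (ζ.map (domFunctor K M)).postcompObj q =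
    ρ.map (domFunctor K M) := (hζ Q.dom).1.2 _
  have hq₁ : ∀ x, (ζ.app x).map ≫ q = (ρ.app x).map :=
    fun x => OplaxNormalCocone.app_of_postcompObj_eq hq x
  have hq₂ : ∀ {x y : Groth W} (f : x ⟶ y), (ζ.cell f).cell ▷ q ≍ (ρ.cell f).cell :=
    fun {x y} f => (whiskerRight_heq rfl rfl rfl (heq_of_eq (map_domFunctor_cell ζ f).symm)).trans
      ((OplaxNormalCocone.cell_of_postcompObj_eq hq f).trans
        (heq_of_eq (map_domFunctor_cell ρ f)))
  have h₁ : ∀ x, (ζ.app x).map ≫ C.hom = (H.obj x).hom := fun x => (ht x).choose.symm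
  have h₂ : ∀ x, (ζ.app x).map ≫ q ≫ Q.hom = (ρ.app x).map ≫ Q.hom := fun x => by
    rw [← Strict.assoc, hq₁]
  -- The filling of `ρ.app x`, with source rewritten by tightness of `ζ.app x` and target by `hq₁`.
  let a : ∀ x, (ζ.app x).map ≫ C.hom ⟶ (ζ.app x).map ≫ q ≫ Q.hom := fun x =>
    eqToHom (h₁ x) ≫ (ρ.app x).cell ≫ eqToHom (h₂ x).symm
  have ha : ∀ x, a x ≍ (ρ.app x).cell := fun x =>
    (eqToHom_comp_heq _ _).trans (comp_eqToHom_heq _ _)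
  obtain ⟨φ, hφ⟩ := hζ.exists_cell (Q := M) (q := C.hom) (q' := q ≫ Q.hom) a (fun {x y} f => by
    have e₁ : ((ζ.map (domFunctor K M)).postcompObj C.hom).cell f ≍ (H.map f).cell :=
      (OplaxNormalCocone.postcompObj_cell_heq _ _ f).trans
        ((whiskerRight_heq rfl rfl rfl (heq_of_eq (map_domFunctor_cell ζ f))).trans
          (cell_whiskerRight_heq_of_isTight (ht x) (ht y) (ζ.cell f)))
    have e₂ : ((ζ.map (domFunctor K M)).postcompObj (q ≫ Q.hom)).cell f ≍
        (ρ.cell f).cell ▷ Q.hom := by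
      refine (OplaxNormalCocone.postcompObj_cell_heq _ _ f).trans
        ((whiskerRight_heq rfl rfl rfl (heq_of_eq (map_domFunctor_cell ζ f))).trans ?_)
      refine (whiskerRight_comp_heq _ _ _).trans (whiskerRight_heq (hq₁ x) ?_ rfl (hq₂ f))
      exact (Strict.assoc _ _ _).trans (congrArg ((H.map f).map ≫ ·) (hq₁ y))
    refine eq_of_heq (HEq.trans (b := (H.map f).cell ≫ (H.map f).map ◁ (ρ.app y).cell) ?_
      (HEq.trans (b := (ρ.app x).cell ≫ (ρ.cell f).cell ▷ Q.hom) ?_ ?_))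
    · exact heq_comp (h₁ x) (congrArg ((H.map f).map ≫ ·) (h₁ y))
        (congrArg ((H.map f).map ≫ ·) (h₂ y)) e₁ (whiskerLeft_heq rfl (h₁ y) (h₂ y) (ha y))
    -- The modification law is the condition that `ρ.cell f` is a 2-cell of the lax slice.
    · exact (comp_cell_heq (H.map f) (ρ.app y)).symm.trans (heq_of_eq (hom₂_w (ρ.cell f)).symm)
    · refine heq_comp (h₁ x).symm (h₂ x).symm ?_ (ha x).symm e₂.symm
      exact ((congrArg ((H.map f).map ≫ ·) (h₂ y)).trans (Strict.assoc _ _ _).symm).symm)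
  have happ : ∀ x, ζ.app x ≫ (Hom.mk q φ : C ⟶ Q) = ρ.app x := fun x =>
    hom_ext' (hq₁ x) ((comp_cell_heq_of_isTight (ht x) _).trans
      ((heq_of_eq (hφ x)).trans (ha x)))
  refine ⟨Hom.mk q φ, OplaxNormalCocone.postcompObj_eq_of_heq happ fun {x y} f => ?_⟩
  refine hom₂_heq (happ x) ?_ (hq₂ f)
  exact (Strict.assoc _ _ _).trans (congrArg (H.map f ≫ ·) (happ y))

/-- The underlying morphisms agree by universality of the domain. The fillings are 2-cells out of
`C.hom`, hence can be compared after whiskering with each `ζ.app x`; by tightness this gives the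
filling of the composite with `ζ.app x`. -/
theorem postcompObj_injective (ht : ∀ x, IsTight (ζ.app x))
    (hζ : (ζ.map (domFunctor K M)).IsUniversal) {Q : LaxSlice K M} {q q' : C ⟶ Q}
    (h : ζ.postcompObj q = ζ.postcompObj q') : q = q' := by
  have happ : ∀ x, ζ.app x ≫ q = ζ.app x ≫ q' :=
    fun x => congrArg (fun σ : OplaxNormalCocone _ _ => σ.app x) h
  have hcell : ∀ {x y : Groth W} (f : x ⟶ y), ζ.cell f ▷ q ≍ ζ.cell f ▷ q' := fun f =>
    (OplaxNormalCocone.cell_of_postcompObj_eq h f).trans (ζ.postcompObj_cell_heq q' f)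
  have hq : q.map = q'.map := by
    refine (hζ Q.dom).1.1 (OplaxNormalCocone.postcompObj_eq_of_heq
      (fun x => congrArg Hom.map (happ x)) fun {x y} f => ?_)
    refine HEq.trans ?_ (OplaxNormalCocone.postcompObj_cell_heq _ _ f).symm
    have e := hom₂_cell_heq (happ x) (((Strict.assoc _ _ _).trans
      (congrArg (H.map f ≫ ·) (happ y))).trans (Strict.assoc _ _ _).symm) (hcell f)
    exact (whiskerRight_heq rfl rfl rfl (heq_of_eq (map_domFunctor_cell ζ f))).trans
      (e.trans (whiskerRight_heq rfl rfl rfl (heq_of_eq (map_domFunctor_cell ζ f).symm)))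
  obtain ⟨m, φ⟩ := q
  obtain ⟨m', φ'⟩ := q'
  obtain rfl : m = m' := hq
  refine hom_ext' rfl (heq_of_eq (hζ.cell_ext (q := C.hom) (q' := m ≫ Q.hom) fun x => ?_))
  refine eq_of_heq ((comp_cell_heq_of_isTight (ht x) (Hom.mk m φ : C ⟶ Q)).symm.trans
    (HEq.trans ?_ (comp_cell_heq_of_isTight (ht x) (Hom.mk m φ' : C ⟶ Q))))
  rw [happ x]

theorem exists_whiskerLeft_eq (ht : ∀ x, IsTight (ζ.app x))
    (hζ : (ζ.map (domFunctor K M)).IsUniversal) {Q : LaxSlice K M} {q q' : C ⟶ Q}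
    (Γ : OplaxNormalCocone.Hom (ζ.postcompObj q) (ζ.postcompObj q')) :
    ∃ η : q ⟶ q', ∀ x, ζ.app x ◁ η = Γ.app x := by
  have hc : ∀ (q : C ⟶ Q) {x y : Groth W} (f : x ⟶ y),
      ((ζ.map (domFunctor K M)).postcompObj q.map).cell f = ((ζ.postcompObj q).cell f).cell :=
    fun q x y f => congrArg (fun k => k ▷ q.map ≫ (α_ (H.map f).map (ζ.app y).map q.map).hom)
      (map_domFunctor_cell ζ f)
  obtain ⟨η, hη⟩ := hζ.exists_cell (q := q.map) (q' := q'.map) (fun x => (Γ.app x).cell)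
    (fun {x y} f => by
      rw [hc, hc]
      exact congrArg Hom₂.cell (Γ.naturality f))
  -- The condition for `η` to be a 2-cell of the lax slice is an equation between 2-cells out of
  -- `C.hom`. Whiskered with `ζ.app x`, it becomes the condition on `Γ.app x`.
  have hw : q.cell ≫ η ▷ Q.hom = q'.cell := by
    refine hζ.cell_ext (q := C.hom) (q' := q'.map ≫ Q.hom) fun x => eq_of_heq ?_
    refine HEq.trans ?_ (comp_cell_heq_of_isTight (ht x) q')
    refine (heq_of_eq (Bicategory.whiskerLeft_comp _ _ _)).trans ?_
    refine HEq.trans ?_ (heq_of_eq (hom₂_w (Γ.app x)))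
    refine heq_comp (ht x).choose.symm (Strict.assoc _ _ _).symm (Strict.assoc _ _ _).symm
      (comp_cell_heq_of_isTight (ht x) q).symm ?_
    exact (whisker_assoc_heq _ _ _).symm.trans
      (whiskerRight_heq rfl rfl rfl (heq_of_eq (hη x)))
  exact ⟨Hom₂.mk η hw, fun x => hom₂_ext (hη x)⟩

/-- A 2-cocone in the lax slice with tight components is universal if its domain is. -/
theorem isUniversal_of_domFunctor (ht : ∀ x, IsTight (ζ.app x))
    (hζ : (ζ.map (domFunctor K M)).IsUniversal) : ζ.IsUniversal :=
  OplaxNormalCocone.IsUniversal.of_bijective (fun h => postcompObj_injective ht hζ h)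
    (fun ρ => exists_postcompObj_eq ht hζ ρ) (fun Γ => exists_whiskerLeft_eq ht hζ Γ)
    (fun h => hom₂_ext (hζ.cell_ext fun x => congrArg Hom₂.cell (h x)))

end LaxSlice

end LaxSliceUniversal

end TwoCat

namespace TwoCat

/-! ### Universality detected through a dense 2-functor -/

section DenseUniversal

variable {K : Type u} [Bicategory.{v, v} K] [Strict K]

/-- Whiskering with a 2-cell on the right, as a natural transformation between postcomposition
functors. -/
@[simps]
def postcompTrans (T : K) {a b : K} {q q' : a ⟶ b} (η : q ⟶ q') :
    postcompFunctor T q ⟶ postcompFunctor T q' where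
  app c := c ◁ η
  naturality _ _ φ := (whisker_exchange φ η).symm

/-- Whiskering with a 2-cell on the left, as a natural transformation between precomposition
functors. -/
@[simps]
def precompTrans {a b : K} {k k' : a ⟶ b} (δ : k ⟶ k') (Q : K) :
    precompFunctor k Q ⟶ precompFunctor k' Q where
  app c := δ ▷ c
  naturality _ _ φ := whisker_exchange δ φ

theorem natTrans_app_heq {X : Type u₁} [Category.{v₁} X] {Y : Type u₂} [Category.{v₂} Y]
    {s s' t t' : X ⥤ Y} (hs : s = t) (hs' : s' = t') {α : s ⟶ s'} {β : t ⟶ t'} (h : α ≍ β)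
    (c : X) : α.app c ≍ β.app c := by
  subst hs hs'
  rw [eq_of_heq h]

theorem natTrans_app_congr {X : Type u₁} [Category.{v₁} X] {Y : Type u₂} [Category.{v₂} Y]
    {s s' : X ⥤ Y} (α : s ⟶ s') {c c' : X} (h : c = c') : α.app c ≍ α.app c' := by
  subst h; rfl

variable {L : Type u₁} [Bicategory.{v, v} L] [Strict L] {J : StrictPseudofunctor L K}

namespace IsDense

theorem hom_ext (hJ : IsDense J) {F G : K} {f g : F ⟶ G}
    (h : ∀ l, postcompFunctor (J.obj l) f = postcompFunctor (J.obj l) g) : f = g :=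
  (hJ F G).1.1 (TwoFunctor.twoNatTrans_ext fun l => Cat.Hom.ext (h l.unop))

theorem cell_ext (hJ : IsDense J) {F G : K} {f g : F ⟶ G} {γ γ' : f ⟶ g}
    (h : ∀ (l : L) (d : J.obj l ⟶ F), d ◁ γ = d ◁ γ') : γ = γ' :=
  ((hJ F G).2 f g).1 (TwoFunctor.modification_ext fun l =>
    Cat.Hom₂.ext (NatTrans.ext (funext fun d => h l.unop d)))

theorem cell_heq (hJ : IsDense J) {F G : K} {f g f' g' : F ⟶ G} (hf : f = f') (hg : g = g')
    {γ : f ⟶ g} {γ' : f' ⟶ g'} (h : ∀ (l : L) (d : J.obj l ⟶ F), d ◁ γ ≍ d ◁ γ') : γ ≍ γ' := by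
  subst hf hg
  exact heq_of_eq (hJ.cell_ext fun l d => eq_of_heq (h l d))

theorem exists_hom (hJ : IsDense J) {F G : K} (s : ∀ l : L, (J.obj l ⟶ F) ⥤ (J.obj l ⟶ G))
    (hs : ∀ {l l' : L} (k : l ⟶ l'),
      precompFunctor (J.map k) F ⋙ s l = s l' ⋙ precompFunctor (J.map k) G)
    (hs' : ∀ {l l' : L} {k k' : l ⟶ l'} (δ : k ⟶ k') (d : J.obj l' ⟶ F),
      (s l).map (J.map₂ δ ▷ d) ≍ J.map₂ δ ▷ (s l').obj d) :
    ∃ q : F ⟶ G, ∀ l, postcompFunctor (J.obj l) q = s l := by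
  obtain ⟨q, hq⟩ := (hJ F G).1.2 (TwoNatTrans.mk (fun l => (s l.unop).toCatHom)
    (fun k => Cat.Hom.ext (hs k.unop))
    (fun {l l' k k'} δ => cat_hom₂_heq (Cat.Hom.ext (hs k.unop)) (Cat.Hom.ext (hs k'.unop))
      (fun d => hs' δ.unop2 d)))
  exact ⟨q, fun l => congrArg
    (fun t : nerveObj J F ⟶ nerveObj J G => Cat.Hom.toFunctor (TwoNatTrans.app t (op l))) hq⟩

theorem exists_cell (hJ : IsDense J) {F G : K} {f g : F ⟶ G}
    (a : ∀ l : L, postcompFunctor (J.obj l) f ⟶ postcompFunctor (J.obj l) g)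
    (ha : ∀ {l l' : L} (k : l ⟶ l') (d : J.obj l' ⟶ F),
      (a l).app (J.map k ≫ d) ≍ J.map k ◁ (a l').app d) :
    ∃ γ : f ⟶ g, ∀ (l : L) (d : J.obj l ⟶ F), (a l).app d = d ◁ γ := by
  obtain ⟨γ, hγ⟩ := ((hJ F G).2 f g).2 (TwoModification.mk
    (fun l => NatTrans.toCatHom₂ (a l.unop))
    (fun {l l'} k => cat_hom₂_heq ((nerveTrans J f).naturality k) ((nerveTrans J g).naturality k)
      (fun d => ha k.unop d)))
  exact ⟨γ, fun l d => (congrArg (fun t : nerveTrans J f ⟶ nerveTrans J g =>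
    (Cat.Hom₂.toNatTrans (TwoModification.app t (op l))).app d) hγ).symm⟩

end IsDense

variable {A : Type u₂} [Bicategory.{w₁, v₁} A]
  {W : StrictPseudofunctor Aᵒᵖ Cat.{v₂, u₃}} {D : StrictPseudofunctor (Groth W) K} {C : K}
  {ξ : OplaxNormalCocone D C}

namespace HomUniversal

open OplaxNormalCocone in
-- By density two morphisms are equal if they induce the same functors on hom-categories out of each
-- `J.obj l`; these functors are compared through their restrictions along ξ.
theorem postcompObj_injective (hξ : ∀ l : L, HomUniversal (J.obj l) ξ) (hJ : IsDense J) {Q : K}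
    {q q' : C ⟶ Q} (h : ξ.postcompObj q = ξ.postcompObj q') : q = q' := by
  have happ : ∀ x, ξ.app x ≫ q = ξ.app x ≫ q' := fun x => app_of_postcompObj_eq h x
  refine hJ.hom_ext fun l => (hξ l).functor_ext (fun x => ?_) fun {x y} f d => ?_
  · refine CategoryTheory.Functor.hext (fun d => ?_) (fun d d' η => ?_)
    · exact (Strict.assoc _ _ _).trans ((congrArg (d ≫ ·) (happ x)).trans (Strict.assoc _ _ _).symm)
    · exact (whiskerRight_comp_heq _ _ _).symm.trans
        ((whiskerRight_heq rfl rfl (happ x) HEq.rfl).trans (whiskerRight_comp_heq _ _ _))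
  · refine (whisker_assoc_heq _ _ _).trans (HEq.trans ?_ (whisker_assoc_heq _ _ _).symm)
    refine whiskerLeft_heq rfl (happ x) ?_
      ((cell_of_postcompObj_eq h f).trans (postcompObj_cell_heq _ _ _))
    rw [Strict.assoc, Strict.assoc, happ]

open HomCocone in
-- For each `l` the 2-cocone represented by ρ extends to a functor `s l` on `J.obj l ⟶ C`.
-- Uniqueness of extensions makes the family 2-natural in `l`, and density turns it into a morphism
-- `q`.
theorem exists_postcompObj_eq (hξ : ∀ l : L, HomUniversal (J.obj l) ξ) (hJ : IsDense J) {Q : K}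
    (ρ : OplaxNormalCocone D Q) : ∃ q, ξ.postcompObj q = ρ := by
  choose s hs using fun l : L => (hξ l (J.obj l ⟶ Q)).2 (ofCocone (J.obj l) ρ)
  have hobj : ∀ {l : L} {x : Groth W} (d : J.obj l ⟶ D.obj x),
      (s l).obj (d ≫ ξ.app x) = d ≫ ρ.app x := fun {l} {x} d => obj_of_restrict_eq (hs l) d
  have hmap : ∀ {l : L} {x : Groth W} {d d' : J.obj l ⟶ D.obj x} (η : d ⟶ d'),
      (s l).map (η ▷ ξ.app x) ≍ η ▷ ρ.app x := fun {l} {x} {d d'} η => map_of_restrict_eq (hs l) η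
  have hcell : ∀ {l : L} {x y : Groth W} (f : x ⟶ y) (d : J.obj l ⟶ D.obj x),
      (s l).map (d ◁ ξ.cell f) ≍ d ◁ ρ.cell f := fun {l} {x y} f d =>
    (cell_of_restrict_eq (hs l) f d).trans (slide_heq ρ f d)
  have hobj' : ∀ {l : L} {x y : Groth W} (f : x ⟶ y) (d : J.obj l ⟶ D.obj x),
      (s l).obj (d ≫ D.map f ≫ ξ.app y) = d ≫ D.map f ≫ ρ.app y := fun f d => by
    rw [← Strict.assoc, hobj, Strict.assoc]
  have hnat : ∀ {l l' : L} (k : l ⟶ l'),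
      precompFunctor (J.map k) C ⋙ s l = s l' ⋙ precompFunctor (J.map k) Q := fun {l l'} k => by
    refine (hξ l').functor_ext (fun x => ?_) fun {x y} f d => ?_
    · refine CategoryTheory.Functor.hext (fun d => ?_) (fun d d' η => ?_)
      · refine (congrArg (s l).obj (Strict.assoc _ _ _).symm).trans ((hobj _).trans ?_)
        exact (Strict.assoc _ _ _).trans (congrArg (J.map k ≫ ·) (hobj d).symm)
      · refine (functor_map_heq (s l) (Strict.assoc _ _ _).symm (Strict.assoc _ _ _).symm
          (whisker_assoc_heq _ _ _).symm).trans ((hmap _).trans ?_)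
        exact (whisker_assoc_heq _ _ _).trans
          (whiskerLeft_heq rfl (hobj d).symm (hobj d').symm (hmap η).symm)
    · refine (functor_map_heq (s l) (Strict.assoc _ _ _).symm (Strict.assoc _ _ _).symm
        (comp_whiskerLeft_heq _ _ _).symm).trans ((hcell f _).trans ?_)
      exact (comp_whiskerLeft_heq _ _ _).trans
        (whiskerLeft_heq rfl (hobj d).symm (hobj' f d).symm (hcell f d).symm)
  have hnat₂ : ∀ {l l' : L} {k k' : l ⟶ l'} (δ : k ⟶ k') (d : J.obj l' ⟶ C),
      (s l).map (J.map₂ δ ▷ d) ≍ J.map₂ δ ▷ (s l').obj d := fun {l l' k k'} δ d => by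
    -- Compatibility with 2-cells of `L` is an equality of natural transformations between functors
    -- on `J.obj l' ⟶ C`, so it may be checked on objects of the form `d ≫ ξ.app x`.
    have h : Functor.whiskerRight (precompTrans (J.map₂ δ) C) (s l) ≍
        Functor.whiskerLeft (s l') (precompTrans (J.map₂ δ) Q) :=
      (hξ l').natTrans_heq (hnat k) (hnat k') fun x d => by
        refine (functor_map_heq (s l) (Strict.assoc _ _ _).symm (Strict.assoc _ _ _).symm
          (whiskerRight_comp_heq _ _ _)).trans ((hmap _).trans ?_)
        exact (whiskerRight_comp_heq _ _ _).symm.trans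
          (whiskerRight_heq rfl rfl (hobj d).symm HEq.rfl)
    exact natTrans_app_heq (hnat k) (hnat k') h d
  obtain ⟨q, hq⟩ := hJ.exists_hom s hnat hnat₂
  have happ : ∀ x, ξ.app x ≫ q = ρ.app x := fun x => hJ.hom_ext fun l => by
    refine CategoryTheory.Functor.hext (fun d => ?_) (fun d d' η => ?_)
    · exact (Strict.assoc _ _ _).symm.trans
        ((CategoryTheory.Functor.congr_obj (hq l) _).trans (hobj d))
    · exact (whiskerRight_comp_heq _ _ _).trans
        ((map_heq_of_functor_eq (hq l) (η ▷ ξ.app x)).trans (hmap η))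
  refine ⟨q, OplaxNormalCocone.postcompObj_eq_of_heq happ fun {x y} f => ?_⟩
  refine hJ.cell_heq (happ x) ((Strict.assoc _ _ _).trans (congrArg (D.map f ≫ ·) (happ y)))
    fun l d => ?_
  exact (whisker_assoc_heq _ _ _).symm.trans
    ((map_heq_of_functor_eq (hq l) (d ◁ ξ.cell f)).trans (hcell f d))

open HomCocone in
-- The 2-dimensional analogue: `Γ` induces natural transformations between the postcomposition
-- functors at each `l`. They form a modification by uniqueness, and density turns this into a
-- 2-cell.
theorem exists_whiskerLeft_eq (hξ : ∀ l : L, HomUniversal (J.obj l) ξ) (hJ : IsDense J) {Q : K}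
    {q q' : C ⟶ Q} (Γ : OplaxNormalCocone.Hom (ξ.postcompObj q) (ξ.postcompObj q')) :
    ∃ η : q ⟶ q', ∀ x, ξ.app x ◁ η = Γ.app x := by
  let a : ∀ (l : L) (x : Groth W) (d : J.obj l ⟶ D.obj x),
      (d ≫ ξ.app x) ≫ q ⟶ (d ≫ ξ.app x) ≫ q' := fun l x d =>
    (α_ d (ξ.app x) q).hom ≫ d ◁ Γ.app x ≫ (α_ d (ξ.app x) q').inv
  have ha : ∀ (l : L) (x : Groth W) (d : J.obj l ⟶ D.obj x), a l x d ≍ d ◁ Γ.app x :=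
    fun l x d => by
      change (α_ d (ξ.app x) q).hom ≫ d ◁ Γ.app x ≫ (α_ d (ξ.app x) q').inv ≍ _
      rw [associator_hom, associator_inv]
      exact (eqToHom_comp_heq _ _).trans (comp_eqToHom_heq (d ◁ Γ.app x) _)
  have hcell : ∀ (l : L) (q : C ⟶ Q) {x y : Groth W} (f : x ⟶ y) (d : J.obj l ⟶ D.obj x),
      (restrict (J.obj l) ξ (postcompFunctor (J.obj l) q)).cell f d ≍
        d ◁ (ξ.postcompObj q).cell f := fun l q x y f d => by
    refine (restrict_cell_heq ξ (postcompFunctor (J.obj l) q) f d).trans ?_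
    exact (whisker_assoc_heq _ _ _).trans (whiskerLeft_heq rfl rfl (Strict.assoc _ _ _)
      (ξ.postcompObj_cell_heq q f).symm)
  have hassoc : ∀ (l : L) (q : C ⟶ Q) {x y : Groth W} (f : x ⟶ y) (d : J.obj l ⟶ D.obj x),
      ((d ≫ D.map f) ≫ ξ.app y) ≫ q = d ≫ D.map f ≫ ξ.app y ≫ q := fun l q x y f d => by
    simp only [Strict.assoc]
  choose α hα using fun l : L => (hξ l).exists_natTrans (s := postcompFunctor (J.obj l) q)
    (s' := postcompFunctor (J.obj l) q') (a l)
    (fun x {d d'} η => by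
      refine eq_of_heq (HEq.trans (b := η ▷ (ξ.app x ≫ q) ≫ d' ◁ Γ.app x) ?_
        (HEq.trans (b := d ◁ Γ.app x ≫ η ▷ (ξ.app x ≫ q')) ?_ ?_))
      · exact heq_comp (Strict.assoc _ _ _) (Strict.assoc _ _ _) (Strict.assoc _ _ _)
          (whiskerRight_comp_heq _ _ _).symm (ha l x d')
      · exact heq_of_eq (whisker_exchange _ _).symm
      · exact heq_comp (Strict.assoc _ _ _).symm (Strict.assoc _ _ _).symm
          (Strict.assoc _ _ _).symm (ha l x d).symm (whiskerRight_comp_heq _ _ _))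
    (fun {x y} f d => by
      have hn := congrArg (d ◁ ·) (Γ.naturality f)
      refine eq_of_heq (HEq.trans (b := d ◁ (ξ.postcompObj q).cell f ≫ d ◁ D.map f ◁ Γ.app y) ?_
        (HEq.trans (b := d ◁ Γ.app x ≫ d ◁ (ξ.postcompObj q').cell f) ?_ ?_))
      · exact heq_comp (Strict.assoc _ _ _) (hassoc l q f d) (hassoc l q' f d) (hcell l q f d)
          ((ha l y _).trans (comp_whiskerLeft_heq _ _ _))
      · refine (heq_of_eq (Bicategory.whiskerLeft_comp _ _ _).symm).trans
          ((heq_of_eq hn).trans (heq_of_eq (Bicategory.whiskerLeft_comp _ _ _)))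
      · exact heq_comp (Strict.assoc _ _ _).symm (Strict.assoc _ _ _).symm (hassoc l q' f d).symm
          (ha l x d).symm (hcell l q' f d).symm)
  have hfun : ∀ {l l' : L} (k : l ⟶ l') (q : C ⟶ Q),
      precompFunctor (J.map k) C ⋙ postcompFunctor (J.obj l) q =
        postcompFunctor (J.obj l') q ⋙ precompFunctor (J.map k) Q := fun k q =>
    CategoryTheory.Functor.hext (fun d => Strict.assoc _ _ _)
      (fun d d' η => whisker_assoc_heq _ _ _)
  obtain ⟨γ, hγ⟩ := hJ.exists_cell α (fun {l l'} k d => by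
    have h : Functor.whiskerLeft (precompFunctor (J.map k) C) (α l) ≍
        Functor.whiskerRight (α l') (precompFunctor (J.map k) Q) :=
      (hξ l').natTrans_heq (hfun k q) (hfun k q') fun x d => by
        refine (natTrans_app_congr (α l) (Strict.assoc (J.map k) d (ξ.app x)).symm).trans ?_
        refine (heq_of_eq (hα l x _)).trans ((ha l x _).trans ((comp_whiskerLeft_heq _ _ _).trans ?_))
        exact whiskerLeft_heq rfl (Strict.assoc _ _ _).symm (Strict.assoc _ _ _).symm
          ((ha l' x d).symm.trans (heq_of_eq (hα l' x d).symm))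
    exact natTrans_app_heq (hfun k q) (hfun k q') h d)
  refine ⟨γ, fun x => hJ.cell_ext fun l d => eq_of_heq ?_⟩
  exact (comp_whiskerLeft_heq _ _ _).symm.trans
    ((heq_of_eq ((hγ l _).symm.trans (hα l x d))).trans (ha l x d))

/-- If `J` is dense, then a 2-cocone is universal if it is universal for the hom-categories out of
the objects in the image of `J`. -/
theorem isUniversal (hξ : ∀ l : L, HomUniversal (J.obj l) ξ) (hJ : IsDense J) : ξ.IsUniversal := by
  refine OplaxNormalCocone.IsUniversal.of_bijective (fun h => postcompObj_injective hξ hJ h)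
    (fun ρ => exists_postcompObj_eq hξ hJ ρ) (fun Γ => exists_whiskerLeft_eq hξ hJ Γ)
    (fun {Q q q' η θ} h => hJ.cell_ext fun l c => ?_)
  have key : postcompTrans (J.obj l) η ≍ postcompTrans (J.obj l) θ :=
    (hξ l).natTrans_heq rfl rfl fun x d => by
      refine (comp_whiskerLeft_heq _ _ _).trans (HEq.trans ?_ (comp_whiskerLeft_heq _ _ _).symm)
      rw [h x]
  exact congrArg (fun t : postcompFunctor (J.obj l) q ⟶ postcompFunctor (J.obj l) q' => t.app c)
    (eq_of_heq key)

end HomUniversal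

end DenseUniversal

end TwoCat

namespace TwoCat

/-! ### Coinduced 2-presheaves -/

section Coinduced

theorem natTrans_heq_of_app {X : Type u₁} [Category.{v₁} X] {Y : Type u₂} [Category.{v₂} Y]
    {s s' t t' : X ⥤ Y} (hs : s = t) (hs' : s' = t') {α : s ⟶ s'} {β : t ⟶ t'}
    (h : ∀ c, α.app c ≍ β.app c) : α ≍ β := by
  subst hs hs'
  exact heq_of_eq (NatTrans.ext (funext fun c => eq_of_heq (h c)))

theorem functor_ext_of_app {X : Type u₁} [Category.{v₁} X] {Y : Type u₂} [Category.{v₂} Y]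
    {Z : Type u₃} [Category.{v₃} Z] {S S' : X ⥤ Y ⥤ Z} (h : ∀ x, S.obj x = S'.obj x)
    (h' : ∀ {x x' : X} (φ : x ⟶ x') (y : Y), (S.map φ).app y ≍ (S'.map φ).app y) : S = S' :=
  CategoryTheory.Functor.hext h fun x x' φ => natTrans_heq_of_app (h x) (h x') (h' φ)

variable {L : Type u₁} [Bicategory.{v, v} L] [Strict L] (l : L) (X : Type v) [Category.{v} X]

theorem postcompFunctor_id (a : L) : postcompFunctor l (𝟙 a) = 𝟭 (l ⟶ a) :=
  CategoryTheory.Functor.hext (fun f => Strict.comp_id f) (fun _ _ η => whiskerRight_id_heq η)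

theorem postcompFunctor_comp {a b c : L} (f : a ⟶ b) (g : b ⟶ c) :
    postcompFunctor l (f ≫ g) = postcompFunctor l f ⋙ postcompFunctor l g :=
  CategoryTheory.Functor.hext (fun k => (Strict.assoc k f g).symm)
    (fun _ _ η => whiskerRight_comp_heq η f g)

/-- Restriction of functors along postcomposition with `k`. -/
abbrev coindMap {a b : Lᵒᵖ} (k : a ⟶ b) :
    Cat.of ((l ⟶ a.unop) ⥤ X) ⟶ Cat.of ((l ⟶ b.unop) ⥤ X) :=
  ((Functor.whiskeringLeft _ _ X).obj (postcompFunctor l k.unop)).toCatHom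

/-- The natural transformation between restriction functors that is induced by `δ`. -/
abbrev coindMap₂ {a b : Lᵒᵖ} {k k' : a ⟶ b} (δ : k ⟶ k') : coindMap l X k ⟶ coindMap l X k' :=
  NatTrans.toCatHom₂ ((Functor.whiskeringLeft _ _ X).map (postcompTrans l δ.unop2))

theorem coindMap_id (a : Lᵒᵖ) : coindMap l X (𝟙 a) = 𝟙 (Cat.of ((l ⟶ a.unop) ⥤ X)) :=
  Cat.Hom.ext (functor_ext_of_app
    (fun Φ => congrArg (· ⋙ Φ) (postcompFunctor_id l a.unop))
    (fun ψ f => natTrans_app_congr ψ (Strict.comp_id f)))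

theorem coindMap_comp {a b c : Lᵒᵖ} (k : a ⟶ b) (k' : b ⟶ c) :
    coindMap l X (k ≫ k') = coindMap l X k ≫ coindMap l X k' :=
  Cat.Hom.ext (functor_ext_of_app
    (fun Φ => congrArg (· ⋙ Φ) (postcompFunctor_comp l k'.unop k.unop))
    (fun ψ f => natTrans_app_congr ψ (Strict.assoc f k'.unop k.unop).symm))

theorem coindMap₂_heq {a b : Lᵒᵖ} {F F' G G' : Cat.of ((l ⟶ a.unop) ⥤ X) ⟶
    Cat.of ((l ⟶ b.unop) ⥤ X)} (hF : F = F') (hG : G = G') {η : F ⟶ G} {η' : F' ⟶ G'}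
    (h : ∀ (Φ : (l ⟶ a.unop) ⥤ X) (f : l ⟶ b.unop),
      NatTrans.app (η.toNatTrans.app Φ : F.toFunctor.obj Φ ⟶ G.toFunctor.obj Φ) f ≍
        NatTrans.app (η'.toNatTrans.app Φ : F'.toFunctor.obj Φ ⟶ G'.toFunctor.obj Φ) f) :
    η ≍ η' := by
  subst hF hG
  exact cat_hom₂_heq rfl rfl fun Φ => natTrans_heq_of_app rfl rfl (h Φ)

theorem coindMap₂_whiskerLeft {a b c : Lᵒᵖ} (f : a ⟶ b) {g g' : b ⟶ c} (δ : g ⟶ g') :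
    coindMap₂ l X (f ◁ δ) ≍ coindMap l X f ◁ coindMap₂ l X δ :=
  coindMap₂_heq l X (coindMap_comp l X f g) (coindMap_comp l X f g') (fun Φ k =>
    functor_map_heq Φ (Strict.assoc _ _ _).symm (Strict.assoc _ _ _).symm
      (whisker_assoc_heq k δ.unop2 f.unop).symm)

theorem coindMap₂_whiskerRight {a b c : Lᵒᵖ} {f f' : a ⟶ b} (δ : f ⟶ f') (g : b ⟶ c) :
    coindMap₂ l X (δ ▷ g) ≍ coindMap₂ l X δ ▷ coindMap l X g :=
  coindMap₂_heq l X (coindMap_comp l X f g) (coindMap_comp l X f' g) (fun Φ k =>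
    functor_map_heq Φ (Strict.assoc _ _ _).symm (Strict.assoc _ _ _).symm
      (comp_whiskerLeft_heq k g.unop δ.unop2).symm)

/-- The 2-presheaf on `L` that is coinduced by the category `X` at `l`: its value at `a` is the
category of functors from `L(l, a)` to `X`. -/
def coind : StrictPseudofunctor Lᵒᵖ Cat.{v, v} :=
  StrictPseudofunctor.mk''
    { obj a := Cat.of ((l ⟶ a.unop) ⥤ X)
      map k := coindMap l X k
      map₂ δ := coindMap₂ l X δ
      map₂_id k := Cat.Hom₂.ext (NatTrans.ext (funext fun Φ => NatTrans.ext (funext fun f =>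
        (congrArg Φ.map (Bicategory.whiskerLeft_id f k.unop)).trans (Φ.map_id _))))
      map₂_comp δ δ' := Cat.Hom₂.ext (NatTrans.ext (funext fun Φ => NatTrans.ext (funext fun f =>
        (congrArg Φ.map (Bicategory.whiskerLeft_comp f δ.unop2 δ'.unop2)).trans (Φ.map_comp _ _))))
      map_id a := coindMap_id l X a
      map_comp f g := coindMap_comp l X f g
      map₂_whisker_left f g g' δ := eq_conj_of_heq (coindMap₂_whiskerLeft l X f δ)
        (coindMap_comp l X f g) (coindMap_comp l X f g')
      map₂_whisker_right {_ _ _ f f'} δ g := eq_conj_of_heq (coindMap₂_whiskerRight l X δ g)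
        (coindMap_comp l X f g) (coindMap_comp l X f' g) }

variable {K : Type u} [Bicategory.{v, v} K] [Strict K] {J : StrictPseudofunctor L K} {l X} {F G : K}

/-- The components of a 2-natural transformation from a nerve to a coinduced 2-presheaf. -/
def transFunctor (t : nerveObj J F ⟶ coind l X) (a : L) : (J.obj a ⟶ F) ⥤ (l ⟶ a) ⥤ X :=
  Cat.Hom.toFunctor (TwoNatTrans.app t (op a))

theorem trans_ext {t t' : nerveObj J F ⟶ coind l X}
    (h : ∀ a, transFunctor t a = transFunctor t' a) : t = t' :=
  TwoFunctor.twoNatTrans_ext fun a => Cat.Hom.ext (h a.unop)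

/-- The components of a modification into a coinduced 2-presheaf. -/
def modTrans {t t' : nerveObj J F ⟶ coind l X} (Γ : t ⟶ t') (a : L) :
    transFunctor t a ⟶ transFunctor t' a :=
  Cat.Hom₂.toNatTrans (TwoModification.app Γ (op a))

theorem mod_heq {t t' r r' : nerveObj J F ⟶ coind l X} (ht : t = r) (ht' : t' = r') {Γ : t ⟶ t'}
    {Θ : r ⟶ r'} (h : ∀ (a : L) (d : J.obj a ⟶ F) (f : l ⟶ a),
      ((modTrans Γ a).app d).app f ≍ ((modTrans Θ a).app d).app f) : Γ ≍ Θ := by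
  subst ht ht'
  exact TwoFunctor.modification_heq rfl rfl fun a => cat_hom₂_heq rfl rfl fun d =>
    natTrans_heq_of_app rfl rfl (h a.unop d)

theorem modTrans_heq {t t' r r' : nerveObj J F ⟶ coind l X} (ht : t = r) (ht' : t' = r')
    {Γ : t ⟶ t'} {Θ : r ⟶ r'} (h : Γ ≍ Θ) (a : L) (d : J.obj a ⟶ F) (f : l ⟶ a) :
    ((modTrans Γ a).app d).app f ≍ ((modTrans Θ a).app d).app f := by
  subst ht ht'
  rw [eq_of_heq h]

/-- The functor `L(l, a) → K(J l, F)` that is given by composition with `d`. -/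
@[simps]
def mapComp (J : StrictPseudofunctor L K) (l : L) {a : L} (d : J.obj a ⟶ F) :
    (l ⟶ a) ⥤ (J.obj l ⟶ F) where
  obj f := J.map f ≫ d
  map δ := J.map₂ δ ▷ d
  map_id f := (congrArg (· ▷ d) (J.map₂_id f)).trans (Bicategory.id_whiskerRight _ _)
  map_comp δ δ' := (congrArg (· ▷ d) (J.map₂_comp δ δ')).trans
    (Bicategory.comp_whiskerRight _ _ _)

/-- The components of the 2-natural transformation `coext`. -/
@[simps]
def coextFunctor (S : (J.obj l ⟶ F) ⥤ X) (a : L) : (J.obj a ⟶ F) ⥤ (l ⟶ a) ⥤ X where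
  obj d := mapComp J l d ⋙ S
  map η :=
    { app f := S.map (J.map f ◁ η)
      naturality f f' δ := (S.map_comp _ _).symm.trans
        ((congrArg S.map (whisker_exchange (J.map₂ δ) η).symm).trans (S.map_comp _ _)) }
  map_id d := NatTrans.ext (funext fun f =>
    (congrArg S.map (Bicategory.whiskerLeft_id _ _)).trans (S.map_id _))
  map_comp η θ := NatTrans.ext (funext fun f =>
    (congrArg S.map (Bicategory.whiskerLeft_comp _ _ _)).trans (S.map_comp _ _))

theorem map_comp_comp {a b : L} (f : l ⟶ a) (k : a ⟶ b) (d : J.obj b ⟶ F) :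
    J.map f ≫ J.map k ≫ d = J.map (f ≫ k) ≫ d :=
  (Strict.assoc _ _ _).symm.trans (congrArg (· ≫ d) (J.map_comp f k).symm)

theorem coextFunctor_natural (S : (J.obj l ⟶ F) ⥤ X) {a b : L} (k : a ⟶ b) :
    precompFunctor (J.map k) F ⋙ coextFunctor S a =
      coextFunctor S b ⋙ (Functor.whiskeringLeft _ _ X).obj (postcompFunctor l k) := by
  refine functor_ext_of_app (fun d => ?_) (fun {d d'} η f => ?_)
  · refine CategoryTheory.Functor.hext (fun f => congrArg S.obj (map_comp_comp f k d)) fun f f' δ => ?_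
    refine functor_map_heq S (map_comp_comp f k d) (map_comp_comp f' k d) ?_
    exact (whiskerRight_comp_heq _ _ _).trans (whiskerRight_heq (J.map_comp f k).symm
      (J.map_comp f' k).symm rfl (map₂_whiskerRight_heq J δ k).symm)
  · refine functor_map_heq S (map_comp_comp f k d) (map_comp_comp f k d') ?_
    exact (comp_whiskerLeft_heq _ _ _).symm.trans
      (whiskerLeft_heq (J.map_comp f k).symm rfl rfl HEq.rfl)

/-- The 2-natural transformation to a coinduced 2-presheaf that corresponds to a functor on
`K(J l, F)`. -/
def coext (S : (J.obj l ⟶ F) ⥤ X) : nerveObj J F ⟶ coind l X :=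
  TwoNatTrans.mk (fun a => (coextFunctor S a.unop).toCatHom)
    (fun k => Cat.Hom.ext (coextFunctor_natural S k.unop))
    (fun {a b k k'} δ => cat_hom₂_heq (Cat.Hom.ext (coextFunctor_natural S k.unop))
      (Cat.Hom.ext (coextFunctor_natural S k'.unop)) fun d => by
        refine natTrans_heq_of_app (α := (coextFunctor S b.unop).map (J.map₂ δ.unop2 ▷ d))
          (β := Functor.whiskerRight (postcompTrans l δ.unop2) ((coextFunctor S a.unop).obj d))
          (CategoryTheory.Functor.congr_obj (coextFunctor_natural S k.unop) d)
          (CategoryTheory.Functor.congr_obj (coextFunctor_natural S k'.unop) d) fun f => ?_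
        refine functor_map_heq S (map_comp_comp f k.unop d) (map_comp_comp f k'.unop d) ?_
        exact (whisker_assoc_heq _ _ _).symm.trans (whiskerRight_heq (J.map_comp _ _).symm
          (J.map_comp _ _).symm rfl (map₂_whiskerLeft_heq J f δ.unop2).symm))

/-- The functor on `K(J l, F)` that corresponds to a 2-natural transformation to a coinduced
2-presheaf. -/
def ofTrans (t : nerveObj J F ⟶ coind l X) : (J.obj l ⟶ F) ⥤ X :=
  transFunctor t l ⋙ (CategoryTheory.evaluation (l ⟶ l) X).obj (𝟙 l)

theorem map_id_comp (l : L) (d : J.obj l ⟶ F) : J.map (𝟙 l) ≫ d = d :=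
  (congrArg (· ≫ d) (J.map_id l)).trans (Strict.id_comp d)

theorem map_id_whiskerLeft_heq (l : L) {d d' : J.obj l ⟶ F} (η : d ⟶ d') :
    J.map (𝟙 l) ◁ η ≍ η :=
  (whiskerLeft_heq (J.map_id l) rfl rfl HEq.rfl).trans (id_whiskerLeft_heq η)

/-- The Yoneda argument: evaluation at the identity of `l` undoes `coext`. This half of the
adjunction makes `coext` injective and lets a functor be read off from a 2-natural transformation.
-/
theorem ofTrans_coext (S : (J.obj l ⟶ F) ⥤ X) : ofTrans (coext S) = S :=
  CategoryTheory.Functor.hext (fun d => congrArg S.obj (map_id_comp l d))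
    (fun d d' η => functor_map_heq S (map_id_comp l d) (map_id_comp l d')
      (map_id_whiskerLeft_heq l η))

theorem coext_injective {S S' : (J.obj l ⟶ F) ⥤ X} (h : coext S = coext S') : S = S' := by
  rw [← ofTrans_coext S, h, ofTrans_coext]

theorem coext_comp (h : F ⟶ G) (S : (J.obj l ⟶ G) ⥤ X) :
    nerveTrans J h ≫ coext S = coext (postcompFunctor (J.obj l) h ⋙ S) :=
  trans_ext fun a => functor_ext_of_app
    (fun d => CategoryTheory.Functor.hext (fun f => congrArg S.obj (Strict.assoc _ _ _).symm)
      (fun f f' δ => functor_map_heq S (Strict.assoc _ _ _).symm (Strict.assoc _ _ _).symm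
        (whiskerRight_comp_heq _ _ _)))
    (fun η f => functor_map_heq S (Strict.assoc _ _ _).symm (Strict.assoc _ _ _).symm
      (whisker_assoc_heq _ _ _).symm)

end Coinduced

end TwoCat

namespace TwoCat

/-! ### From absoluteness to universality for hom-categories -/

section Absolute

/-- An oplax normal 2-cocone from structure 2-cells that satisfy the laws up to heterogeneous
equality. -/
@[simps]
def OplaxNormalCocone.ofHEq {A : Type u₁} [Bicategory.{w₁, v₁} A]
    {W : StrictPseudofunctor Aᵒᵖ Cat.{v₂, u₂}} {S : Type u} [Bicategory.{w, v} S] [Strict S]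
    {D : StrictPseudofunctor (Groth W) S} {C : S} (app : ∀ x, D.obj x ⟶ C)
    (cell : ∀ {x y : Groth W} (f : x ⟶ y), app x ⟶ D.map f ≫ app y)
    (cell_id : ∀ x, cell (𝟙 x) ≍ 𝟙 (app x))
    (cell_comp : ∀ {x y z : Groth W} (f : x ⟶ y) (g : y ⟶ z),
      cell (f ≫ g) ≍ cell f ≫ D.map f ◁ cell g)
    (cell_naturality : ∀ {x y : Groth W} {f g : x ⟶ y} (δ : f ⟶ g),
      cell f ≫ D.map₂ δ ▷ app y = cell g)
    (normal : ∀ {x y : Groth W} (f : x ⟶ y), Groth.IsCleavage f →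
      app x = D.map f ≫ app y ∧ cell f ≍ 𝟙 (app x)) : OplaxNormalCocone D C where
  app := app
  cell := cell
  cell_id x := eq_of_heq ((cell_id x).trans (heq_id_of_eqToHom _).symm)
  cell_comp {x y z} f g := by
    have h : D.map f ≫ D.map g ≫ app z = D.map (f ≫ g) ≫ app z := by
      rw [D.map_comp, Strict.assoc]
    refine eq_of_heq ((cell_comp f g).trans
      ((comp_eqToHom_heq (cell f ≫ D.map f ◁ cell g) h).symm.trans (heq_of_eq ?_)))
    exact Category.assoc (cell f) _ _
  cell_naturality := cell_naturality
  normal f hf := ⟨(normal f hf).1, eq_of_heq ((normal f hf).2.trans (heq_id_of_eqToHom _).symm)⟩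

variable {K : Type u} [Bicategory.{v, v} K] [Strict K] {L : Type u₁} [Bicategory.{v, v} L]
  [Strict L] {J : StrictPseudofunctor L K} {l : L} {X : Type v} [Category.{v} X]
  {A : Type u₂} [Bicategory.{w₁, v₁} A]
  {W : StrictPseudofunctor Aᵒᵖ Cat.{v₂, u₃}} {D : StrictPseudofunctor (Groth W) K} {C : K}

namespace HomCocone

variable (σ : HomCocone (J.obj l) D X)

/-- Normality gives the equality on objects; naturality of structure cells that are identities gives
it on morphisms. -/
theorem app_eq_of_isCleavage {x y : Groth W} (f : x ⟶ y) (hf : Groth.IsCleavage f) :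
    σ.app x = postcompFunctor (J.obj l) (D.map f) ⋙ σ.app y :=
  CategoryTheory.Functor.hext (fun d => (σ.normal f hf d).choose) fun d d' η => by
    obtain ⟨h, e⟩ := σ.normal f hf d
    obtain ⟨h', e'⟩ := σ.normal f hf d'
    have hn := σ.cell_natural f η
    rw [e, e'] at hn
    exact (comp_eqToHom_heq _ h').symm.trans
      ((heq_of_eq hn.symm).trans (eqToHom_comp_heq ((σ.app y).map (η ▷ D.map f)) h))

theorem cell_congr {x y : Groth W} (f : x ⟶ y) {d d' : J.obj l ⟶ D.obj x} (h : d = d') :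
    σ.cell f d ≍ σ.cell f d' := by
  subst h; rfl

/-- The components of the structure 2-cells of the transpose of a 2-cocone. -/
def coindCell {x y : Groth W} (f : x ⟶ y) {a : L} (d : J.obj a ⟶ D.obj x) (g : l ⟶ a) :
    (σ.app x).obj (J.map g ≫ d) ⟶ (σ.app y).obj (J.map g ≫ d ≫ D.map f) :=
  σ.cell f (J.map g ≫ d) ≫ (σ.app y).map (α_ (J.map g) d (D.map f)).hom

theorem coindCell_heq {x y : Groth W} (f : x ⟶ y) {a : L} (d : J.obj a ⟶ D.obj x) (g : l ⟶ a) :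
    coindCell σ f d g ≍ σ.cell f (J.map g ≫ d) := by
  rw [coindCell, associator_hom, eqToHom_map]
  exact comp_eqToHom_heq _ _

theorem coindCell_natural {x y : Groth W} (f : x ⟶ y) {a : L} (d : J.obj a ⟶ D.obj x)
    {g g' : l ⟶ a} (δ : g ⟶ g') :
    (σ.app x).map (J.map₂ δ ▷ d) ≫ coindCell σ f d g' =
      coindCell σ f d g ≫ (σ.app y).map (J.map₂ δ ▷ (d ≫ D.map f)) := by
  rw [coindCell, coindCell, ← Category.assoc ((σ.app x).map _), ← σ.cell_natural f,
    Category.assoc (σ.cell f (J.map g ≫ d)), Category.assoc (σ.cell f (J.map g ≫ d)),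
    ← Functor.map_comp, ← Functor.map_comp, associator_naturality_left]

theorem coindCell_natural_right {x y : Groth W} (f : x ⟶ y) {a : L} {d d' : J.obj a ⟶ D.obj x}
    (η : d ⟶ d') (g : l ⟶ a) :
    (σ.app x).map (J.map g ◁ η) ≫ coindCell σ f d' g =
      coindCell σ f d g ≫ (σ.app y).map (J.map g ◁ η ▷ D.map f) := by
  rw [coindCell, coindCell, ← Category.assoc ((σ.app x).map _), ← σ.cell_natural f,
    Category.assoc (σ.cell f (J.map g ≫ d)), Category.assoc (σ.cell f (J.map g ≫ d)),
    ← Functor.map_comp, ← Functor.map_comp, associator_naturality_middle]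

/-- The structure 2-cells of the transpose of a 2-cocone, at an object of `L`. -/
@[simps]
def coindCellTrans {x y : Groth W} (f : x ⟶ y) (a : L) : coextFunctor (σ.app x) a ⟶
    postcompFunctor (J.obj a) (D.map f) ⋙ coextFunctor (σ.app y) a where
  app d :=
    { app g := coindCell σ f d g
      naturality _ _ δ := coindCell_natural σ f d δ }
  naturality _ _ η := NatTrans.ext (funext fun g => coindCell_natural_right σ f η g)

/-- The structure 2-cells of the transpose of a 2-cocone. -/
def coindMod {x y : Groth W} (f : x ⟶ y) :
    coext (σ.app x) ⟶ nerveTrans J (D.map f) ≫ coext (σ.app y) :=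
  TwoModification.mk (fun a => NatTrans.toCatHom₂ (coindCellTrans σ f a.unop))
    (fun {a b} k => cat_hom₂_heq ((coext (σ.app x)).naturality k)
      ((nerveTrans J (D.map f) ≫ coext (σ.app y)).naturality k) fun d =>
        natTrans_heq_of_app
          (α := (coindCellTrans σ f b.unop).app (J.map k.unop ≫ d))
          (β := Functor.whiskerLeft (postcompFunctor l k.unop)
            ((coindCellTrans σ f a.unop).app d))
          (CategoryTheory.Functor.congr_obj (coextFunctor_natural (σ.app x) k.unop) d)
          (CategoryTheory.Functor.congr_obj (congrArg Cat.Hom.toFunctor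
            ((nerveTrans J (D.map f) ≫ coext (σ.app y)).naturality k)) d) fun g =>
          (coindCell_heq σ f _ g).trans ((cell_congr σ f (map_comp_comp g k.unop d)).trans
            (coindCell_heq σ f d (g ≫ k.unop)).symm))

theorem modTrans_coindMod_heq {x y : Groth W} (f : x ⟶ y) {a : L} (d : J.obj a ⟶ D.obj x)
    (g : l ⟶ a) : ((modTrans (coindMod σ f) a).app d).app g ≍ σ.cell f (J.map g ≫ d) :=
  coindCell_heq σ f d g

theorem coext_eq_of_isCleavage {x y : Groth W} (f : x ⟶ y) (hf : Groth.IsCleavage f) :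
    coext (σ.app x) = nerveTrans J (D.map f) ≫ coext (σ.app y) := by
  rw [coext_comp, ← σ.app_eq_of_isCleavage f hf]

/-- The transpose of a 2-cocone for `K(J l, D(-))`: a 2-cocone on the coinduced 2-presheaf. -/
def coindCocone : OplaxNormalCocone (D.comp (tilde J)) (coind l X) :=
  OplaxNormalCocone.ofHEq (D := D.comp (tilde J)) (fun x => coext (σ.app x))
    (fun f => coindMod σ f)
    (fun x => mod_heq rfl (σ.coext_eq_of_isCleavage (𝟙 x) (Groth.isCleavage_id x)).symm
      fun a d g => (modTrans_coindMod_heq σ (𝟙 x) d g).trans (σ.cell_id x _))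
    (fun {x y z} f g => mod_heq rfl
      ((congrArg (fun k => nerveTrans J k ≫ coext (σ.app z)) (D.map_comp f g)).trans
        ((congrArg (· ≫ coext (σ.app z)) (nerveTrans_comp J (D.map f) (D.map g))).trans
          (Strict.assoc _ _ _)))
      fun a d k => by
        refine (modTrans_coindMod_heq σ (f ≫ g) d k).trans ((σ.cell_comp f g _).trans ?_)
        have e₁ := Strict.assoc (J.map k) d (D.map f)
        have e₂ := Strict.assoc (J.map k) (d ≫ D.map f) (D.map g)
        exact heq_comp rfl (congrArg (σ.app y).obj e₁)
          (congrArg (σ.app z).obj ((congrArg (· ≫ D.map g) e₁).trans e₂))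
          (coindCell_heq σ f d k).symm
          ((cell_congr σ g e₁).trans (coindCell_heq σ g (d ≫ D.map f) k).symm))
    (fun {x y f g} δ => eq_of_heq (mod_heq rfl rfl fun a d k => by
      refine HEq.trans (b := σ.cell f (J.map k ≫ d) ≫
        (σ.app y).map ((J.map k ≫ d) ◁ D.map₂ δ)) ?_ ?_
      · have e₁ := Strict.assoc (J.map k) d (D.map f)
        have e₂ := Strict.assoc (J.map k) d (D.map g)
        exact heq_comp rfl (congrArg (σ.app y).obj e₁.symm) (congrArg (σ.app y).obj e₂.symm)
          (coindCell_heq σ f d k)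
          (functor_map_heq (σ.app y) e₁.symm e₂.symm (comp_whiskerLeft_heq _ _ _).symm)
      · exact (heq_of_eq (σ.cell_map₂ δ _)).trans (coindCell_heq σ g d k).symm))
    (fun {x y} f hf => ⟨σ.coext_eq_of_isCleavage f hf,
      mod_heq rfl (σ.coext_eq_of_isCleavage f hf).symm fun a d g => by
        obtain ⟨h, e⟩ := σ.normal f hf (J.map g ≫ d)
        exact (modTrans_coindMod_heq σ f d g).trans ((heq_of_eq e).trans (heq_id_of_eqToHom h))⟩)

end HomCocone

variable {ξ : OplaxNormalCocone D C}

theorem map_tilde_cell_whiskerRight_heq (ξ : OplaxNormalCocone D C) {x y : Groth W} (f : x ⟶ y)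
    (t : nerveObj J C ⟶ coind l X) :
    (ξ.map (tilde J)).cell f ▷ t ≍ nerveModification J (ξ.cell f) ▷ t :=
  whiskerRight_heq rfl (nerveTrans_comp J (D.map f) (ξ.app y)).symm rfl
    (ξ.map_cell_heq (tilde J) f)

/-- Universality of the nerve of ξ is tested against `coind l X`. The transposes of `s` and `s'`
have the same composite with that 2-cocone, hence are equal, and `coext` is injective. -/
theorem IsAbsolute.restrict_injective (hξ : IsAbsolute J ξ) {s s' : (J.obj l ⟶ C) ⥤ X}
    (h : HomCocone.restrict (J.obj l) ξ s = HomCocone.restrict (J.obj l) ξ s') : s = s' := by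
  have happ : ∀ x, nerveTrans J (ξ.app x) ≫ coext s = nerveTrans J (ξ.app x) ≫ coext s' :=
    fun x => by
      rw [coext_comp, coext_comp]
      exact congrArg (fun σ : HomCocone _ _ _ => coext (σ.app x)) h
  refine coext_injective ((hξ (coind l X)).1.1
    (OplaxNormalCocone.postcompObj_eq_of_heq happ fun {x y} f => ?_))
  refine HEq.trans ?_ (OplaxNormalCocone.postcompObj_cell_heq _ _ f).symm
  refine (map_tilde_cell_whiskerRight_heq ξ f _).trans
    (HEq.trans ?_ (map_tilde_cell_whiskerRight_heq ξ f _).symm)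
  refine mod_heq (happ x) ?_ fun a d g => ?_
  · rw [nerveTrans_comp, Strict.assoc, Strict.assoc, happ]
  · have e : J.map g ≫ d ≫ D.map f ≫ ξ.app y = (J.map g ≫ d) ≫ D.map f ≫ ξ.app y :=
      (Strict.assoc _ _ _).symm
    have e' := comp_whiskerLeft_heq (J.map g) d (ξ.cell f)
    refine (functor_map_heq s (Strict.assoc _ _ _).symm e e'.symm).trans
      (HEq.trans ?_ (functor_map_heq s' (Strict.assoc _ _ _).symm e e'.symm).symm)
    exact (HomCocone.restrict_cell_heq ξ s f _).symm.trans
      ((HomCocone.cell_heq_of_eq h f _).trans (HomCocone.restrict_cell_heq ξ s' f _))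

/-- The transpose of σ is a 2-cocone on `coind l X`; absoluteness factors it through a 2-natural
transformation `t`, and evaluation of `t` at the identity of `l` is the extension. -/
theorem IsAbsolute.exists_restrict_eq (hξ : IsAbsolute J ξ) (σ : HomCocone (J.obj l) D X) :
    ∃ s, HomCocone.restrict (J.obj l) ξ s = σ := by
  obtain ⟨t, ht⟩ : ∃ t : nerveObj J C ⟶ coind l X,
    (ξ.map (tilde J)).postcompObj t = σ.coindCocone := (hξ (coind l X)).1.2 _
  have happ : ∀ x, nerveTrans J (ξ.app x) ≫ t = coext (σ.app x) :=
    fun x => OplaxNormalCocone.app_of_postcompObj_eq ht x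
  -- By definition, `ofTrans` of a composite `nerveTrans J h ≫ t` is postcomposition with `h`
  -- followed by `ofTrans t`; so applying `ofTrans` to `happ x` yields the restriction of `ofTrans
  -- t`.
  have hobj : ∀ {x : Groth W} (d : J.obj l ⟶ D.obj x),
      (ofTrans t).obj (d ≫ ξ.app x) = (σ.app x).obj d := fun {x} d =>
    CategoryTheory.Functor.congr_obj ((congrArg ofTrans (happ x)).trans (ofTrans_coext _)) d
  refine ⟨ofTrans t, HomCocone.ext_of_heq
    (fun x => (congrArg ofTrans (happ x)).trans (ofTrans_coext _)) fun {x y} f d => ?_⟩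
  refine (HomCocone.restrict_cell_heq ξ _ f d).trans ?_
  have hcell := (map_tilde_cell_whiskerRight_heq ξ f t).symm.trans
    (OplaxNormalCocone.cell_of_postcompObj_eq ht f)
  have e : nerveTrans J (D.map f ≫ ξ.app y) ≫ t =
      nerveTrans J (D.map f) ≫ coext (σ.app y) := by
    rw [nerveTrans_comp, Strict.assoc, happ]
  -- The image under `ofTrans t` of the whiskered structure 2-cell is the component of the
  -- modification in `hcell` at `d` and the identity of `l`.
  refine (modTrans_heq (happ x) e hcell l d (𝟙 l)).trans ?_
  exact (HomCocone.modTrans_coindMod_heq σ f d (𝟙 l)).trans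
    (HomCocone.cell_congr σ f (map_id_comp l d))

/-- An absolute 2-cocone is universal for the hom-categories out of the objects in the image of
`J`. -/
theorem IsAbsolute.homUniversal (hξ : IsAbsolute J ξ) (l : L) : HomUniversal (J.obj l) ξ :=
  fun X _ => ⟨fun _ _ h => hξ.restrict_injective h, fun σ => hξ.exists_restrict_eq σ⟩

end Absolute

end TwoCat

theorem mainTheorem6 {K : Type u} [Bicategory.{v, v} K] [Strict K]
    (hK : IsFinitelyComplete K)
    {L : Type u₁} [Bicategory.{v, v} L] [Strict L] (J : StrictPseudofunctor L K)
    (hJ : IsFullyFaithful J) (hd : IsDense J)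
    {E B : K} (τ : E ⟶ B) (c : SplitOpfibration τ)
    (P : ∀ (X : K) (F : X ⟶ B), TwoPullback F τ)
    {A : Type u₂} [Bicategory.{w₂, v₂} A] [Strict A]
    (W : StrictPseudofunctor Aᵒᵖ Cat.{v₃, u₃})
    (H : StrictPseudofunctor (Groth W) (LaxSlice K B))
    (hH : ∀ {x y : Groth W} (f : x ⟶ y), Groth.IsCleavage f → LaxSlice.IsTight (H.map f))
    (C : LaxSlice K B) (ζ : OplaxNormalCocone H C) (hζ : ζ.IsUniversal)
    (ht : ∀ x : Groth W, LaxSlice.IsTight (ζ.app x))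
    (habs : IsAbsolute J (ζ.map (LaxSlice.domFunctor K B))) :
    (ζ.map (changeOfBase c P)).IsUniversal := by
  have h₁ : ∀ l : L, HomUniversal (J.obj l) (ζ.map (LaxSlice.domFunctor K B)) :=
    fun l => IsAbsolute.homUniversal habs l
  have h₂ : ∀ l : L, HomUniversal (J.obj l)
      ((ζ.map (changeOfBase c P)).map (LaxSlice.domFunctor K E)) :=
    fun l => (h₁ l).changeOfBase c P ht hH
  -- The components of `τ^* ∘ ζ` are tight because `τ^*` preserves tightness, so only the domain of
  -- the 2-cocone has to be universal; density reduces this to `h₂`.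
  exact LaxSlice.isUniversal_of_domFunctor (fun x => ChangeOfBase.isTight_map c P (ht x))
    (HomUniversal.isUniversal h₂ hd)
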